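/- Let $a<b$, $T>0$, let $k\ge 1$ be an integer, let $\rho>0$, and let $N_e\ge 1$ be a fixed integer. Consider $u_t+u_x=0$ on $[a,b]\times(0,T]$, $u(\cdot,0)=u_0$ on $[a,b]$, with either the periodic condition $u(a,t)=u(b,t)$ or the inflow condition $u(a,t)=g(t)$, $t\in[0,T]$. **Mesh.** Let $a=x_{1/2}<x_{3/2}<\dots<x_{N+1/2}=b$, $\tau_i=(x_{i-1/2},x_{i+1/2})$, $h_i=x_{i+1/2}-x_{i-1/2}$, and $h=\max_i h_i$, with $h\le\rho h_i$ for all $i$. Each $\tau_i$ is divided by points $x_{i-1/2}=x_{i,0}<x_{i,1}<\dots<x_{i,k+1}=x_{i+1/2}$, where $x_{i,1},\dots,x_{i,k}$ are either the $k$ Gauss points of $\tau_i$ (OF-LSV) or the interior right Radau points of $\tau_i$, i.e. the zeros other than $x_{i+1/2}$ of $L_{i,k+1}-L_{i,k}$, with $L_{i,n}$ the Legendre polynomial of degree $n$ on $\tau_i$ (OF-RRSV). **Scheme.** Let $P^l$ be the $L^2$ projection onto polynomials of degree at most $l$ on each $\tau_i$, with $P^{-1}:=P^0$. The numerical solution $u_h(\cdot,t)$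 is on each $\tau_i$ a polynomial of degree at most $k$. As a function of $t$ it is continuous on $[0,T]$ and differentiable on $(0,T]$, and for $1\le i\le N$, $0\le j\le k$, $t\in(0,T]$, $$\int_{x_{i,j}}^{x_{i,j+1}}\partial_t u_h\,dx+u_h^-(x_{i,j+1},t)-u_h^-(x_{i,j},t)+\sum_{l=0}^k\frac{\sigma_i^l}{h_i}\int_{x_{i,j}}^{x_{i,j+1}}(u_h-P^{l-1}u_h)\,dx=0,$$ $$\sigma_i^l=\frac{2(2l+1)}{2k-1}\,\frac{h^l}{l!}\Big(\tfrac1{N_e}\big([\![\partial_x^l u_h]\!]_{i-1/2}^2+[\![\partial_x^l u_h]\!]_{i+1/2}^2\big)\Big)^{1/2}.$$ Here $u_h^-$ is the left limit; at $x_{1,0}=a$ it is $u_h(b^-,t)$ in the periodic case and $g(t)$ in the inflow case. $[\![\cdot]\!]$ is the right limit minus the left limit. At the endpoints $a,b$ the jump is taken periodically in the periodic case. In the inflow case it is zero at $b$, and at $a$ it is, as a fixed choice in the definition of the scheme, either always zero or always $\partial_x^l u_h(a^+,t)-(-1)^l g^{(l)}(t)$; the result holds for both choices. Initially $u_h(\cdot,0)=(u_0)_I$,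 i.e. $u_h(x_{i,j}^-,0)=u_0(x_{i,j})$ for $1\le i\le N$, $1\le j\le k+1$. **Theorem.** For each of the two methods there is a function $C:\mathbb R\to\mathbb R$ depending only on $k,a,b,T,\rho,N_e$ such that the following holds. Let $u$ be the exact solution: continuous on $[a,b]\times[0,T]$, differentiable on $[a,b]\times(0,T]$, satisfying there the equation, and satisfying the initial and boundary conditions. Assume $u(\cdot,t)\in H^{k+2}(a,b)$ for every $t\in[0,T]$. Then $M:=\sup_{t\in[0,T]}\|u(\cdot,t)\|_{H^{k+2}(a,b)}$ is finite, and for every mesh as above, every solution $u_h$ of the scheme and every $t\in[0,T]$, $$\|(u-u_h)(\cdot,t)\|_{L^2(a,b)}\le C(M)\,h^{k+1}.$$ -/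

import Mathlib

noncomputable section

namespace OFSV

open Polynomial Set MeasureTheory
open scoped ContDiff Nat

/-! ### Sobolev spaces on a bounded interval -/

/-- `w` is the `j`-th weak derivative of `f` on `(a, b)`. -/
def IsWeakDeriv (a b : ℝ) (j : ℕ) (f w : ℝ → ℝ) : Prop :=
  LocallyIntegrableOn w (Ioo a b) ∧
  ∀ η : ℝ → ℝ, ContDiff ℝ ∞ η → HasCompactSupport η → tsupport η ⊆ Ioo a b →
    ∫ x in Ioo a b, f x * iteratedDeriv j η x = (-1) ^ j * ∫ x in Ioo a b, w x * η x

/-- `f ∈ Hⁿ(a, b)`: `f` and its weak derivatives up to order `n` are square integrable. -/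
def MemH (a b : ℝ) (n : ℕ) (f : ℝ → ℝ) : Prop :=
  MemLp f 2 (volume.restrict (Ioo a b)) ∧
  ∀ j ≤ n, ∃ w : ℝ → ℝ, MemLp w 2 (volume.restrict (Ioo a b)) ∧ IsWeakDeriv a b j f w

/-- A choice of the `j`-th weak derivative (almost everywhere unique when it exists). -/
def weakDeriv (a b : ℝ) (j : ℕ) (f : ℝ → ℝ) : ℝ → ℝ :=
  Classical.epsilon (IsWeakDeriv a b j f)

/-- The `Hⁿ(a, b)` norm. -/
def hNorm (a b : ℝ) (n : ℕ) (f : ℝ → ℝ) : ℝ :=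
  √(∑ j ∈ Finset.range (n + 1), ∫ x in Ioo a b, (weakDeriv a b j f x) ^ 2)

/-! ### The advection problem -/

/-- Boundary conditions: periodic, or inflow data `g` at the left endpoint. For the inflow problem
the flag fixes how the damping coefficients treat the endpoints: with `false` only the jumps at
interior mesh points count; with `true` the jump at the inflow endpoint is also counted, its
exterior trace being computed from `g`. -/
inductive BoundaryCondition where
  | periodic
  | inflow (g : ℝ → ℝ) (useData : Bool)

/-- `u` satisfies the boundary condition on the time interval `[0, T]`. -/
def BoundaryCondition.Holds (bc : BoundaryCondition) (a b T : ℝ) (u : ℝ → ℝ → ℝ) : Prop :=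
  match bc with
  | .periodic => ∀ t ∈ Icc 0 T, u a t = u b t
  | .inflow g _ => ∀ t ∈ Icc 0 T, u a t = g t

/-- `u = u(x, t)` is a classical solution of `u_t + u_x = 0` on `[a, b] × (0, T]`, continuous up to
`t = 0`, with initial value `u₀` and the boundary condition `bc`. -/
structure IsExactSolution (bc : BoundaryCondition) (a b T : ℝ) (u₀ : ℝ → ℝ)
    (u : ℝ → ℝ → ℝ) : Prop where
  continuousOn : ContinuousOn (fun p : ℝ × ℝ => u p.1 p.2) (Icc a b ×ˢ Icc 0 T)
  pde : ∀ x ∈ Icc a b, ∀ t ∈ Ioc 0 T, ∃ D : ℝ × ℝ →L[ℝ] ℝ,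
    HasFDerivWithinAt (fun p : ℝ × ℝ => u p.1 p.2) D (Icc a b ×ˢ Icc 0 T) (x, t) ∧
    D (0, 1) + D (1, 0) = 0
  initial : ∀ x ∈ Icc a b, u x 0 = u₀ x
  boundary : bc.Holds a b T u

/-! ### Meshes and control volumes -/

/-- A partition `a = x₀ < x₁ < ⋯ < x_N = b` into the spectral volumes `(x_i, x_{i+1})`, `i < N`.
Only the values `node i` with `i ≤ N` matter. -/
structure Mesh (a b : ℝ) where
  N : ℕ
  node : ℕ → ℝ
  node_zero : node 0 = a
  node_last : node N = b
  node_lt : ∀ i < N, node i < node (i + 1)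

namespace Mesh

variable {a b : ℝ} (m : Mesh a b)

/-- The length of the `i`-th spectral volume. -/
def len (i : ℕ) : ℝ := m.node (i + 1) - m.node i

/-- The mesh size `h`. -/
def h : ℝ := ⨆ i : Fin m.N, m.len i

/-- Shape regularity with constant `ρ`. -/
def Regular (ρ : ℝ) : Prop := ∀ i < m.N, m.h ≤ ρ * m.len i

/-- The point with reference coordinate `s j ∈ [0, 1]` in the `i`-th spectral volume. -/
def pt (s : ℕ → ℝ) (i j : ℕ) : ℝ := m.node i + m.len i * s j

end Mesh

/-- The Legendre polynomial of degree `n`, transplanted from `[-1, 1]` to `[0, 1]` (positive leading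
coefficient, value `1` at the right endpoint). -/
def legendre (n : ℕ) : ℝ[X] := (-1) ^ n * (shiftedLegendre n).map (Int.castRingHom ℝ)

/-- The two choices of control volumes: Gauss points (OF-LSV), right Radau points (OF-RRSV). -/
inductive Family where
  | gauss
  | rightRadau

/-- The polynomial on `[0, 1]` whose zeros in `(0, 1)` are the interior control-volume points. -/
def Family.nodal (F : Family) (k : ℕ) : ℝ[X] :=
  match F with
  | .gauss => legendre k
  | .rightRadau => legendre (k + 1) - legendre k

/-- `0 = s₀ < s₁ < ⋯ < s_{k+1} = 1` where `s₁, …, s_k` are the Gauss points, respectively the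
interior right Radau points, of `[0, 1]`. Only `s j` with `j ≤ k + 1` matters. -/
structure IsCVPoints (F : Family) (k : ℕ) (s : ℕ → ℝ) : Prop where
  zero : s 0 = 0
  last : s (k + 1) = 1
  lt : ∀ j ≤ k, s j < s (j + 1)
  root : ∀ j, 1 ≤ j → j ≤ k → (F.nodal k).IsRoot (s j)

/-! ### The local `L²` projection -/

/-- `q` is the `L²(α, β)` projection of `p` onto the polynomials of degree at most `n`. -/
def IsL2Proj (α β : ℝ) (n : ℕ) (p q : ℝ[X]) : Prop :=
  q.natDegree ≤ n ∧
  ∀ r : ℝ[X], r.natDegree ≤ n → ∫ x in α..β, (p - q).eval x * r.eval x = 0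

/-- The `L²(α, β)` projection onto the polynomials of degree at most `n`. -/
def l2Proj (α β : ℝ) (n : ℕ) (p : ℝ[X]) : ℝ[X] := Classical.epsilon (IsL2Proj α β n p)

theorem eq_zero_of_integral_sq {α β : ℝ} (hαβ : α < β) (q : ℝ[X])
    (hq : ∫ x in α..β, q.eval x * q.eval x = 0) : q = 0 := by
  by_contra hne
  have hroots : (Icc α β \ {x | q.IsRoot x}).Nonempty :=
    ((Icc_infinite hαβ).sdiff (Polynomial.finite_setOfPred_isRoot hne)).nonempty
  obtain ⟨c, hc, hcr⟩ := hroots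
  have := intervalIntegral.integral_pos hαβ
    (f := fun x => q.eval x * q.eval x) (by fun_prop)
    (fun x _ => mul_self_nonneg _) ⟨c, hc, mul_self_pos.2 hcr⟩
  exact this.ne' hq

theorem exists_isL2Proj {α β : ℝ} (hαβ : α < β) (n : ℕ) (p : ℝ[X]) :
    ∃ q, IsL2Proj α β n p q := by
  have hint : ∀ q r : ℝ[X], IntervalIntegrable (fun x => q.eval x * r.eval x) volume α β :=
    fun q r => Continuous.intervalIntegrable (by fun_prop) _ _
  let B : ℝ[X] →ₗ[ℝ] ℝ[X] →ₗ[ℝ] ℝ :=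
    LinearMap.mk₂ ℝ (fun q r => ∫ x in α..β, q.eval x * r.eval x)
      (fun q q' r => by
        simp only [eval_add, add_mul]
        exact intervalIntegral.integral_add (hint _ _) (hint _ _))
      (fun c q r => by
        simp only [eval_smul, smul_eq_mul, mul_assoc]
        exact intervalIntegral.integral_const_mul _ _)
      (fun q r r' => by
        simp only [eval_add, mul_add]
        exact intervalIntegral.integral_add (hint _ _) (hint _ _))
      (fun c q r => by
        simp only [eval_smul, smul_eq_mul, mul_left_comm _ c]
        exact intervalIntegral.integral_const_mul _ _)
  let W : Submodule ℝ ℝ[X] := degreeLT ℝ (n + 1)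
  have hW : ∀ r : ℝ[X], r.natDegree ≤ n ↔ r ∈ W := fun r => by
    simp only [W, mem_degreeLT, degree_lt_iff_coeff_zero, natDegree_le_iff_coeff_eq_zero,
      Nat.succ_le_iff]
  have : FiniteDimensional ℝ W := Module.Finite.equiv (degreeLTEquiv ℝ (n + 1)).symm
  let Φ : W →ₗ[ℝ] Module.Dual ℝ W := (B.domRestrict₁₂ W W)
  have hinj : Function.Injective Φ := by
    rw [← LinearMap.ker_eq_bot, LinearMap.ker_eq_bot']
    intro q hq
    have h0 : Φ q q = 0 := by rw [hq]; rfl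
    exact Subtype.ext (eq_zero_of_integral_sq hαβ q.1 h0)
  have hsurj : Function.Surjective Φ :=
    (LinearMap.injective_iff_surjective_of_finrank_eq_finrank
      (Subspace.dual_finrank_eq (K := ℝ) (V := W)).symm).1 hinj
  obtain ⟨q, hq⟩ := hsurj ((B p).domRestrict W)
  refine ⟨q.1, (hW _).2 q.2, fun r hr => ?_⟩
  have h1 : B q.1 r = B p r := congrArg (fun f => f ⟨r, (hW r).1 hr⟩) hq
  have h2 : B (p - q.1) r = 0 := by simp [h1]
  exact h2

theorem isL2Proj_l2Proj {α β : ℝ} (hαβ : α < β) (n : ℕ) (p : ℝ[X]) :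
    IsL2Proj α β n p (l2Proj α β n p) :=
  Classical.epsilon_spec (exists_isL2Proj hαβ n p)

/-! ### The scheme

A broken polynomial is a family `v : ℕ → ℝ[X]`, `v i` being its restriction to the `i`-th spectral
volume; only indices `i < N` matter. -/

section Scheme

variable {a b : ℝ} (m : Mesh a b) (bc : BoundaryCondition) (T : ℝ)

/-- The jump `⟦∂ₓˡ v⟧` (right minus left trace) at the mesh point `x_n`, at time `t`. With inflow
data the exterior trace of `∂ₓˡ` at the left endpoint is `(-1)ˡ g⁽ˡ⁾(t)`, as the equation
`u_x = -u_t` dictates. -/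
def jump (v : ℕ → ℝ[X]) (t : ℝ) (l n : ℕ) : ℝ :=
  if n = 0 ∨ n = m.N then
    match bc with
    | .periodic => (derivative^[l] (v 0)).eval a - (derivative^[l] (v (m.N - 1))).eval b
    | .inflow g useData =>
        if n = 0 ∧ useData = true then
          (derivative^[l] (v 0)).eval a - (-1) ^ l * iteratedDerivWithin l g (Icc 0 T) t
        else 0
  else (derivative^[l] (v n)).eval (m.node n) - (derivative^[l] (v (n - 1))).eval (m.node n)

/-- The damping coefficient `σ_iˡ`; `nE` is the number by which the sum over the end points of the
spectral volume is divided. -/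
def sigma (k nE : ℕ) (v : ℕ → ℝ[X]) (t : ℝ) (i l : ℕ) : ℝ :=
  2 * (2 * (l : ℝ) + 1) / (2 * (k : ℝ) - 1) * (m.h ^ l / (l ! : ℝ)) *
    √(1 / (nE : ℝ) * (jump m bc T v t l i ^ 2 + jump m bc T v t l (i + 1) ^ 2))

/-- The upwind (left) trace `v⁻_{i,j}` at the point `x_{i,j}`, at time `t`. -/
def upwind (s : ℕ → ℝ) (v : ℕ → ℝ[X]) (t : ℝ) (i j : ℕ) : ℝ :=
  if j = 0 then
    if i = 0 then
      match bc with
      | .periodic => (v (m.N - 1)).eval b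
      | .inflow g _ => g t
    else (v (i - 1)).eval (m.node i)
  else (v i).eval (m.pt s i j)

/-- The form `a_h(v, w*)` at time `t`, for a time-dependent broken polynomial `v` and the piecewise
constant `w*` with value `w i j` on the control volume `(x_{i,j}, x_{i,j+1})`. The truncated
subtraction `l - 1` implements the convention `P_h^{-1} = P_h^0`. -/
def form (k nE : ℕ) (s : ℕ → ℝ) (v : ℕ → ℝ → ℝ[X]) (w : ℕ → ℕ → ℝ) (t : ℝ) : ℝ :=
  ∑ i ∈ Finset.range m.N, ∑ j ∈ Finset.range (k + 1), w i j *
    ((∫ x in m.pt s i j..m.pt s i (j + 1),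
        derivWithin (fun r => (v i r).eval x) (Icc 0 T) t)
      + upwind m bc s (fun n => v n t) t i (j + 1) - upwind m bc s (fun n => v n t) t i j
      + ∑ l ∈ Finset.range (k + 1), sigma m bc T k nE (fun n => v n t) t i l / m.len i *
          ∫ x in m.pt s i j..m.pt s i (j + 1),
            (v i t - l2Proj (m.node i) (m.node (i + 1)) (l - 1) (v i t)).eval x)

/-- `uh` solves the semi-discrete scheme on `[0, T]`, starting from the Lagrange interpolant of
`u₀` at the points `x_{i,j}`, `1 ≤ j ≤ k + 1`. -/
structure IsSolution (k nE : ℕ) (s : ℕ → ℝ) (u₀ : ℝ → ℝ) (uh : ℕ → ℝ → ℝ[X]) : Prop where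
  natDegree_le : ∀ i < m.N, ∀ t ∈ Icc 0 T, (uh i t).natDegree ≤ k
  continuousOn : ∀ i < m.N, ∀ x : ℝ, ContinuousOn (fun t => (uh i t).eval x) (Icc 0 T)
  differentiable : ∀ i < m.N, ∀ x : ℝ, ∀ t ∈ Ioc 0 T,
    DifferentiableWithinAt ℝ (fun r => (uh i r).eval x) (Icc 0 T) t
  scheme : ∀ t ∈ Ioc 0 T, ∀ w : ℕ → ℕ → ℝ, form m bc T k nE s uh w t = 0
  initial : ∀ i < m.N, ∀ j, 1 ≤ j → j ≤ k + 1 →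
    (uh i 0).eval (m.pt s i j) = u₀ (m.pt s i j)

/-- The `L²(a, b)` distance between a function and a broken polynomial. -/
def l2Error (f : ℝ → ℝ) (v : ℕ → ℝ[X]) : ℝ :=
  √(∑ i ∈ Finset.range m.N, ∫ x in m.node i..m.node (i + 1), (f x - (v i).eval x) ^ 2)

end Scheme

end OFSV

end

noncomputable section

namespace OFSV

open Polynomial Set MeasureTheory
open scoped ContDiff Nat

/-! ### Legendre polynomials and the quadrature rules attached to the control volumes -/

/-! The scheme is a Petrov-Galerkin method that can be rewritten as an upwind discontinuous Galerkin
method with a modified inner product. The right end points of the control volumes carry a quadrature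
rule with nonnegative weights, exact below degree `2k` and, in degree `2k`, off by `β ≥ 0` times the
leading coefficient (`IsCVPoints.exists_quadrature`). To a polynomial `w` on a cell one attaches the
piecewise constant `testVal`, obtained by integrating `w'` with this rule. Summation by parts then
turns the control-volume fluxes into the discontinuous Galerkin fluxes (`sum_testVal_mul_flux`), and
the time derivative is paired through the `L²` product plus a nonnegative multiple of the product of
leading coefficients (`sum_testVal_mul_integral`, `massForm`).

Let `e` be the numerical solution minus the interpolant of `u` at the right end points.
Interpolation is exact at these points, so the fluxes produce no consistency error. Using `u_t =
-u_x`, all that remains besides the damping is the interpolation error of `u_x`, of order `k + 1`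
because `u` lies in `H^{k+2}` (`integral_errDot`). The upwind flux terms are dissipative after
summation over the cells, with both boundary conditions (`sum_sq_upwindErr_le`).

The nonlinear damping is handled by writing `u_h = e + p` with `p` the interpolant. The part of the
damping that acts on `e` has a sign, since `e - P e` is orthogonal to `P e` and `P` does not reach
degree `k`; the other part is bounded by the slope of `p`, hence by `M`
(`neg_sum_testVal_mul_damping_le`). The coefficient `σ` is itself small: exact derivatives do not
jump, so inverse and interpolation estimates bound the jumps of `u_h` by `e` plus a term of optimal
order (`trace_error_le`, `jump_le`). The remaining damping term is therefore a product of two error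
quantities with a bounded factor, and Young's inequality makes it quadratic. No a priori smallness
of `e` is needed.

Altogether the energy `E` satisfies `E' ≤ P (E + h^{2k+2})` with `E(0) = 0`, where `P` is
`growthRate`, and Grönwall's inequality finishes the estimate (`sum_cellSq_err_le`, `l2Error_le`).

Finiteness of `M` is a separate matter. Along characteristics each `u(·,t)` is glued from translates
of its values at an earlier and a later time at most `b - a` apart, so finitely many times control
all others (`bddAbove_hNorm`). The same transport identifies time derivatives at the end points with
space derivatives up to sign, which shows that the boundary jumps of the exact solution vanish
(`iteratedDerivWithin_eq`). -/

theorem intervalIntegrable_eval (p : ℝ[X]) (α β : ℝ) :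
    IntervalIntegrable (fun x => p.eval x) volume α β :=
  p.continuous.intervalIntegrable _ _

theorem integral_derivative_mul (p q : ℝ[X]) (α β : ℝ) :
    ∫ x in α..β, (derivative p * q).eval x =
      p.eval β * q.eval β - p.eval α * q.eval α - ∫ x in α..β, (p * derivative q).eval x := by
  have h := intervalIntegral.integral_eq_sub_of_hasDerivAt (a := α) (b := β)
    (fun x _ => (p * q).hasDerivAt x) (intervalIntegrable_eval _ _ _)
  rw [derivative_mul] at h
  simp only [eval_add] at h
  rw [intervalIntegral.integral_add (intervalIntegrable_eval _ _ _)
    (intervalIntegrable_eval _ _ _)] at h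
  simp only [eval_mul] at h ⊢
  linarith

theorem degree_derivative_lt_of_lt_succ {r : ℝ[X]} {j : ℕ} (hr : r.degree < (j + 1 : ℕ)) :
    (derivative r).degree < j := by
  rw [degree_lt_iff_coeff_zero] at hr ⊢
  intro i hi
  rw [coeff_derivative, hr (i + 1) (by omega), zero_mul]

/-- Repeated integration by parts in Rodrigues' formula. Before the last derivative, `X ^ n * (1 -
X) ^ n` still has zeros at both end points, so no boundary terms appear, and each step lowers the
degree of `r`. -/
theorem integral_iterate_derivative_mul_eq_zero (n : ℕ) {j : ℕ} (hj : j ≤ n) (r : ℝ[X])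
    (hr : r.degree < j) :
    ∫ x in (0 : ℝ)..1, (derivative^[j] ((X : ℝ[X]) ^ n * (1 - X) ^ n) * r).eval x = 0 := by
  induction j generalizing r with
  | zero =>
    have : r = 0 := by
      ext i; exact (degree_lt_iff_coeff_zero _ _).1 hr i (Nat.zero_le i)
    simp [this]
  | succ j ih =>
    have h0 : (derivative^[j] ((X : ℝ[X]) ^ n * (1 - X) ^ n)).eval 0 = 0 := by
      have := pow_sub_dvd_iterate_derivative_of_pow_dvd (p := (X : ℝ[X]) ^ n * (1 - X) ^ n)
        (q := X) (n := n) j (Dvd.intro _ rfl)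
      obtain ⟨q, hq⟩ := this
      rw [hq, eval_mul, eval_pow, eval_X, zero_pow (by omega), zero_mul]
    have h1 : (derivative^[j] ((X : ℝ[X]) ^ n * (1 - X) ^ n)).eval 1 = 0 := by
      have := pow_sub_dvd_iterate_derivative_of_pow_dvd (p := (X : ℝ[X]) ^ n * (1 - X) ^ n)
        (q := 1 - X) (n := n) j (Dvd.intro_left _ rfl)
      obtain ⟨q, hq⟩ := this
      rw [hq, eval_mul, eval_pow]
      simp [zero_pow (show n - j ≠ 0 by omega)]
    rw [Function.iterate_succ_apply', integral_derivative_mul, h0, h1,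
      ih (by omega) _ (degree_derivative_lt_of_lt_succ hr)]
    simp

theorem integral_legendre_mul_eq_zero (n : ℕ) (r : ℝ[X]) (hr : r.degree < n) :
    ∫ x in (0 : ℝ)..1, (legendre n * r).eval x = 0 := by
  have h := integral_iterate_derivative_mul_eq_zero n le_rfl r hr
  have hL : (n ! : ℝ[X]) * (shiftedLegendre n).map (Int.castRingHom ℝ) =
      derivative^[n] ((X : ℝ[X]) ^ n * (1 - X) ^ n) := by
    have := congrArg (Polynomial.map (Int.castRingHom ℝ)) (factorial_mul_shiftedLegendre_eq n)
    simpa [← iterate_derivative_map] using this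
  rw [← hL] at h
  have : ∀ x : ℝ, (legendre n * r).eval x = ((-1) ^ n * ((n ! : ℝ))⁻¹) *
      (((n ! : ℝ[X]) * (shiftedLegendre n).map (Int.castRingHom ℝ)) * r).eval x := by
    intro x
    have hn : (n ! : ℝ) ≠ 0 := by positivity
    simp only [legendre, eval_mul, eval_pow, eval_neg, eval_one, eval_natCast]
    field_simp
  simp_rw [this]
  rw [intervalIntegral.integral_const_mul, h, mul_zero]

theorem natDegree_legendre (n : ℕ) : (legendre n).natDegree = n := by
  have : legendre n = C ((-1 : ℝ) ^ n) * (shiftedLegendre n).map (Int.castRingHom ℝ) := by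
    simp [legendre]
  rw [this, natDegree_C_mul (by positivity),
    natDegree_map_eq_of_injective (RingHom.injective_int _), natDegree_shiftedLegendre]

theorem legendre_eval_one (n : ℕ) : (legendre n).eval 1 = 1 := by
  have h := shiftedLegendre_eval_symm n (1 : ℝ)
  have h0 : aeval (0 : ℝ) (shiftedLegendre n) = 1 := by
    have := coeff_shiftedLegendre n 0
    rw [aeval_def, eval₂_eq_eval_map, ← coeff_zero_eq_eval_zero, coeff_map, this]
    simp
  rw [sub_self, h0, aeval_def, eval₂_eq_eval_map] at h
  simp only [legendre, eval_mul, eval_pow, eval_neg, eval_one]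
  have h' : eval 1 (map (Int.castRingHom ℝ) (shiftedLegendre n)) = (-1) ^ n * 1 := h
  rw [h', ← mul_assoc, ← mul_pow]
  simp

/-! ### Interpolatory quadrature with an orthogonal nodal polynomial -/

theorem eq_C_mul_nodal {S : Finset ℕ} {v : ℕ → ℝ} (hv : InjOn v S) {P : ℝ[X]} (hP0 : P ≠ 0)
    (hP : P.natDegree = S.card) (hroot : ∀ j ∈ S, P.eval (v j) = 0) :
    P = C P.leadingCoeff * Lagrange.nodal S v := by
  have hlc : P.leadingCoeff ≠ 0 := leadingCoeff_ne_zero.2 hP0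
  rw [← sub_eq_zero]
  refine Polynomial.eq_zero_of_degree_lt_of_eval_index_eq_zero S hv ?_ ?_
  · have hdeg : P.degree = (C P.leadingCoeff * Lagrange.nodal S v).degree := by
      rw [degree_C_mul hlc, Lagrange.degree_nodal, degree_eq_natDegree hP0, hP]
    have := degree_sub_lt_left hdeg hP0 (by
      rw [leadingCoeff_mul, leadingCoeff_C, Lagrange.nodal_monic.leadingCoeff, mul_one])
    rwa [degree_eq_natDegree hP0, hP] at this
  · intro j hj
    rw [eval_sub, hroot j hj, eval_mul, Lagrange.eval_nodal_at_node hj]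
    simp

/-- Interpolatory quadrature on `[0, 1]` with nodal polynomial orthogonal to degree `< k`. -/
theorem integral_eq_sum_of_orthogonal {S : Finset ℕ} {v : ℕ → ℝ} (hv : InjOn v S) {k : ℕ}
    (hk : k ≤ S.card)
    (horth : ∀ r : ℝ[X], r.degree < k →
      ∫ x in (0 : ℝ)..1, (Lagrange.nodal S v * r).eval x = 0)
    (f : ℝ[X]) (hf : f.natDegree < k + S.card) :
    ∫ x in (0 : ℝ)..1, f.eval x =
      ∑ j ∈ S, (∫ x in (0 : ℝ)..1, (Lagrange.basis S v j).eval x) * f.eval (v j) := by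
  set W := Lagrange.nodal S v with hW
  have hmon : W.Monic := Lagrange.nodal_monic
  -- Gauss's argument: the quotient by the nodal polynomial is killed by orthogonality, and the
  -- remainder is the interpolant of `f`.
  have hdiv : f %ₘ W + W * (f /ₘ W) = f := modByMonic_add_div f W
  have hq : (f /ₘ W).degree < k := by
    by_cases h0 : f /ₘ W = 0
    · rw [h0, degree_zero]; exact WithBot.bot_lt_coe _
    · rw [degree_eq_natDegree h0, natDegree_divByMonic f hmon, Lagrange.natDegree_nodal]
      norm_cast
      have hne : ¬ f.degree < W.degree := fun h => h0 ((divByMonic_eq_zero_iff hmon).2 h)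
      -- For `k = 0` the degree of `f` is below that of `W`, so the quotient would be zero.
      have : k ≠ 0 := by
        rintro rfl
        apply hne
        rw [Lagrange.degree_nodal]
        exact (degree_le_natDegree).trans_lt (by exact_mod_cast (by omega))
      omega
  have hr : (f %ₘ W).degree < S.card := by
    have := degree_modByMonic_lt f hmon
    rwa [Lagrange.degree_nodal] at this
  have hev : ∀ j ∈ S, (f %ₘ W).eval (v j) = f.eval (v j) := by
    intro j hj
    have := congrArg (eval (v j)) hdiv
    rw [eval_add, eval_mul, hW, Lagrange.eval_nodal_at_node hj, zero_mul, add_zero] at this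
    exact this
  have hint : f %ₘ W = ∑ j ∈ S, C (f.eval (v j)) * Lagrange.basis S v j := by
    rw [Lagrange.eq_interpolate_of_eval_eq (r := fun j => f.eval (v j)) hv hr hev,
      Lagrange.interpolate_apply]
  conv_lhs => rw [← hdiv]
  simp only [eval_add]
  rw [intervalIntegral.integral_add (intervalIntegrable_eval _ _ _)
    (intervalIntegrable_eval _ _ _), horth _ hq, add_zero, hint]
  simp only [eval_finsetSum, eval_mul, eval_C]
  rw [intervalIntegral.integral_finsetSum]
  · exact Finset.sum_congr rfl fun j _ => by
      rw [intervalIntegral.integral_const_mul, mul_comm]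
  · intro j _
    exact ((intervalIntegrable_eval _ _ _).const_mul _)

/-- Applying the rule to the square of a Lagrange basis polynomial isolates its weight. With at most
`k + 1` nodes this square is still within the degree of exactness. -/
theorem integral_basis_nonneg {S : Finset ℕ} {v : ℕ → ℝ} (hv : InjOn v S) {k : ℕ}
    (hk : k ≤ S.card) (hk' : S.card ≤ k + 1)
    (horth : ∀ r : ℝ[X], r.degree < k →
      ∫ x in (0 : ℝ)..1, (Lagrange.nodal S v * r).eval x = 0) {j : ℕ} (hj : j ∈ S) :
    0 ≤ ∫ x in (0 : ℝ)..1, (Lagrange.basis S v j).eval x := by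
  have hcard : 0 < S.card := Finset.card_pos.2 ⟨j, hj⟩
  have h := integral_eq_sum_of_orthogonal hv hk horth
    (Lagrange.basis S v j * Lagrange.basis S v j) (by
      refine natDegree_mul_le.trans_lt ?_
      rw [Lagrange.natDegree_basis hv hj]; omega)
  rw [Finset.sum_eq_single_of_mem j hj] at h
  · rw [eval_mul, Lagrange.eval_basis_self hv hj, mul_one, mul_one] at h
    rw [← h]
    refine intervalIntegral.integral_nonneg zero_le_one fun x _ => ?_
    rw [eval_mul]; exact mul_self_nonneg _
  · intro i hi hij
    rw [eval_mul, Lagrange.eval_basis_of_ne hij.symm hi]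
    simp

namespace IsCVPoints

variable {F : Family} {k : ℕ} {s : ℕ → ℝ}

theorem lt_of_lt (hs : IsCVPoints F k s) {i j : ℕ} (hij : i < j) (hj : j ≤ k + 1) :
    s i < s j := by
  induction j with
  | zero => omega
  | succ j ih =>
    rcases Nat.lt_succ_iff_lt_or_eq.1 hij with h | rfl
    · exact (ih h (by omega)).trans (hs.lt j (by omega))
    · exact hs.lt i (by omega)

theorem le_of_le (hs : IsCVPoints F k s) {i j : ℕ} (hij : i ≤ j) (hj : j ≤ k + 1) :
    s i ≤ s j := by
  rcases hij.eq_or_lt with rfl | h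
  · exact le_rfl
  · exact (hs.lt_of_lt h hj).le

theorem mem_Icc (hs : IsCVPoints F k s) {j : ℕ} (hj : j ≤ k + 1) : s j ∈ Icc (0 : ℝ) 1 :=
  ⟨hs.zero ▸ hs.le_of_le (Nat.zero_le j) hj, hs.last ▸ hs.le_of_le hj le_rfl⟩

theorem injOn_succ (hs : IsCVPoints F k s) {n : ℕ} (hn : n ≤ k + 1) :
    InjOn (fun j => s (j + 1)) (Finset.range n : Finset ℕ) := by
  intro i hi j hj hij
  simp only [Finset.coe_range, mem_Iio] at hi hj
  rcases lt_trichotomy i j with h | h | h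
  · exact absurd hij (hs.lt_of_lt (by omega) (by omega)).ne
  · exact h
  · exact absurd hij (hs.lt_of_lt (by omega) (by omega)).ne'

/-- The quadrature rule at the right end points of the control volumes: it has nonnegative weights,
and is exact up to degree `2k`, except for a multiple of the coefficient of degree `2k`. -/
theorem exists_quadrature (hs : IsCVPoints F k s) : ∃ (A : ℕ → ℝ) (β : ℝ),
    (∀ j, 0 ≤ A j) ∧ 0 ≤ β ∧ ∀ f : ℝ[X], f.natDegree ≤ 2 * k →
      ∫ x in (0 : ℝ)..1, f.eval x =
        ∑ j ∈ Finset.range (k + 1), A j * f.eval (s (j + 1)) + β * f.coeff (2 * k) := by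
  cases F with
  | gauss =>
    set S := Finset.range k with hS
    set v : ℕ → ℝ := fun j => s (j + 1) with hvdef
    have hv : InjOn v S := hs.injOn_succ (by omega)
    have hcard : S.card = k := Finset.card_range k
    set W := Lagrange.nodal S v with hW
    have hL0 : legendre k ≠ 0 := by
      intro h
      have := legendre_eval_one k
      rw [h] at this; simp at this
    have hLW := eq_C_mul_nodal hv hL0 (by rw [natDegree_legendre, hcard]) (by
      intro j hj
      exact hs.root (j + 1) (by omega) (by have := Finset.mem_range.1 hj; omega))
    have horth : ∀ r : ℝ[X], r.degree < k → ∫ x in (0 : ℝ)..1, (W * r).eval x = 0 := by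
      intro r hr
      have h := integral_legendre_mul_eq_zero k r hr
      rw [hLW] at h
      simp only [mul_assoc, eval_C_mul] at h
      rw [intervalIntegral.integral_const_mul] at h
      exact (mul_eq_zero.1 h).resolve_left (leadingCoeff_ne_zero.2 hL0)
    -- There are only `k` Gauss points, so the end point `s (k + 1) = 1` receives weight zero. The
    -- defect is the value on the square of the monic nodal polynomial, which vanishes at every
    -- node.
    refine ⟨fun j => if j ∈ S then ∫ x in (0 : ℝ)..1, (Lagrange.basis S v j).eval x else 0,
      ∫ x in (0 : ℝ)..1, (W * W).eval x, ?_, ?_, ?_⟩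
    · intro j
      dsimp only
      split_ifs with hj
      · exact integral_basis_nonneg hv hcard.ge (by omega) horth hj
      · exact le_rfl
    · refine intervalIntegral.integral_nonneg zero_le_one fun x _ => ?_
      rw [eval_mul]; exact mul_self_nonneg _
    · intro f hf
      set c := f.coeff (2 * k) with hc
      have hWd : W.natDegree = k := by rw [hW, Lagrange.natDegree_nodal, hcard]
      have hWc : W.coeff k = 1 := by
        have := Lagrange.nodal_monic (s := S) (v := v)
        rw [Monic, leadingCoeff, ← hW, hWd] at this
        exact this
      -- Subtracting `c * W ^ 2` removes the coefficient of degree `2k` without changing the values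
      -- at the nodes.
      have hg2 : (f - C c * (W * W)).degree < ((2 * k : ℕ) : WithBot ℕ) := by
        rw [degree_lt_iff_coeff_zero]
        intro i hi
        rw [coeff_sub, coeff_C_mul]
        rcases hi.eq_or_lt with h | h
        · rw [← h, ← hc, two_mul, coeff_mul_add_eq_of_natDegree_le hWd.le hWd.le, hWc]; ring
        · rw [coeff_eq_zero_of_natDegree_lt (by omega), coeff_eq_zero_of_natDegree_lt]
          · ring
          · exact natDegree_mul_le.trans_lt (by omega)
      have hev : ∀ j ∈ S, (f - C c * (W * W)).eval (v j) = f.eval (v j) := by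
        intro j hj
        rw [eval_sub, eval_mul, eval_mul, hW, Lagrange.eval_nodal_at_node hj]
        ring
      have hsplit : ∫ x in (0 : ℝ)..1, f.eval x =
          (∫ x in (0 : ℝ)..1, (f - C c * (W * W)).eval x) +
            (∫ x in (0 : ℝ)..1, (W * W).eval x) * c := by
        simp only [eval_sub, eval_C_mul]
        rw [intervalIntegral.integral_sub (intervalIntegrable_eval _ _ _)
          ((intervalIntegrable_eval _ _ _).const_mul _), intervalIntegral.integral_const_mul]
        ring
      rw [hsplit, Finset.sum_range_succ]
      have hkS : k ∉ S := by simp [hS]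
      simp only [if_neg hkS, zero_mul, add_zero]
      congr 1
      -- For `k = 0` the bound `natDegree < 2 * k` is unattainable even by the zero polynomial, so
      -- this case is treated by hand.
      rcases ne_or_eq k 0 with hk0 | hk0
      · rw [integral_eq_sum_of_orthogonal hv hcard.ge horth]
        · exact Finset.sum_congr rfl fun j hj => by rw [if_pos hj, hev j hj]
        · rw [hcard]
          by_cases h0 : f - C c * (W * W) = 0
          · rw [h0]; simp; omega
          · rw [← natDegree_lt_iff_degree_lt h0] at hg2
            omega
      · have : f - C c * (W * W) = 0 := by
          ext i; exact (degree_lt_iff_coeff_zero _ _).1 hg2 i (by omega)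
        rw [this]
        simp [hS, hk0]
  | rightRadau =>
    set S := Finset.range (k + 1) with hS
    set v : ℕ → ℝ := fun j => s (j + 1) with hvdef
    have hv : InjOn v S := hs.injOn_succ le_rfl
    have hcard : S.card = k + 1 := Finset.card_range _
    set P := legendre (k + 1) - legendre k with hP
    have hPd : P.natDegree = k + 1 := by
      rw [hP, natDegree_sub_eq_left_of_natDegree_lt] <;> simp [natDegree_legendre]
    have hP0 : P ≠ 0 := by
      intro h; rw [h] at hPd; simp at hPd
    have hLW := eq_C_mul_nodal hv hP0 (by rw [hPd, hcard]) (by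
      intro j hj
      have hj := Finset.mem_range.1 hj
      -- The end point `1` is the remaining root, because all Legendre polynomials take the value
      -- `1` there.
      rcases (Nat.lt_succ_iff.1 hj).eq_or_lt with rfl | h
      · simp only [hvdef, hs.last, hP, eval_sub, legendre_eval_one, sub_self]
      · exact hs.root (j + 1) (by omega) (by omega))
    have horth : ∀ r : ℝ[X], r.degree < k →
        ∫ x in (0 : ℝ)..1, (Lagrange.nodal S v * r).eval x = 0 := by
      intro r hr
      have h1 := integral_legendre_mul_eq_zero k r hr
      have h2 := integral_legendre_mul_eq_zero (k + 1) r
        (hr.trans (by exact_mod_cast Nat.lt_succ_self k))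
      have h : ∫ x in (0 : ℝ)..1, (P * r).eval x = 0 := by
        rw [hP]
        simp only [sub_mul, eval_sub]
        rw [intervalIntegral.integral_sub (intervalIntegrable_eval _ _ _)
          (intervalIntegrable_eval _ _ _), h1, h2, sub_self]
      rw [hLW] at h
      simp only [mul_assoc, eval_C_mul] at h
      rw [intervalIntegral.integral_const_mul] at h
      exact (mul_eq_zero.1 h).resolve_left (leadingCoeff_ne_zero.2 hP0)
    -- With `k + 1` nodes and orthogonality below degree `k`, the Radau rule is exact up to degree
    -- `2k`, so there is no defect.
    refine ⟨fun j => if j ∈ S then ∫ x in (0 : ℝ)..1, (Lagrange.basis S v j).eval x else 0,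
      0, ?_, le_rfl, ?_⟩
    · intro j
      dsimp only
      split_ifs with hj
      · exact integral_basis_nonneg hv (by omega) (by omega) horth hj
      · exact le_rfl
    · intro f hf
      rw [integral_eq_sum_of_orthogonal hv (by omega) horth f (by omega), zero_mul, add_zero]
      exact Finset.sum_congr rfl fun j hj => by simp only [if_pos hj, hvdef]

end IsCVPoints

end OFSV

end

noncomputable section

namespace OFSV

open Polynomial Set MeasureTheory

/-! ### Test values on one spectral volume -/

/-- A quadrature rule on `[0, 1]` with nodes `s 1, …, s (k + 1)` and nonnegative weights, exact up
to degree `2k`, except for a nonnegative multiple of the coefficient of degree `2k`. -/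
structure IsQuadrature (k : ℕ) (s A : ℕ → ℝ) (β : ℝ) : Prop where
  weight_nonneg : ∀ j, 0 ≤ A j
  defect_nonneg : 0 ≤ β
  integral_eq : ∀ f : ℝ[X], f.natDegree ≤ 2 * k →
    ∫ x in (0 : ℝ)..1, f.eval x =
      ∑ j ∈ Finset.range (k + 1), A j * f.eval (s (j + 1)) + β * f.coeff (2 * k)

theorem natDegree_comp_affine_le (p : ℝ[X]) (α l : ℝ) :
    (p.comp (C l * X + C α)).natDegree ≤ p.natDegree := by
  refine natDegree_comp_le.trans ?_
  calc p.natDegree * (C l * X + C α).natDegree ≤ p.natDegree * 1 :=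
        Nat.mul_le_mul_left _ (natDegree_linear_le)
    _ = p.natDegree := mul_one _

theorem coeff_comp_affine (p : ℝ[X]) {α l : ℝ} (hl : l ≠ 0) {n : ℕ} (hp : p.natDegree ≤ n) :
    (p.comp (C l * X + C α)).coeff n = l ^ n * p.coeff n := by
  have hdeg : (p.comp (C l * X + C α)).natDegree = p.natDegree := by
    rw [natDegree_comp, natDegree_linear hl, mul_one]
  rcases hp.eq_or_lt with rfl | h
  · have := leadingCoeff_comp (p := p) (q := C l * X + C α) (by rw [natDegree_linear hl]; simp)
    rw [leadingCoeff, hdeg, leadingCoeff_linear hl, leadingCoeff] at this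
    rw [this, mul_comm]
  · rw [coeff_eq_zero_of_natDegree_lt (by rwa [hdeg]), coeff_eq_zero_of_natDegree_lt h, mul_zero]

theorem integral_comp_affine (g : ℝ → ℝ) (α l x y : ℝ) :
    ∫ z in (α + l * x)..(α + l * y), g z = l * ∫ z in x..y, g (l * z + α) := by
  have := intervalIntegral.smul_integral_comp_mul_add (a := x) (b := y) g l α
  rw [smul_eq_mul] at this
  rw [this, add_comm α, add_comm α]

theorem integral_comp_affine_unit (g : ℝ → ℝ) (α l : ℝ) :
    ∫ z in α..(α + l), g z = l * ∫ z in (0 : ℝ)..1, g (l * z + α) := by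
  have := integral_comp_affine g α l 0 1
  simpa using this

theorem IsQuadrature.integral_eq_scaled {k : ℕ} {s A : ℕ → ℝ} {β : ℝ}
    (hQ : IsQuadrature k s A β) (α : ℝ) {l : ℝ} (hl : 0 < l) (f : ℝ[X])
    (hf : f.natDegree ≤ 2 * k) :
    ∫ x in α..(α + l), f.eval x =
      l * ∑ j ∈ Finset.range (k + 1), A j * f.eval (α + l * s (j + 1)) +
        β * l ^ (2 * k + 1) * f.coeff (2 * k) := by
  have h := hQ.integral_eq (f.comp (C l * X + C α)) ((natDegree_comp_affine_le _ _ _).trans hf)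
  rw [coeff_comp_affine _ hl.ne' hf] at h
  simp only [eval_comp, eval_add, eval_mul, eval_C, eval_X] at h
  rw [integral_comp_affine_unit, h]
  simp only [add_comm α]
  ring

/-- The values on the control volumes of the piecewise constant test function attached to `w`. -/
def testVal (s A : ℕ → ℝ) (α l : ℝ) (w : ℝ[X]) (j : ℕ) : ℝ :=
  w.eval α + l * ∑ i ∈ Finset.range j, A i * (derivative w).eval (α + l * s (i + 1))

/-- Abel summation: consecutive test values differ by `l * A j * w'` at the node between them. It is
applied both to the upwind traces and to an antiderivative. -/
theorem sum_testVal_mul_sub (s A : ℕ → ℝ) (α l : ℝ) (w : ℝ[X]) (V : ℕ → ℝ) (n : ℕ) :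
    ∑ j ∈ Finset.range n, testVal s A α l w j * (V (j + 1) - V j) =
      testVal s A α l w n * V n - w.eval α * V 0 -
        l * ∑ i ∈ Finset.range n, A i * ((derivative w).eval (α + l * s (i + 1)) * V (i + 1)) := by
  induction n with
  | zero => simp [testVal]
  | succ n ih =>
    rw [Finset.sum_range_succ, ih, Finset.sum_range_succ _ n]
    have : testVal s A α l w (n + 1) = testVal s A α l w n +
        l * (A n * (derivative w).eval (α + l * s (n + 1))) := by
      simp only [testVal, Finset.sum_range_succ]; ring
    rw [this]
    ring

theorem exists_derivative_eq (v : ℝ[X]) :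
    ∃ V : ℝ[X], derivative V = v ∧ V.natDegree ≤ v.natDegree + 1 := by
  refine ⟨∑ i ∈ Finset.range (v.natDegree + 1), C (v.coeff i / (i + 1)) * X ^ (i + 1), ?_, ?_⟩
  · conv_rhs => rw [v.as_sum_range_C_mul_X_pow]
    rw [derivative_sum]
    refine Finset.sum_congr rfl fun i _ => ?_
    rw [derivative_C_mul_X_pow]
    congr 2
    push_cast
    field_simp
  · refine natDegree_sum_le_of_forall_le _ _ fun i hi => ?_
    have := Finset.mem_range.1 hi
    exact (natDegree_C_mul_X_pow_le _ _).trans (by omega)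

theorem integral_derivative (V : ℝ[X]) (x y : ℝ) :
    ∫ z in x..y, (derivative V).eval z = V.eval y - V.eval x :=
  intervalIntegral.integral_eq_sub_of_hasDerivAt (fun z _ => V.hasDerivAt z)
    (intervalIntegrable_eval _ _ _)

namespace IsQuadrature

variable {k : ℕ} {s A : ℕ → ℝ} {β : ℝ}

/-- The derivative of `w` has degree at most `k - 1`, so the rule integrates it exactly and the
accumulated value is the right trace of `w`. -/
theorem testVal_last (hQ : IsQuadrature k s A β) (hk : 1 ≤ k) (α : ℝ) {l : ℝ} (hl : 0 < l)
    {w : ℝ[X]} (hw : w.natDegree ≤ k) : testVal s A α l w (k + 1) = w.eval (α + l) := by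
  have hd := (natDegree_derivative_le w).trans (Nat.sub_le_sub_right hw 1)
  have h := hQ.integral_eq_scaled α hl (derivative w) (by omega)
  rw [coeff_eq_zero_of_natDegree_lt (by omega), mul_zero, add_zero, integral_derivative] at h
  rw [testVal, ← h]
  ring

/-- Summation by parts turns the upwind fluxes into those of the discontinuous Galerkin method. -/
theorem sum_testVal_mul_flux (hQ : IsQuadrature k s A β) (hk : 1 ≤ k) (α : ℝ) {l : ℝ}
    (hl : 0 < l) {v w : ℝ[X]} (hv : v.natDegree ≤ k) (hw : w.natDegree ≤ k) (V : ℕ → ℝ)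
    (hlast : s (k + 1) = 1)
    (hV : ∀ j ≤ k, V (j + 1) = v.eval (α + l * s (j + 1))) :
    ∑ j ∈ Finset.range (k + 1), testVal s A α l w j * (V (j + 1) - V j) =
      w.eval (α + l) * v.eval (α + l) - w.eval α * V 0 -
        ∫ x in α..(α + l), (derivative w * v).eval x := by
  have hd := (natDegree_derivative_le w).trans (Nat.sub_le_sub_right hw 1)
  have hdv : (derivative w * v).natDegree ≤ 2 * k - 1 := natDegree_mul_le.trans (by omega)
  rw [sum_testVal_mul_sub, hQ.testVal_last hk α hl hw, hV k le_rfl, hlast, mul_one,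
    hQ.integral_eq_scaled α hl (derivative w * v) (by omega),
    coeff_eq_zero_of_natDegree_lt (by omega), mul_zero, add_zero]
  congr 2
  refine Finset.sum_congr rfl fun j hj => ?_
  rw [hV j (by have := Finset.mem_range.1 hj; omega), eval_mul]

/-- On polynomials of degree at most `k`, pairing with the test values is the `L²` product plus a
positive semidefinite term in the leading coefficients. -/
theorem sum_testVal_mul_integral (hQ : IsQuadrature k s A β) (hk : 1 ≤ k) (α : ℝ) {l : ℝ}
    (hl : 0 < l) {v w : ℝ[X]} (hv : v.natDegree ≤ k) (hw : w.natDegree ≤ k)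
    (h0 : s 0 = 0) (hlast : s (k + 1) = 1) :
    ∑ j ∈ Finset.range (k + 1), testVal s A α l w j *
        ∫ x in (α + l * s j)..(α + l * s (j + 1)), v.eval x =
      (∫ x in α..(α + l), v.eval x * w.eval x) +
        β * (k / (k + 1)) * l ^ (2 * k + 1) * (v.coeff k * w.coeff k) := by
  obtain ⟨V, rfl, hVd⟩ := exists_derivative_eq v
  have hVd' : V.natDegree ≤ k + 1 := hVd.trans (by omega)
  have hd := (natDegree_derivative_le w).trans (Nat.sub_le_sub_right hw 1)
  simp only [integral_derivative]
  have hsum := sum_testVal_mul_sub s A α l w (fun j => V.eval (α + l * s j)) (k + 1)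
  rw [hsum, hQ.testVal_last hk α hl hw]
  have hq := hQ.integral_eq_scaled α hl (derivative w * V) (natDegree_mul_le.trans (by omega))
  -- The product reaches degree `2k`, where the rule may fail. The leading coefficients are `k *
  -- w_k` and `v_k / (k + 1)`, which makes the correction symmetric in `v` and `w`.
  have hc : (derivative w * V).coeff (2 * k) = (k / (k + 1)) *
      ((derivative V).coeff k * w.coeff k) := by
    have h2k : 2 * k = (k - 1) + (k + 1) := by omega
    rw [h2k, coeff_mul_add_eq_of_natDegree_le hd hVd', coeff_derivative, coeff_derivative,
      Nat.sub_add_cancel hk, Nat.cast_sub hk]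
    field_simp
    push_cast
    ring
  rw [hc, integral_derivative_mul] at hq
  simp only [eval_mul] at hq ⊢
  rw [h0, hlast, mul_zero, mul_one, add_zero]
  have hcomm : ∫ x in α..(α + l), (derivative V).eval x * w.eval x =
      ∫ x in α..(α + l), w.eval x * (derivative V).eval x := by simp only [mul_comm]
  rw [hcomm]
  linarith

end IsQuadrature

/-! ### Inverse estimates -/

/-- Equivalence of norms in finite dimension: the `L²` form is continuous and positive on the
compact unit sphere of coefficient vectors, and homogeneity extends the bound by its minimum to all
vectors. -/
theorem exists_coeff_sq_le (k : ℕ) : ∃ K : ℝ, 0 < K ∧ ∀ p : ℝ[X], p.natDegree ≤ k →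
    ∀ i, p.coeff i ^ 2 ≤ K * ∫ x in (0 : ℝ)..1, p.eval x ^ 2 := by
  let P : (Fin (k + 1) → ℝ) → ℝ[X] := fun c => ∑ i, C (c i) * X ^ (i : ℕ)
  have hPeval : ∀ c x, (P c).eval x = ∑ i, c i * x ^ (i : ℕ) := fun c x => by
    simp [P, eval_finsetSum]
  have hPcoeff : ∀ c (i : Fin (k + 1)), (P c).coeff i = c i := fun c i => by
    simp only [P, finsetSum_coeff, coeff_C_mul_X_pow]
    rw [Finset.sum_eq_single i]
    · simp
    · intro j _ hj
      exact if_neg fun h => hj (Fin.ext h.symm)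
    · simp
  let Φ : (Fin (k + 1) → ℝ) → ℝ := fun c => ∫ x in (0 : ℝ)..1, (P c).eval x ^ 2
  have hΦ : Continuous Φ := by
    refine intervalIntegral.continuous_parametric_intervalIntegral_of_continuous' ?_ 0 1
    simp only [Function.uncurry_def, hPeval]
    fun_prop
  have hΦs : ∀ (r : ℝ) c, Φ (r • c) = r ^ 2 * Φ c := fun r c => by
    simp only [Φ, hPeval, ← intervalIntegral.integral_const_mul, ← mul_pow, Finset.mul_sum]
    simp [mul_assoc]
  obtain ⟨c₀, hc₀, hmin⟩ := (isCompact_sphere (0 : Fin (k + 1) → ℝ) 1).exists_isMinOn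
    (NormedSpace.sphere_nonempty.2 zero_le_one) hΦ.continuousOn
  have hc₀0 : c₀ ≠ 0 := by
    rintro rfl
    simp at hc₀
  have hpos : 0 < Φ c₀ := by
    have h0 : 0 ≤ Φ c₀ := intervalIntegral.integral_nonneg zero_le_one fun x _ => sq_nonneg _
    refine h0.lt_of_ne fun h => hc₀0 ?_
    have : P c₀ = 0 := eq_zero_of_integral_sq zero_lt_one _ (by
      simpa only [Φ, sq] using h.symm)
    ext i
    rw [← hPcoeff c₀ i, this]; simp
  have hle : ∀ c, ‖c‖ ^ 2 * Φ c₀ ≤ Φ c := fun c => by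
    by_cases hc : c = 0
    · subst hc
      simpa using intervalIntegral.integral_nonneg (μ := volume)
        (f := fun x => (P 0).eval x ^ 2) zero_le_one fun x _ => sq_nonneg _
    · have hn : ‖c‖ ≠ 0 := norm_ne_zero_iff.2 hc
      have h1 : Φ c₀ ≤ Φ (‖c‖⁻¹ • c) := hmin (by
        simp [norm_smul, hn])
      have h2 : Φ c = ‖c‖ ^ 2 * Φ (‖c‖⁻¹ • c) := by
        rw [hΦs]; field_simp
      rw [h2]
      gcongr
  refine ⟨(Φ c₀)⁻¹, inv_pos.2 hpos, fun p hp i => ?_⟩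
  have hpP : P (fun i => p.coeff i) = p := by
    simp only [P]
    rw [Fin.sum_univ_eq_sum_range (fun i => C (p.coeff i) * X ^ i) (k + 1)]
    exact (p.as_sum_range_C_mul_X_pow' (by omega)).symm
  have h := hle (fun i => p.coeff i)
  have hΦp : Φ (fun i => p.coeff i) = ∫ x in (0 : ℝ)..1, p.eval x ^ 2 := by
    simp only [Φ, hpP]
  rw [hΦp] at h
  have hint : 0 ≤ ∫ x in (0 : ℝ)..1, p.eval x ^ 2 :=
    intervalIntegral.integral_nonneg zero_le_one fun x _ => sq_nonneg _
  by_cases hi : i ≤ k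
  · have h1 := norm_le_pi_norm (fun i : Fin (k + 1) => p.coeff i) ⟨i, by omega⟩
    have h2 : p.coeff i ^ 2 ≤ ‖(fun i : Fin (k + 1) => p.coeff i)‖ ^ 2 := by
      rw [← sq_abs]
      exact pow_le_pow_left₀ (abs_nonneg _) h1 2
    rw [inv_mul_eq_div, le_div_iff₀ hpos]
    exact (mul_le_mul_of_nonneg_right h2 hpos.le).trans h
  · rw [coeff_eq_zero_of_natDegree_lt (by omega)]
    have := mul_nonneg (inv_pos.2 hpos).le hint
    simpa using this

theorem abs_coeff_iterate_derivative_le {k : ℕ} {p : ℝ[X]} (hp : p.natDegree ≤ k) {B : ℝ}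
    (hB : ∀ i, |p.coeff i| ≤ B) (l i : ℕ) : |(derivative^[l] p).coeff i| ≤ k ^ l * B := by
  have hB0 : 0 ≤ B := (abs_nonneg _).trans (hB 0)
  induction l generalizing i with
  | zero => simpa using hB i
  | succ l ih =>
    rw [Function.iterate_succ_apply', coeff_derivative]
    by_cases hi : i + 1 ≤ k
    · rw [abs_mul, pow_succ', mul_comm, mul_assoc]
      have : |(i : ℝ) + 1| ≤ k := by
        rw [abs_of_nonneg (by positivity)]; exact_mod_cast hi
      exact mul_le_mul this (ih _) (abs_nonneg _) (by positivity)
    · rw [coeff_eq_zero_of_natDegree_lt]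
      · simp; positivity
      · exact ((natDegree_iterate_derivative p l).trans (Nat.sub_le _ _)).trans_lt (by omega)

theorem abs_eval_le_of_coeff {k : ℕ} {p : ℝ[X]} (hp : p.natDegree ≤ k) {B : ℝ}
    (hB : ∀ i, |p.coeff i| ≤ B) {x : ℝ} (hx : x ∈ Icc (0 : ℝ) 1) :
    |p.eval x| ≤ (k + 1) * B := by
  rw [eval_eq_sum_range' (n := k + 1) (by omega)]
  refine (Finset.abs_sum_le_sum_abs _ _).trans ?_
  calc ∑ i ∈ Finset.range (k + 1), |p.coeff i * x ^ i|
      ≤ ∑ i ∈ Finset.range (k + 1), B := by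
        refine Finset.sum_le_sum fun i _ => ?_
        rw [abs_mul, abs_of_nonneg (pow_nonneg hx.1 i)]
        calc |p.coeff i| * x ^ i ≤ |p.coeff i| * 1 :=
              mul_le_mul_of_nonneg_left (pow_le_one₀ hx.1 hx.2) (abs_nonneg _)
          _ ≤ B := by rw [mul_one]; exact hB i
    _ = (k + 1) * B := by simp

theorem iterate_derivative_comp_affine (p : ℝ[X]) (α l : ℝ) (n : ℕ) :
    derivative^[n] (p.comp (C l * X + C α)) =
      C (l ^ n) * (derivative^[n] p).comp (C l * X + C α) := by
  induction n with
  | zero => simp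
  | succ n ih =>
    rw [Function.iterate_succ_apply', ih, derivative_C_mul, derivative_comp,
      Function.iterate_succ_apply']
    simp only [derivative_add, derivative_mul, derivative_C, derivative_X, pow_succ, C_mul]
    ring

/-- The inverse estimate for polynomials of degree at most `k`. -/
theorem exists_inverse_estimate (k : ℕ) (hk : 1 ≤ k) : ∃ K : ℝ, 0 < K ∧
    ∀ p : ℝ[X], p.natDegree ≤ k → ∀ n ≤ k, ∀ α l : ℝ, 0 < l → ∀ x ∈ Icc α (α + l),
      l ^ (2 * n + 1) * (derivative^[n] p).eval x ^ 2 ≤ K * ∫ y in α..(α + l), p.eval y ^ 2 := by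
  obtain ⟨K, hK, hcoef⟩ := exists_coeff_sq_le k
  refine ⟨((k + 1) * k ^ k) ^ 2 * K, by positivity, fun p hp n hn α l hl x hx => ?_⟩
  set q := p.comp (C l * X + C α) with hq
  have hqd : q.natDegree ≤ k := (natDegree_comp_affine_le _ _ _).trans hp
  set I := ∫ x in (0 : ℝ)..1, q.eval x ^ 2 with hI
  have hI0 : 0 ≤ I := intervalIntegral.integral_nonneg zero_le_one fun x _ => sq_nonneg _
  have hpI : ∫ y in α..(α + l), p.eval y ^ 2 = l * I := by
    rw [integral_comp_affine_unit, hI]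
    simp [hq]
  have hB : ∀ i, |q.coeff i| ≤ √(K * I) := fun i => Real.abs_le_sqrt (hcoef q hqd i)
  set y := (x - α) / l with hy
  have hxy : l * y + α = x := by rw [hy]; field_simp; ring
  have hy01 : y ∈ Icc (0 : ℝ) 1 :=
    ⟨div_nonneg (by linarith [hx.1]) hl.le, (div_le_one hl).2 (by linarith [hx.2])⟩
  have h1 := abs_eval_le_of_coeff
    ((natDegree_iterate_derivative q n).trans ((Nat.sub_le _ _).trans hqd))
    (abs_coeff_iterate_derivative_le hqd hB n) hy01
  have h2 : (derivative^[n] q).eval y = l ^ n * (derivative^[n] p).eval x := by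
    rw [hq, iterate_derivative_comp_affine, eval_mul, eval_C, eval_comp]
    simp [hxy]
  rw [h2] at h1
  have hkk : (k : ℝ) ^ n ≤ (k : ℝ) ^ k := pow_le_pow_right₀ (by exact_mod_cast hk) hn
  have h3 : |l ^ n * (derivative^[n] p).eval x| ≤ ((k + 1) * k ^ k) * √(K * I) := by
    refine h1.trans ?_
    rw [mul_assoc]
    gcongr
  have h4 : (l ^ n * (derivative^[n] p).eval x) ^ 2 ≤ (((k + 1) * k ^ k) * √(K * I)) ^ 2 :=
    sq_le_sq' (by linarith [neg_abs_le (l ^ n * (derivative^[n] p).eval x)])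
      ((le_abs_self _).trans h3)
  rw [mul_pow _ (√_), Real.sq_sqrt (by positivity)] at h4
  rw [hpI]
  calc l ^ (2 * n + 1) * (derivative^[n] p).eval x ^ 2
      = l * (l ^ n * (derivative^[n] p).eval x) ^ 2 := by ring
    _ ≤ l * (((k + 1) * k ^ k) ^ 2 * (K * I)) := by gcongr
    _ = _ := by ring

end OFSV

end

noncomputable section

namespace OFSV

open Polynomial Set MeasureTheory Filter Topology
open scoped ContDiff

/-! ### Weak derivatives on an interval -/

/-- Smooth functions with compact support in `(a, b)`. -/
structure IsTest (a b : ℝ) (η : ℝ → ℝ) : Prop where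
  contDiff : ContDiff ℝ ∞ η
  compact : HasCompactSupport η
  subset : tsupport η ⊆ Ioo a b

theorem IsTest.deriv {a b : ℝ} {η : ℝ → ℝ} (h : IsTest a b η) : IsTest a b (deriv η) :=
  ⟨(contDiff_infty_iff_deriv.1 h.contDiff).2, h.compact.deriv,
    tsupport_deriv_subset.trans h.subset⟩

theorem IsTest.iteratedDeriv {a b : ℝ} {η : ℝ → ℝ} (h : IsTest a b η) (n : ℕ) :
    IsTest a b (iteratedDeriv n η) := by
  induction n with
  | zero => simpa using h
  | succ n ih => rw [iteratedDeriv_succ]; exact ih.deriv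

theorem IsTest.eq_zero {a b : ℝ} {η : ℝ → ℝ} (h : IsTest a b η) {x : ℝ} (hx : x ∉ Ioo a b) :
    η x = 0 :=
  image_eq_zero_of_notMem_tsupport fun hx' => hx (h.subset hx')

theorem IsTest.mono {a b c d : ℝ} {η : ℝ → ℝ} (h : IsTest c d η) (hac : a ≤ c) (hdb : d ≤ b) :
    IsTest a b η :=
  ⟨h.contDiff, h.compact, h.subset.trans (Ioo_subset_Ioo hac hdb)⟩

theorem IsWeakDeriv.integral_eq {a b : ℝ} {j : ℕ} {f w η : ℝ → ℝ} (h : IsWeakDeriv a b j f w)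
    (hη : IsTest a b η) :
    ∫ x in Ioo a b, f x * iteratedDeriv j η x = (-1) ^ j * ∫ x in Ioo a b, w x * η x :=
  h.2 η hη.contDiff hη.compact hη.subset

theorem setIntegral_mul_of_support {a b c d : ℝ} (hac : a ≤ c) (hdb : d ≤ b) {g η : ℝ → ℝ}
    (hη : ∀ x ∉ Ioo c d, η x = 0) :
    ∫ x in Ioo a b, g x * η x = ∫ x in Ioo c d, g x * η x :=
  setIntegral_eq_of_subset_of_forall_sdiff_eq_zero measurableSet_Ioo (Ioo_subset_Ioo hac hdb)
    fun x hx => by rw [hη x hx.2, mul_zero]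

/-- The fundamental lemma of the calculus of variations; compact supports inside the interval make
local integrability sufficient. -/
theorem ae_eq_of_integral_test {a b : ℝ} {f g : ℝ → ℝ} (hf : LocallyIntegrableOn f (Ioo a b))
    (hg : LocallyIntegrableOn g (Ioo a b))
    (h : ∀ η, IsTest a b η → ∫ x in Ioo a b, f x * η x = ∫ x in Ioo a b, g x * η x) :
    f =ᵐ[volume.restrict (Ioo a b)] g := by
  have key : ∀ᵐ x, x ∈ Ioo a b → f x - g x = 0 := by
    refine isOpen_Ioo.ae_eq_zero_of_integral_contDiff_smul_eq_zero (hf.sub hg) ?_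
    intro η h1 h2 h3
    have hη : IsTest a b η := ⟨h1, h2, h3⟩
    have hint : ∀ g : ℝ → ℝ, LocallyIntegrableOn g (Ioo a b) →
        IntegrableOn (fun x => g x * η x) (Ioo a b) := by
      intro g hg
      have h4 : IntegrableOn g (tsupport η) := hg.integrableOn_compact_subset h3 h2
      have h5 : IntegrableOn (fun x => g x * η x) (tsupport η) :=
        IntegrableOn.mul_continuousOn h4 h1.continuous.continuousOn h2
      have h6 : Integrable (fun x => g x * η x) :=
        h5.integrable_of_forall_notMem_eq_zero fun x hx => by
          rw [image_eq_zero_of_notMem_tsupport hx, mul_zero]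
      exact h6.integrableOn
    have h7 : ∫ x, η x • (f x - g x) = ∫ x in Ioo a b, (f x * η x - g x * η x) := by
      rw [setIntegral_eq_integral_of_forall_compl_eq_zero]
      · congr 1; ext x; simp only [smul_eq_mul]; ring
      · intro x hx; rw [hη.eq_zero hx]; ring
    rw [h7, integral_sub (hint f hf) (hint g hg), h η hη, sub_self]
  rw [EventuallyEq, ae_restrict_iff' measurableSet_Ioo]
  filter_upwards [key] with x hx hxI
  linarith [hx hxI]

theorem IsWeakDeriv.ae_eq {a b : ℝ} {j : ℕ} {f w w' : ℝ → ℝ} (h : IsWeakDeriv a b j f w)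
    (h' : IsWeakDeriv a b j f w') : w =ᵐ[volume.restrict (Ioo a b)] w' := by
  refine ae_eq_of_integral_test h.1 h'.1 fun η hη => ?_
  have := (h.integral_eq hη).symm.trans (h'.integral_eq hη)
  exact mul_left_cancel₀ (pow_ne_zero j (by norm_num)) this

theorem IsWeakDeriv.congr {a b : ℝ} {j : ℕ} {f g w : ℝ → ℝ} (h : IsWeakDeriv a b j f w)
    (hfg : f =ᵐ[volume.restrict (Ioo a b)] g) : IsWeakDeriv a b j g w := by
  refine ⟨h.1, fun η h1 h2 h3 => ?_⟩
  rw [← h.2 η h1 h2 h3]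
  refine integral_congr_ae ?_
  filter_upwards [hfg] with x hx
  rw [hx]

theorem IsWeakDeriv.mono {a b c d : ℝ} {j : ℕ} {f w : ℝ → ℝ} (h : IsWeakDeriv a b j f w)
    (hac : a ≤ c) (hdb : d ≤ b) : IsWeakDeriv c d j f w := by
  refine ⟨h.1.mono_set (Ioo_subset_Ioo hac hdb), fun η h1 h2 h3 => ?_⟩
  have hη : IsTest c d η := ⟨h1, h2, h3⟩
  have := h.integral_eq (hη.mono hac hdb)
  rwa [setIntegral_mul_of_support hac hdb (fun x => (hη.iteratedDeriv j).eq_zero),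
    setIntegral_mul_of_support hac hdb (fun x => hη.eq_zero)] at this

theorem setIntegral_Ioo_eq {a b : ℝ} (hab : a ≤ b) (f : ℝ → ℝ) :
    ∫ x in Ioo a b, f x = ∫ x in a..b, f x := by
  rw [intervalIntegral.integral_of_le hab, integral_Ioc_eq_integral_Ioo]

theorem intervalIntegrable_of_memLp {a b : ℝ} (hab : a ≤ b) {f : ℝ → ℝ}
    (hf : MemLp f 2 (volume.restrict (Ioo a b))) : IntervalIntegrable f volume a b := by
  rw [intervalIntegrable_iff_integrableOn_Ioo_of_le hab]
  exact hf.integrable (by norm_num)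

theorem IsWeakDeriv.comp_add_right {a b δ : ℝ} (hab : a ≤ b) {j : ℕ} {f w : ℝ → ℝ}
    (h : IsWeakDeriv a b j f w) (hw : IntervalIntegrable w volume a b) :
    IsWeakDeriv (a - δ) (b - δ) j (fun x => f (x + δ)) (fun x => w (x + δ)) := by
  have hab' : a - δ ≤ b - δ := by linarith
  refine ⟨?_, fun η h1 h2 h3 => ?_⟩
  · have := (hw.comp_add_right δ)
    rw [intervalIntegrable_iff_integrableOn_Ioo_of_le hab'] at this
    exact this.locallyIntegrableOn
  · have hη : IsTest a b (fun x => η (x + -δ)) := by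
      refine ⟨h1.comp (contDiff_id.add contDiff_const), ?_, ?_⟩
      · exact h2.comp_homeomorph (Homeomorph.addRight (-δ))
      · have hcl : IsClosed ((fun x => x + -δ) ⁻¹' tsupport η) :=
          (isClosed_tsupport η).preimage (by fun_prop)
        have hsub : tsupport (fun x => η (x + -δ)) ⊆ (fun x => x + -δ) ⁻¹' tsupport η :=
          closure_minimal (fun x hx => subset_tsupport η hx) hcl
        intro x hx
        have := h3 (hsub hx)
        constructor <;> linarith [this.1, this.2]
    have h4 := h.integral_eq hη
    have h5 : iteratedDeriv j (fun x => η (x + -δ)) = fun x => iteratedDeriv j η (x + -δ) :=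
      iteratedDeriv_comp_add_const j η (-δ)
    rw [h5, setIntegral_Ioo_eq hab, setIntegral_Ioo_eq hab] at h4
    rw [setIntegral_Ioo_eq hab', setIntegral_Ioo_eq hab']
    have e1 := intervalIntegral.integral_comp_add_right (a := a - δ) (b := b - δ)
      (fun x => f x * iteratedDeriv j η (x + -δ)) δ
    have e2 := intervalIntegral.integral_comp_add_right (a := a - δ) (b := b - δ)
      (fun x => w x * η (x + -δ)) δ
    simp only [add_neg_cancel_right, sub_add_cancel] at e1 e2
    rw [e1, e2, h4]

theorem MemH.isWeakDeriv {a b : ℝ} {n j : ℕ} {f : ℝ → ℝ} (h : MemH a b n f) (hj : j ≤ n) :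
    IsWeakDeriv a b j f (weakDeriv a b j f) := by
  obtain ⟨w, -, hw⟩ := h.2 j hj
  exact Classical.epsilon_spec ⟨w, hw⟩

theorem MemH.memLp_weakDeriv {a b : ℝ} {n j : ℕ} {f : ℝ → ℝ} (h : MemH a b n f) (hj : j ≤ n) :
    MemLp (weakDeriv a b j f) 2 (volume.restrict (Ioo a b)) := by
  obtain ⟨w, hwL, hw⟩ := h.2 j hj
  exact hwL.ae_eq (hw.ae_eq (h.isWeakDeriv hj))

theorem MemH.ae_eq_weakDeriv {a b : ℝ} {n j : ℕ} {f w : ℝ → ℝ} (h : MemH a b n f) (hj : j ≤ n)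
    (hw : IsWeakDeriv a b j f w) : weakDeriv a b j f =ᵐ[volume.restrict (Ioo a b)] w :=
  (h.isWeakDeriv hj).ae_eq hw

/-- Translates have the same weak derivatives. -/
theorem integral_weakDeriv_sq_of_translate {a b δ : ℝ} (hδ : 0 ≤ δ) (hδb : δ ≤ b - a)
    {n j : ℕ} (hj : j ≤ n) {f g : ℝ → ℝ} (hf : MemH a b n f) (hg : MemH a b n g)
    (hfg : ∀ x ∈ Ioo a (b - δ), f x = g (x + δ)) :
    ∫ x in a..(b - δ), weakDeriv a b j f x ^ 2 =
      ∫ x in (a + δ)..b, weakDeriv a b j g x ^ 2 := by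
  have hab : a ≤ b := by linarith
  have h1 : IsWeakDeriv a (b - δ) j f (weakDeriv a b j f) :=
    (hf.isWeakDeriv hj).mono le_rfl (by linarith)
  have h2 := ((hg.isWeakDeriv hj).comp_add_right (δ := δ) hab
    (intervalIntegrable_of_memLp hab (hg.memLp_weakDeriv hj))).mono
      (show a - δ ≤ a by linarith) le_rfl
  have h3 := h2.congr (g := f) (by
    rw [EventuallyEq, ae_restrict_iff' measurableSet_Ioo]
    exact Eventually.of_forall fun x hx => (hfg x hx).symm)
  have h4 := h1.ae_eq h3
  have e := intervalIntegral.integral_comp_add_right (a := a) (b := b - δ)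
    (fun x => weakDeriv a b j g x ^ 2) δ
  rw [sub_add_cancel] at e
  rw [← e, ← setIntegral_Ioo_eq (by linarith), ← setIntegral_Ioo_eq (by linarith)]
  refine integral_congr_ae ?_
  filter_upwards [h4] with x hx
  rw [hx]

/-! ### Continuous representatives -/

/-- The du Bois-Reymond lemma. -/
theorem ae_const_of_integral_mul_deriv_eq_zero {a b : ℝ} (hab : a < b) {f : ℝ → ℝ}
    (hf : LocallyIntegrableOn f (Ioo a b))
    (h : ∀ η, IsTest a b η → ∫ x in Ioo a b, f x * deriv η x = 0) :
    ∃ c : ℝ, f =ᵐ[volume.restrict (Ioo a b)] fun _ => c := by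
  let B : ContDiffBump ((a + b) / 2 : ℝ) :=
    { rIn := (b - a) / 8, rOut := (b - a) / 4, rIn_pos := by linarith, rIn_lt_rOut := by linarith }
  set ψ : ℝ → ℝ := B.normed volume with hψ
  have hψtest : IsTest a b ψ := by
    refine ⟨B.contDiff_normed, B.hasCompactSupport_normed, ?_⟩
    rw [hψ, B.tsupport_normed_eq]
    intro x hx
    rw [Metric.mem_closedBall, Real.dist_eq, abs_le] at hx
    have h1 : B.rOut = (b - a) / 4 := rfl
    rw [h1] at hx
    constructor <;> linarith [hx.1, hx.2]
  have hψ1 : ∫ x, ψ x = 1 := B.integral_normed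
  have hint : ∀ g : ℝ → ℝ, LocallyIntegrableOn g (Ioo a b) → ∀ η, IsTest a b η →
      IntegrableOn (fun x => g x * η x) (Ioo a b) := by
    intro g hg η hη
    have h4 : IntegrableOn g (tsupport η) :=
      hg.integrableOn_compact_subset hη.subset hη.compact
    have h5 : IntegrableOn (fun x => g x * η x) (tsupport η) :=
      IntegrableOn.mul_continuousOn h4 hη.contDiff.continuous.continuousOn hη.compact
    have h6 : Integrable (fun x => g x * η x) :=
      h5.integrable_of_forall_notMem_eq_zero fun x hx => by
        rw [image_eq_zero_of_notMem_tsupport hx, mul_zero]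
    exact h6.integrableOn
  set c := ∫ x in Ioo a b, f x * ψ x with hc
  have hconst : LocallyIntegrableOn (fun _ : ℝ => c) (Ioo a b) :=
    (locallyIntegrable_const c).locallyIntegrableOn _
  refine ⟨c, ae_eq_of_integral_test hf hconst fun φ hφ => ?_⟩
  set m := ∫ x, φ x with hm
  -- Subtracting a bump with the same integral gives `θ` zero mean, so its primitive vanishes on
  -- both sides of a compact subinterval and is again a test function. The hypothesis applied to
  -- this primitive identifies the constant as `∫ f ψ`.
  set θ : ℝ → ℝ := fun x => φ x - m * ψ x with hθ
  have hθc : ContDiff ℝ ∞ θ := hφ.contDiff.sub (contDiff_const.mul hψtest.contDiff)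
  have hφint : Integrable φ := hφ.contDiff.continuous.integrable_of_hasCompactSupport hφ.compact
  have hψint : Integrable ψ :=
    hψtest.contDiff.continuous.integrable_of_hasCompactSupport hψtest.compact
  have hθint : ∫ x, θ x = 0 := by
    rw [hθ, integral_sub hφint (hψint.const_mul m), integral_const_mul, hψ1, mul_one, ← hm,
      sub_self]
  have hθI : Integrable θ := hφint.sub (hψint.const_mul m)
  -- the supports of `φ` and `ψ` lie in a compact subinterval
  obtain ⟨a', b', ha', hb', hsupp⟩ : ∃ a' b', a < a' ∧ b' < b ∧ ∀ x ∉ Icc a' b', θ x = 0 := by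
    set S := tsupport φ ∪ tsupport ψ with hS
    have hSc : IsCompact S := hφ.compact.isCompact.union hψtest.compact.isCompact
    have hSne : S.Nonempty := by
      by_contra hne
      have : ∀ x, ψ x = 0 := fun x => image_eq_zero_of_notMem_tsupport fun hx =>
        hne ⟨x, Or.inr hx⟩
      simp [this] at hψ1
    have hSsub : S ⊆ Ioo a b := union_subset hφ.subset hψtest.subset
    refine ⟨sInf S, sSup S, (hSsub (hSc.sInf_mem hSne)).1, (hSsub (hSc.sSup_mem hSne)).2, ?_⟩
    intro x hx
    have hxS : x ∉ S := fun h => hx ⟨csInf_le hSc.bddBelow h, le_csSup hSc.bddAbove h⟩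
    have h1 : φ x = 0 := image_eq_zero_of_notMem_tsupport fun h => hxS (Or.inl h)
    have h2 : ψ x = 0 := image_eq_zero_of_notMem_tsupport fun h => hxS (Or.inr h)
    simp [hθ, h1, h2]
  set η : ℝ → ℝ := fun x => ∫ y in a..x, θ y with hη
  have hderiv : ∀ x, HasDerivAt η (θ x) x := fun x =>
    intervalIntegral.integral_hasDerivAt_right (hθc.continuous.intervalIntegrable _ _)
      hθc.continuous.aestronglyMeasurable.stronglyMeasurableAtFilter hθc.continuous.continuousAt
  have hdη : deriv η = θ := funext fun x => (hderiv x).deriv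
  have hηsupp : ∀ x ∉ Icc a' b', η x = 0 := by
    intro x hx
    by_cases hxa : x < a'
    · rw [hη]
      refine intervalIntegral.integral_zero_ae (Eventually.of_forall fun y hy => hsupp y ?_)
      intro hy'
      have := (uIoc_subset_uIcc hy)
      rcases le_total a x with hax | hax
      · rw [uIcc_of_le hax] at this; linarith [this.2, hy'.1]
      · rw [uIcc_of_ge hax] at this; linarith [this.2, hy'.1]
    · have hxb : b' < x := by
        by_contra hxb; exact hx ⟨not_lt.1 hxa, not_lt.1 hxb⟩
      have hax : a ≤ x := by linarith [not_lt.1 hxa]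
      rw [hη]
      simp only
      rw [intervalIntegral.integral_of_le hax, ← hθint]
      refine setIntegral_eq_integral_of_forall_compl_eq_zero fun y hy => hsupp y fun hy' => hy ?_
      exact ⟨ha'.trans_le hy'.1, hy'.2.trans hxb.le⟩
  have htsupp : tsupport η ⊆ Icc a' b' :=
    closure_minimal (fun x hx => by
      by_contra hx'; exact hx (hηsupp x hx')) isClosed_Icc
  have hηtest : IsTest a b η := by
    refine ⟨contDiff_infty_iff_deriv.2 ⟨fun x => (hderiv x).differentiableAt, hdη ▸ hθc⟩,
      HasCompactSupport.intro isCompact_Icc hηsupp, fun x hx => ?_⟩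
    have := htsupp hx
    exact ⟨ha'.trans_le this.1, this.2.trans_lt hb'⟩
  have h0 := h η hηtest
  rw [hdη] at h0
  have h1 : ∫ x in Ioo a b, f x * θ x =
      (∫ x in Ioo a b, f x * φ x) - m * c := by
    rw [hc, ← integral_const_mul, ← integral_sub (hint f hf φ hφ)
      ((hint f hf ψ hψtest).const_mul m)]
    congr 1; ext x; simp only [hθ]; ring
  have h2 : ∫ x in Ioo a b, c * φ x = c * m := by
    rw [integral_const_mul, hm, setIntegral_eq_integral_of_forall_compl_eq_zero]
    intro x hx; exact hφ.eq_zero hx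
  rw [h2]
  linarith

/-- A primitive of an integrable function is absolutely continuous, so it can be integrated by parts
against a test function, whose boundary values are zero. -/
theorem isWeakDeriv_primitive {a b : ℝ} (hab : a ≤ b) {w : ℝ → ℝ}
    (hw : IntervalIntegrable w volume a b) {η : ℝ → ℝ} (hη : IsTest a b η) (c : ℝ) :
    ∫ x in Ioo a b, (c + ∫ y in a..x, w y) * deriv η x = -∫ x in Ioo a b, w x * η x := by
  set W : ℝ → ℝ := fun x => c + ∫ y in a..x, w y with hW
  have hWac : AbsolutelyContinuousOnInterval W a b := by
    have h1 := hw.absolutelyContinuousOnInterval_intervalIntegral (c := a) (by simp)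
    have h2 : AbsolutelyContinuousOnInterval (fun _ : ℝ => c) a b :=
      ContDiffOn.absolutelyContinuousOnInterval contDiffOn_const
    exact h2.add h1
  have hηac : AbsolutelyContinuousOnInterval η a b :=
    ContDiffOn.absolutelyContinuousOnInterval ((hη.contDiff.of_le (by simp)).contDiffOn)
  have h := hWac.integral_mul_deriv_eq_deriv_mul hηac
  rw [hη.eq_zero (x := a) (by simp), hη.eq_zero (x := b) (by simp)] at h
  rw [setIntegral_Ioo_eq hab, setIntegral_Ioo_eq hab, h]
  simp only [mul_zero, sub_self, zero_sub, neg_inj]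
  refine intervalIntegral.integral_congr_ae ?_
  filter_upwards [hw.ae_hasDerivAt_integral] with x hx hxI
  have := hx (uIoc_subset_uIcc hxI) a (by simp)
  rw [(this.const_add c).deriv]

theorem ae_eq_primitive {a b : ℝ} (hab : a < b) {f w : ℝ → ℝ}
    (hf : MemLp f 2 (volume.restrict (Ioo a b))) (hw : IntervalIntegrable w volume a b)
    (h : IsWeakDeriv a b 1 f w) :
    ∃ c : ℝ, f =ᵐ[volume.restrict (Ioo a b)] fun x => c + ∫ y in a..x, w y := by
  have hcont : ContinuousOn (fun x => ∫ y in a..x, w y) (uIcc a b) :=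
    (hw.absolutelyContinuousOnInterval_intervalIntegral (c := a) (by simp)).continuousOn
  rw [uIcc_of_le hab.le] at hcont
  have hWI : IntegrableOn (fun x => ∫ y in a..x, w y) (Ioo a b) :=
    (hcont.integrableOn_Icc).mono_set Ioo_subset_Icc_self
  have hfI : IntegrableOn f (Ioo a b) := hf.integrable (by norm_num)
  obtain ⟨c, hc⟩ := ae_const_of_integral_mul_deriv_eq_zero hab
    (f := fun x => f x - ∫ y in a..x, w y) (hfI.sub hWI).locallyIntegrableOn (by
      intro η hη
      obtain ⟨C, hC⟩ := hη.deriv.contDiff.continuous.bounded_above_of_compact_support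
        hη.deriv.compact
      have hm : AEStronglyMeasurable (deriv η) (volume.restrict (Ioo a b)) :=
        hη.deriv.contDiff.continuous.aestronglyMeasurable
      have i1 : IntegrableOn (fun x => f x * deriv η x) (Ioo a b) :=
        hfI.mul_bdd (c := C) hm (Eventually.of_forall hC)
      have i2 : IntegrableOn (fun x => (∫ y in a..x, w y) * deriv η x) (Ioo a b) :=
        hWI.mul_bdd (c := C) hm (Eventually.of_forall hC)
      have h1 := h.integral_eq hη
      have h2 := isWeakDeriv_primitive hab.le hw hη 0
      simp only [zero_add] at h2
      rw [iteratedDeriv_one] at h1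
      simp only [sub_mul]
      rw [integral_sub i1 i2, h1, h2]
      ring)
  refine ⟨c, ?_⟩
  filter_upwards [hc] with x hx
  linarith

/-- `φ 0, φ 1, …, φ n` are the successive derivatives of `φ 0 ∈ Hⁿ(a, b)`, the first `n` of them in
their continuous representatives. -/
structure SobolevChain (a b : ℝ) (n : ℕ) (φ : ℕ → ℝ → ℝ) : Prop where
  continuousOn : ∀ l < n, ContinuousOn (φ l) (Icc a b)
  memLp : MemLp (φ n) 2 (volume.restrict (Ioo a b))
  ftc : ∀ l < n, ∀ x ∈ Icc a b, ∀ y ∈ Icc a b, φ l y - φ l x = ∫ z in x..y, φ (l + 1) z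

theorem integral_mul_iteratedDeriv_of_weakDeriv_one {a b : ℝ} {f w₁ w : ℝ → ℝ} {j : ℕ}
    (h1 : IsWeakDeriv a b 1 f w₁) (h : IsWeakDeriv a b (j + 1) f w) : IsWeakDeriv a b j w₁ w := by
  refine ⟨h.1, fun η e1 e2 e3 => ?_⟩
  have hη : IsTest a b η := ⟨e1, e2, e3⟩
  have i1 := h1.integral_eq (hη.iteratedDeriv j)
  have i2 := h.integral_eq hη
  rw [iteratedDeriv_one, ← iteratedDeriv_succ, i2] at i1
  rw [pow_succ] at i1
  linarith

/-- Induction applied to the weak derivative of `f`, which has one order less. Since `f` differs by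
a constant from the primitive of that derivative almost everywhere, this primitive is the continuous
representative placed at the head of the chain. -/
theorem exists_sobolevChain_ae {a b : ℝ} (hab : a < b) (n : ℕ) {f : ℝ → ℝ} (hf : MemH a b n f) :
    ∃ φ : ℕ → ℝ → ℝ, f =ᵐ[volume.restrict (Ioo a b)] φ 0 ∧ SobolevChain a b n φ ∧
      ∀ l ≤ n, IsWeakDeriv a b l (φ 0) (φ l) := by
  induction n generalizing f with
  | zero =>
    refine ⟨fun _ => f, EventuallyEq.rfl, ⟨by simp, hf.1, by simp⟩, fun l hl => ?_⟩
    obtain rfl : l = 0 := by omega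
    refine ⟨?_, fun η _ _ _ => by simp⟩
    have : IntegrableOn f (Ioo a b) := hf.1.integrable (by norm_num)
    exact this.locallyIntegrableOn
  | succ n ih =>
    obtain ⟨w, hwL, hw⟩ := hf.2 1 (by omega)
    have hwH : MemH a b n w := by
      refine ⟨hwL, fun j hj => ?_⟩
      obtain ⟨v, hvL, hv⟩ := hf.2 (j + 1) (by omega)
      exact ⟨v, hvL, integral_mul_iteratedDeriv_of_weakDeriv_one hw hv⟩
    obtain ⟨φ, hφ0, hφ, hφw⟩ := ih hwH
    have hφ0L : MemLp (φ 0) 2 (volume.restrict (Ioo a b)) := hwL.ae_eq hφ0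
    have hφ0I := intervalIntegrable_of_memLp hab.le hφ0L
    have hw0 : IsWeakDeriv a b 1 f (φ 0) := by
      have hI : IntegrableOn (φ 0) (Ioo a b) := hφ0L.integrable (by norm_num)
      refine ⟨hI.locallyIntegrableOn, fun η e1 e2 e3 => ?_⟩
      rw [hw.2 η e1 e2 e3]
      congr 1
      refine integral_congr_ae ?_
      filter_upwards [hφ0] with x hx
      rw [hx]
    obtain ⟨c, hc⟩ := ae_eq_primitive hab hf.1 hφ0I hw0
    set Φ : ℕ → ℝ → ℝ := fun l => Nat.casesOn l (fun x => c + ∫ y in a..x, φ 0 y) φ with hΦ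
    have hII : ∀ x ∈ Icc a b, ∀ y ∈ Icc a b, IntervalIntegrable (φ 0) volume x y :=
      fun x hx y hy => hφ0I.mono_set (by
        rw [uIcc_of_le hab.le]; exact uIcc_subset_Icc hx hy)
    refine ⟨Φ, hc, ⟨?_, hφ.memLp, ?_⟩, ?_⟩
    · rintro (_ | l) hl
      · have := (hφ0I.absolutelyContinuousOnInterval_intervalIntegral (c := a)
          (by simp)).continuousOn
        rw [uIcc_of_le hab.le] at this
        exact continuousOn_const.add this
      · exact hφ.continuousOn l (by omega)
    · rintro (_ | l) hl x hx y hy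
      · have := intervalIntegral.integral_add_adjacent_intervals
          (hII a (left_mem_Icc.2 hab.le) x hx) (hII x hx y hy)
        change (c + ∫ z in a..y, φ 0 z) - (c + ∫ z in a..x, φ 0 z) = ∫ z in x..y, φ 0 z
        linarith
      · exact hφ.ftc l (by omega) x hx y hy
    · rintro (_ | l) hl
      · have hI : IntegrableOn (Φ 0) (Ioo a b) := by
          have : IntegrableOn f (Ioo a b) := hf.1.integrable (by norm_num)
          exact this.congr hc
        exact ⟨hI.locallyIntegrableOn, fun η _ _ _ => by simp⟩
      · refine ⟨(hφw l (by omega)).1, fun η e1 e2 e3 => ?_⟩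
        have hη : IsTest a b η := ⟨e1, e2, e3⟩
        have i1 := isWeakDeriv_primitive hab.le hφ0I (hη.iteratedDeriv l) c
        have i2 := (hφw l (by omega)).integral_eq hη
        rw [← iteratedDeriv_succ, i2] at i1
        refine i1.trans ?_
        rw [pow_succ]
        change _ = _ * ∫ x in Ioo a b, φ l x * η x
        ring

theorem eqOn_Icc_of_ae_eq {a b : ℝ} (hab : a < b) {f g : ℝ → ℝ} (hf : ContinuousOn f (Icc a b))
    (hg : ContinuousOn g (Icc a b)) (h : f =ᵐ[volume.restrict (Ioo a b)] g) :
    EqOn f g (Icc a b) := by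
  have h' : f =ᵐ[volume.restrict (Icc a b)] g := by
    rwa [← restrict_Ioo_eq_restrict_Icc]
  exact Measure.eqOn_Icc_of_ae_eq volume hab.ne h' hf hg

/-- A continuous function in `Hⁿ(a, b)`, `n ≥ 1`, has `n - 1` continuous derivatives, and all its
derivatives are controlled by the `Hⁿ` norm. -/
theorem exists_sobolevChain {a b : ℝ} (hab : a < b) {n : ℕ} (hn : 1 ≤ n) {f : ℝ → ℝ}
    (hf : MemH a b n f) (hfc : ContinuousOn f (Icc a b)) :
    ∃ φ : ℕ → ℝ → ℝ, φ 0 = f ∧ SobolevChain a b n φ ∧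
      ∀ l ≤ n, ∫ x in a..b, φ l x ^ 2 ≤ hNorm a b n f ^ 2 := by
  obtain ⟨φ, h0, hφ, hw⟩ := exists_sobolevChain_ae hab n hf
  have heq : EqOn f (φ 0) (Icc a b) := eqOn_Icc_of_ae_eq hab hfc (hφ.continuousOn 0 (by omega)) h0
  -- The head of the chain is replaced by `f` itself. The two agree on the closed interval by
  -- continuity, but they may differ outside it.
  refine ⟨fun l => Nat.casesOn l f fun l => φ (l + 1), rfl, ⟨?_, ?_, ?_⟩, ?_⟩
  · rintro (_ | l) hl
    · exact hfc
    · exact hφ.continuousOn _ hl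
  · obtain ⟨n, rfl⟩ : ∃ n', n = n' + 1 := ⟨n - 1, by omega⟩
    exact hφ.memLp
  · rintro (_ | l) hl x hx y hy
    · change f y - f x = _
      rw [heq hx, heq hy]
      exact hφ.ftc 0 hl x hx y hy
    · exact hφ.ftc _ hl x hx y hy
  · intro l hl
    have hwl : IsWeakDeriv a b l f (φ l) := (hw l hl).congr h0.symm
    have h1 : ∫ x in Ioo a b, weakDeriv a b l f x ^ 2 = ∫ x in a..b, φ l x ^ 2 := by
      rw [← setIntegral_Ioo_eq hab.le]
      refine integral_congr_ae ?_
      filter_upwards [hf.ae_eq_weakDeriv hl hwl] with x hx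
      rw [hx]
    have h2 : ∫ x in a..b, φ l x ^ 2 ≤ hNorm a b n f ^ 2 := by
      rw [← h1, hNorm, Real.sq_sqrt (Finset.sum_nonneg fun j _ =>
        integral_nonneg fun x => sq_nonneg _)]
      exact Finset.single_le_sum
        (f := fun j => ∫ x in Ioo a b, weakDeriv a b j f x ^ 2)
        (fun j _ => integral_nonneg fun x => sq_nonneg _)
        (Finset.mem_range.2 (by omega))
    rcases l with _ | l
    · refine le_of_eq_of_le ?_ h2
      refine intervalIntegral.integral_congr fun x hx => ?_
      rw [uIcc_of_le hab.le] at hx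
      change f x ^ 2 = _
      rw [heq hx]
    · exact h2

end OFSV

end

noncomputable section

namespace OFSV

open Polynomial Set MeasureTheory Filter Topology

/-! ### Estimates for chains of derivatives -/

theorem intervalIntegrable_sq_of_memLp {a b : ℝ} (hab : a ≤ b) {f : ℝ → ℝ}
    (hf : MemLp f 2 (volume.restrict (Ioo a b))) :
    IntervalIntegrable (fun x => f x ^ 2) volume a b := by
  rw [intervalIntegrable_iff_integrableOn_Ioo_of_le hab]
  exact hf.integrable_sq

theorem sq_integral_abs_le {a b : ℝ} (hab : a ≤ b) {f : ℝ → ℝ}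
    (hf : MemLp f 2 (volume.restrict (Ioo a b))) :
    (∫ x in a..b, |f x|) ^ 2 ≤ (b - a) * ∫ x in a..b, f x ^ 2 := by
  rcases hab.eq_or_lt with rfl | hlt
  · simp
  set I := ∫ x in a..b, |f x| with hI
  have h1 : IntervalIntegrable (fun x => |f x|) volume a b :=
    (intervalIntegrable_of_memLp hab hf).abs
  have h2 := intervalIntegrable_sq_of_memLp hab hf
  have h0 : 0 ≤ ∫ x in a..b, ((b - a) * |f x| - I) ^ 2 :=
    intervalIntegral.integral_nonneg hab fun x _ => sq_nonneg _
  -- Cauchy-Schwarz in the form of a nonnegative variance of `|f|`.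
  have h3 : ∀ x, ((b - a) * |f x| - I) ^ 2 =
      ((b - a) ^ 2 * f x ^ 2 - 2 * (b - a) * I * |f x|) + I ^ 2 := fun x => by
    rw [← sq_abs (f x)]; ring
  simp only [h3] at h0
  rw [intervalIntegral.integral_add ((h2.const_mul _).sub (h1.const_mul _)) (by simp),
    intervalIntegral.integral_sub (h2.const_mul _) (h1.const_mul _),
    intervalIntegral.integral_const_mul, intervalIntegral.integral_const_mul,
    intervalIntegral.integral_const, ← hI, smul_eq_mul] at h0
  have h4 : 0 ≤ (b - a) * ((b - a) * (∫ x in a..b, f x ^ 2) - I ^ 2) := by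
    calc (0 : ℝ) ≤ _ := h0
      _ = _ := by ring
  have := nonneg_of_mul_nonneg_right h4 (sub_pos.2 hlt)
  linarith

theorem abs_integral_le_integral_abs {a b x y : ℝ} (hx : x ∈ Icc a b) (hy : y ∈ Icc a b)
    {f : ℝ → ℝ} (hf : IntervalIntegrable f volume a b) :
    |∫ z in x..y, f z| ≤ ∫ z in a..b, |f z| := by
  have hab : a ≤ b := hx.1.trans hx.2
  have h1 := intervalIntegral.norm_integral_le_abs_integral_norm (f := f) (a := x) (b := y)
    (μ := volume)
  have hsub : uIoc x y ⊆ uIoc a b := by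
    rw [uIoc_of_le hab]
    intro w hw
    rcases le_total x y with h | h
    · rw [uIoc_of_le h] at hw; exact ⟨hx.1.trans_lt hw.1, hw.2.trans hy.2⟩
    · rw [uIoc_of_ge h] at hw; exact ⟨hy.1.trans_lt hw.1, hw.2.trans hx.2⟩
  have h2 := intervalIntegral.abs_integral_mono_interval (μ := volume) (f := fun z => |f z|)
    hsub (Eventually.of_forall fun z => abs_nonneg _) hf.abs
  rw [abs_of_nonneg (intervalIntegral.integral_nonneg hab fun z _ => abs_nonneg (f z))] at h2
  exact h1.trans h2

theorem memLp_of_continuousOn {a b : ℝ} {f : ℝ → ℝ} (hf : ContinuousOn f (Icc a b)) :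
    MemLp f 2 (volume.restrict (Ioo a b)) := by
  obtain ⟨C, hC⟩ := isCompact_Icc.exists_bound_of_continuousOn hf
  refine MemLp.of_bound ((hf.mono Ioo_subset_Icc_self).aestronglyMeasurable measurableSet_Ioo) C ?_
  rw [ae_restrict_iff' measurableSet_Ioo]
  exact Eventually.of_forall fun x hx => hC x (Ioo_subset_Icc_self hx)

namespace SobolevChain

variable {a b : ℝ} {n : ℕ} {φ : ℕ → ℝ → ℝ}

theorem memLp_of_le (h : SobolevChain a b n φ) {l : ℕ} (hl : l ≤ n) :
    MemLp (φ l) 2 (volume.restrict (Ioo a b)) := by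
  rcases hl.eq_or_lt with rfl | hlt
  · exact h.memLp
  · exact memLp_of_continuousOn (h.continuousOn l hlt)

theorem of_le (h : SobolevChain a b n φ) {m : ℕ} (hm : m ≤ n) : SobolevChain a b m φ :=
  ⟨fun l hl => h.continuousOn l (hl.trans_le hm), h.memLp_of_le hm,
    fun l hl => h.ftc l (hl.trans_le hm)⟩

theorem tail (h : SobolevChain a b (n + 1) φ) : SobolevChain a b n fun l => φ (l + 1) :=
  ⟨fun l hl => h.continuousOn _ (by omega), h.memLp, fun l hl => h.ftc _ (by omega)⟩

theorem mono (h : SobolevChain a b n φ) {c d : ℝ} (hac : a ≤ c) (hdb : d ≤ b) :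
    SobolevChain c d n φ :=
  ⟨fun l hl => (h.continuousOn l hl).mono (Icc_subset_Icc hac hdb),
    h.memLp.mono_measure (Measure.restrict_mono (Ioo_subset_Ioo hac hdb) le_rfl),
    fun l hl x hx y hy =>
      h.ftc l hl x (Icc_subset_Icc hac hdb hx) y (Icc_subset_Icc hac hdb hy)⟩

theorem intervalIntegrable (h : SobolevChain a b n φ) {l : ℕ} (hl : l ≤ n) {x y : ℝ}
    (hx : x ∈ Icc a b) (hy : y ∈ Icc a b) : IntervalIntegrable (φ l) volume x y := by
  have hab : a ≤ b := hx.1.trans hx.2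
  exact (intervalIntegrable_of_memLp hab (h.memLp_of_le hl)).mono_set (by
    rw [uIcc_of_le hab]; exact uIcc_subset_Icc hx hy)

theorem sub_polynomial (h : SobolevChain a b n φ) (p : ℝ[X]) :
    SobolevChain a b n fun l x => φ l x - (derivative^[l] p).eval x := by
  refine ⟨fun l hl => (h.continuousOn l hl).sub (Polynomial.continuous _).continuousOn,
    h.memLp.sub (memLp_of_continuousOn (Polynomial.continuous _).continuousOn), ?_⟩
  intro l hl x hx y hy
  rw [intervalIntegral.integral_sub (h.intervalIntegrable (by omega) hx hy)
    (intervalIntegrable_eval _ _ _), ← h.ftc l hl x hx y hy, Function.iterate_succ_apply',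
    integral_derivative]
  ring

theorem hasDerivWithinAt (h : SobolevChain a b n φ) {l : ℕ} (hl : l + 1 < n) {x : ℝ}
    (hx : x ∈ Icc a b) : HasDerivWithinAt (φ l) (φ (l + 1) x) (Icc a b) x := by
  have hab : a ≤ b := hx.1.trans hx.2
  have ha : a ∈ Icc a b := left_mem_Icc.2 hab
  have : Fact (x ∈ Icc a b) := ⟨hx⟩
  have hc := h.continuousOn (l + 1) hl
  have h1 := intervalIntegral.integral_hasDerivWithinAt_right (s := Icc a b) (t := Icc a b)
    (h.intervalIntegrable (l := l + 1) (by omega) ha hx)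
    (hc.stronglyMeasurableAtFilter_nhdsWithin measurableSet_Icc x) (hc x hx)
  have h2 : ∀ y ∈ Icc a b, φ l y = φ l a + ∫ z in a..y, φ (l + 1) z := fun y hy => by
    rw [← h.ftc l (by omega) a ha y hy]; ring
  exact (h1.const_add (φ l a)).congr h2 (h2 x hx)

theorem hasDerivAt (h : SobolevChain a b n φ) {l : ℕ} (hl : l + 1 < n) {x : ℝ}
    (hx : x ∈ Ioo a b) : HasDerivAt (φ l) (φ (l + 1) x) x :=
  (h.hasDerivWithinAt hl (Ioo_subset_Icc_self hx)).hasDerivAt (Icc_mem_nhds hx.1 hx.2)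

/-! ### Rolle's theorem and Lagrange interpolation -/

theorem exists_zeros {k : ℕ} (h : SobolevChain a b (k + 1) φ) {z : ℕ → ℝ}
    (hz : ∀ j ≤ k, z j ∈ Icc a b ∧ φ 0 (z j) = 0) (hlt : ∀ j < k, z j < z (j + 1)) {l : ℕ}
    (hl : l ≤ k) : ∃ z : ℕ → ℝ, (∀ j ≤ k - l, z j ∈ Icc a b ∧ φ l (z j) = 0) ∧
      ∀ j < k - l, z j < z (j + 1) := by
  induction l with
  | zero => exact ⟨z, hz, hlt⟩
  | succ l ih =>
    obtain ⟨y, hy, hylt⟩ := ih (by omega)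
    have key : ∀ j, ∃ c, j < k - l → c ∈ Ioo (y j) (y (j + 1)) ∧ φ (l + 1) c = 0 := by
      intro j
      by_cases hj : j < k - l
      · have hj0 := hy j (by omega)
        have hj1 := hy (j + 1) (by omega)
        obtain ⟨c, hc, hc0⟩ := exists_hasDerivAt_eq_zero (f := φ l) (f' := φ (l + 1))
          (hylt j hj) ((h.continuousOn l (by omega)).mono (Icc_subset_Icc hj0.1.1 hj1.1.2))
          (hj0.2.trans hj1.2.symm)
          (fun x hx => h.hasDerivAt (by omega) ⟨hj0.1.1.trans_lt hx.1, hx.2.trans_le hj1.1.2⟩)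
        exact ⟨c, fun _ => ⟨hc, hc0⟩⟩
      · exact ⟨0, fun h => absurd h hj⟩
    choose c hc using key
    refine ⟨c, fun j hj => ?_, fun j hj => ?_⟩
    · obtain ⟨h1, h2⟩ := hc j (by omega)
      exact ⟨⟨(hy j (by omega)).1.1.trans h1.1.le, h1.2.le.trans (hy (j + 1) (by omega)).1.2⟩, h2⟩
    · exact (hc j (by omega)).1.2.trans (hc (j + 1) (by omega)).1.1

/-- By repeated Rolle every derivative up to order `k` has a zero, so it is bounded by the integral
of the next one; each descent in order costs one factor `b - a`. No separation of the zeros enters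
the constant. -/
theorem abs_le_of_zeros {k : ℕ} (h : SobolevChain a b (k + 1) φ) {z : ℕ → ℝ}
    (hz : ∀ j ≤ k, z j ∈ Icc a b ∧ φ 0 (z j) = 0) (hlt : ∀ j < k, z j < z (j + 1)) {m : ℕ}
    (hm : m ≤ k) {x : ℝ} (hx : x ∈ Icc a b) :
    |φ (k - m) x| ≤ (b - a) ^ m * ∫ y in a..b, |φ (k + 1) y| := by
  have hab : a ≤ b := hx.1.trans hx.2
  have key : ∀ l ≤ k, ∀ x ∈ Icc a b, |φ l x| ≤ ∫ y in a..b, |φ (l + 1) y| := by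
    intro l hl x hx
    obtain ⟨y, hy, -⟩ := h.exists_zeros hz hlt hl
    obtain ⟨hy1, hy2⟩ := hy 0 (by omega)
    have h1 := h.ftc l (by omega) (y 0) hy1 x hx
    rw [hy2, sub_zero] at h1
    rw [h1]
    exact abs_integral_le_integral_abs hy1 hx
      (h.intervalIntegrable (by omega) (left_mem_Icc.2 hab) (right_mem_Icc.2 hab))
  induction m generalizing x with
  | zero => simpa using key k le_rfl x hx
  | succ m ih =>
    refine (key (k - (m + 1)) (by omega) x hx).trans ?_
    have e : k - (m + 1) + 1 = k - m := by omega
    rw [e]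
    have := intervalIntegral.norm_integral_le_of_norm_le_const (a := a) (b := b)
      (f := fun y => |φ (k - m) y|) (C := (b - a) ^ m * ∫ y in a..b, |φ (k + 1) y|)
      (fun y hy => by
        rw [uIoc_of_le hab] at hy
        rw [Real.norm_eq_abs, abs_abs]
        exact ih (by omega) (Ioc_subset_Icc_self hy))
    calc ∫ y in a..b, |φ (k - m) y| ≤ ‖∫ y in a..b, |φ (k - m) y|‖ := Real.le_norm_self _
      _ ≤ _ := this
      _ = _ := by rw [abs_of_nonneg (sub_nonneg.2 hab)]; ring

/-- The error of Lagrange interpolation, uniformly in the choice of the nodes. -/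
theorem sq_interpolation_error_le {k : ℕ} (h : SobolevChain a b (k + 1) φ) {p : ℝ[X]}
    (hp : p.natDegree ≤ k) {z : ℕ → ℝ} (hz : ∀ j ≤ k, z j ∈ Icc a b ∧ p.eval (z j) = φ 0 (z j))
    (hlt : ∀ j < k, z j < z (j + 1)) {l : ℕ} (hl : l ≤ k) {x : ℝ} (hx : x ∈ Icc a b) :
    (φ l x - (derivative^[l] p).eval x) ^ 2 ≤
      (b - a) ^ (2 * (k - l) + 1) * ∫ y in a..b, φ (k + 1) y ^ 2 := by
  have hab : a ≤ b := hx.1.trans hx.2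
  have h1 := (h.sub_polynomial p).abs_le_of_zeros (z := z)
    (fun j hj => ⟨(hz j hj).1, by simp [(hz j hj).2]⟩) hlt (Nat.sub_le k l) hx
  have e : k - (k - l) = l := by omega
  have hd : derivative^[k + 1] p = 0 := iterate_derivative_eq_zero (by omega)
  rw [e] at h1
  simp only [hd, eval_zero, sub_zero] at h1
  have h2 := sq_integral_abs_le hab h.memLp
  calc (φ l x - (derivative^[l] p).eval x) ^ 2
      = |φ l x - (derivative^[l] p).eval x| ^ 2 := (sq_abs _).symm
    _ ≤ ((b - a) ^ (k - l) * ∫ y in a..b, |φ (k + 1) y|) ^ 2 :=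
        pow_le_pow_left₀ (abs_nonneg _) h1 2
    _ = ((b - a) ^ (k - l)) ^ 2 * (∫ y in a..b, |φ (k + 1) y|) ^ 2 := mul_pow _ _ _
    _ ≤ ((b - a) ^ (k - l)) ^ 2 * ((b - a) * ∫ y in a..b, φ (k + 1) y ^ 2) := by gcongr
    _ = _ := by ring

/-- The one-dimensional Sobolev inequality. -/
theorem sq_le_sobolev (hab : a < b) (h : SobolevChain a b n φ) {l : ℕ} (hl : l < n) {x : ℝ}
    (hx : x ∈ Icc a b) : φ l x ^ 2 ≤
      2 / (b - a) * (∫ y in a..b, φ l y ^ 2) + 2 * (b - a) * ∫ y in a..b, φ (l + 1) y ^ 2 := by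
  have hL : 0 < b - a := sub_pos.2 hab
  set I := ∫ y in a..b, φ (l + 1) y ^ 2 with hI
  have hmem := h.memLp_of_le (l := l + 1) hl
  have hpt : ∀ y ∈ Icc a b, φ l x ^ 2 ≤ 2 * φ l y ^ 2 + 2 * ((b - a) * I) := by
    intro y hy
    have h1 := h.ftc l hl y hy x hx
    have h2 : |∫ z in y..x, φ (l + 1) z| ≤ ∫ z in a..b, |φ (l + 1) z| :=
      abs_integral_le_integral_abs hy hx (intervalIntegrable_of_memLp hab.le hmem)
    have h3 : (φ l x - φ l y) ^ 2 ≤ (b - a) * I := by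
      rw [h1, ← sq_abs]
      exact (pow_le_pow_left₀ (abs_nonneg _) h2 2).trans (sq_integral_abs_le hab.le hmem)
    nlinarith [sq_nonneg (φ l x - 2 * φ l y)]
  have hsq := intervalIntegrable_sq_of_memLp hab.le (h.memLp_of_le hl.le)
  have h4 := intervalIntegral.integral_mono_on hab.le
    (f := fun _ => φ l x ^ 2) (g := fun y => 2 * φ l y ^ 2 + 2 * ((b - a) * I))
    (by simp) ((hsq.const_mul 2).add (by simp)) hpt
  rw [intervalIntegral.integral_add (hsq.const_mul 2) (by simp),
    intervalIntegral.integral_const, intervalIntegral.integral_const,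
    intervalIntegral.integral_const_mul, smul_eq_mul, smul_eq_mul] at h4
  have h5 : φ l x ^ 2 ≤
      (2 * (∫ y in a..b, φ l y ^ 2) + (b - a) * (2 * ((b - a) * I))) / (b - a) := by
    rw [le_div_iff₀ hL]; linarith
  refine h5.trans (le_of_eq ?_)
  field_simp

end SobolevChain

/-! ### Transport along characteristics -/

section Exact

variable {bc : BoundaryCondition} {a b T : ℝ} {u₀ : ℝ → ℝ} {u : ℝ → ℝ → ℝ}

/-- Along a characteristic the derivative is `D (1, 1) = D (0, 1) + D (1, 0) = 0`. It is needed only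
at interior parameters, so the missing differentiability at time zero does no harm. -/
theorem IsExactSolution.transport (hu : IsExactSolution bc a b T u₀ u) {x t δ : ℝ} (hδ : 0 ≤ δ)
    (hx : a ≤ x) (hxδ : x + δ ≤ b) (ht : 0 ≤ t) (htδ : t + δ ≤ T) :
    u (x + δ) (t + δ) = u x t := by
  rcases hδ.eq_or_lt with rfl | hpos
  · simp
  have hmem : ∀ s ∈ Icc 0 δ, (x + s, t + s) ∈ Icc a b ×ˢ Icc 0 T := fun s hs =>
    ⟨⟨by linarith [hs.1], by linarith [hs.2]⟩, ⟨by linarith [hs.1], by linarith [hs.2]⟩⟩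
  have hcont : ContinuousOn (fun s => u (x + s) (t + s)) (Icc 0 δ) :=
    hu.continuousOn.comp (f := fun s : ℝ => (x + s, t + s)) (by fun_prop) hmem
  have hder : ∀ s ∈ Ioo 0 δ, HasDerivAt (fun s => u (x + s) (t + s)) 0 s := by
    intro s hs
    obtain ⟨D, hD, hD0⟩ := hu.pde (x + s) (hmem s (Ioo_subset_Icc_self hs)).1 (t + s)
      ⟨by linarith [hs.1], (hmem s (Ioo_subset_Icc_self hs)).2.2⟩
    have hline : HasDerivWithinAt (fun s : ℝ => (x + s, t + s)) (1, 1) (Icc 0 δ) s :=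
      (((hasDerivAt_id s).const_add x).prodMk ((hasDerivAt_id s).const_add t)).hasDerivWithinAt
    have h := hD.comp_hasDerivWithinAt s hline hmem
    have h11 : D (1, 1) = 0 := by
      rw [← hD0, ← map_add]; simp
    rw [h11] at h
    exact h.hasDerivAt (Icc_mem_nhds hs.1 hs.2)
  obtain ⟨c, -, hc⟩ := exists_hasDerivAt_eq_slope _ (fun _ => 0) hpos hcont hder
  rw [eq_comm, div_eq_zero_iff] at hc
  simp only [add_zero, sub_zero] at hc
  rcases hc with hc | hc
  · linarith
  · exact absurd hc hpos.ne'

theorem hNorm_sq {a b : ℝ} (hab : a ≤ b) (n : ℕ) (f : ℝ → ℝ) :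
    hNorm a b n f ^ 2 = ∑ j ∈ Finset.range (n + 1), ∫ x in a..b, weakDeriv a b j f x ^ 2 := by
  rw [hNorm, Real.sq_sqrt (Finset.sum_nonneg fun j _ => integral_nonneg fun x => sq_nonneg _)]
  exact Finset.sum_congr rfl fun j _ => setIntegral_Ioo_eq hab _

/-- The norm at an intermediate time is controlled by those at an earlier and a later time. -/
theorem IsExactSolution.hNorm_sq_le (hu : IsExactSolution bc a b T u₀ u) {n : ℕ}
    (hH : ∀ t ∈ Icc 0 T, MemH a b n (fun x => u x t)) {t₁ t t₂ : ℝ} (h1 : 0 ≤ t₁) (h1t : t₁ ≤ t)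
    (ht2 : t ≤ t₂) (h2 : t₂ ≤ T) (h12 : t₂ - t₁ ≤ b - a) :
    hNorm a b n (fun x => u x t) ^ 2 ≤
      hNorm a b n (fun x => u x t₁) ^ 2 + hNorm a b n (fun x => u x t₂) ^ 2 := by
  have hab : a ≤ b := by linarith
  have m1 := hH t₁ ⟨h1, by linarith⟩
  have m := hH t ⟨by linarith, by linarith⟩
  have m2 := hH t₂ ⟨by linarith, h2⟩
  rw [hNorm_sq hab, hNorm_sq hab, hNorm_sq hab, ← Finset.sum_add_distrib]
  refine Finset.sum_le_sum fun j hj => ?_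
  have hj : j ≤ n := by have := Finset.mem_range.1 hj; omega
  have i1 := intervalIntegrable_sq_of_memLp hab (m1.memLp_weakDeriv hj)
  have i := intervalIntegrable_sq_of_memLp hab (m.memLp_weakDeriv hj)
  have i2 := intervalIntegrable_sq_of_memLp hab (m2.memLp_weakDeriv hj)
  have e1 := integral_weakDeriv_sq_of_translate (δ := t - t₁) (by linarith) (by linarith) hj m1 m
    (fun x hx => by
      have := hu.transport (x := x) (t := t₁) (δ := t - t₁) (by linarith) hx.1.le
        (by linarith [hx.2]) h1 (by linarith)
      rw [← this]; congr 1; ring)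
  have e2 := integral_weakDeriv_sq_of_translate (δ := t₂ - t) (by linarith) (by linarith) hj m m2
    (fun x hx => by
      have := hu.transport (x := x) (t := t) (δ := t₂ - t) (by linarith) hx.1.le
        (by linarith [hx.2]) (by linarith) (by linarith)
      rw [← this]; congr 1; ring)
  -- Left of `c` the profile at time `t` reappears at `t₂`; right of `c` it comes from `t₁`. The
  -- hypothesis `t₂ - t₁ ≤ b - a` says that these two ranges cover the interval.
  set c := b - (t₂ - t) with hc
  have hac : a + (t - t₁) ≤ c := by rw [hc]; linarith
  have hcb : c ≤ b := by rw [hc]; linarith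
  have hsub : ∀ {f : ℝ → ℝ}, IntervalIntegrable f volume a b → ∀ {x y : ℝ}, x ∈ Icc a b →
      y ∈ Icc a b → IntervalIntegrable f volume x y := fun hf x y hx hy =>
    hf.mono_set (by rw [uIcc_of_le hab]; exact uIcc_subset_Icc hx hy)
  have ha : a ∈ Icc a b := left_mem_Icc.2 hab
  have hb : b ∈ Icc a b := right_mem_Icc.2 hab
  have hcm : c ∈ Icc a b := ⟨by linarith, hcb⟩
  have hmono : ∀ {f : ℝ → ℝ}, IntervalIntegrable (fun x => f x ^ 2) volume a b → ∀ {x y : ℝ},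
      a ≤ x → x ≤ y → y ≤ b → ∫ z in x..y, f z ^ 2 ≤ ∫ z in a..b, f z ^ 2 :=
    fun hf x y h1 h2 h3 => intervalIntegral.integral_mono_interval h1 h2 h3
      (Eventually.of_forall fun z => sq_nonneg _) hf
  rw [← intervalIntegral.integral_add_adjacent_intervals (hsub i ha hcm) (hsub i hcm hb), e2,
    add_comm]
  refine add_le_add ?_ (hmono i2 (by linarith) (by linarith) le_rfl)
  calc ∫ x in c..b, weakDeriv a b j (fun x => u x t) x ^ 2
      ≤ ∫ x in (a + (t - t₁))..b, weakDeriv a b j (fun x => u x t) x ^ 2 :=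
        intervalIntegral.integral_mono_interval hac hcb le_rfl
          (Eventually.of_forall fun z => sq_nonneg _)
          (hsub i ⟨by linarith, by linarith⟩ hb)
    _ = ∫ x in a..(b - (t - t₁)), weakDeriv a b j (fun x => u x t₁) x ^ 2 := e1.symm
    _ ≤ _ := hmono i1 le_rfl (by linarith) (by linarith)

theorem IsExactSolution.bddAbove_hNorm (hu : IsExactSolution bc a b T u₀ u) (hab : a < b)
    {n : ℕ} (hH : ∀ t ∈ Icc 0 T, MemH a b n (fun x => u x t)) :
    BddAbove ((fun t => hNorm a b n (fun x => u x t)) '' Icc 0 T) := by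
  set L := b - a with hL
  have hLpos : 0 < L := sub_pos.2 hab
  -- The grid has spacing `L` and is truncated at `T`. The index after the floor of `T / L` is also
  -- used, hence `+ 2`.
  set N := ⌊T / L⌋₊ + 2 with hN
  set τ : ℕ → ℝ := fun m => min (m * L) T with hτ
  set S := ∑ m ∈ Finset.range N, hNorm a b n (fun x => u x (τ m)) ^ 2 with hS
  have hle : ∀ m < N, hNorm a b n (fun x => u x (τ m)) ^ 2 ≤ S := fun m hm =>
    Finset.single_le_sum (f := fun m => hNorm a b n (fun x => u x (τ m)) ^ 2)
      (fun j _ => sq_nonneg _) (Finset.mem_range.2 hm)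
  refine ⟨√(S + S), ?_⟩
  rintro _ ⟨t, ht, rfl⟩
  have hT : 0 ≤ T := ht.1.trans ht.2
  set m := ⌊t / L⌋₊ with hm
  have hm1 : m * L ≤ t := by
    rw [← le_div_iff₀ hLpos]; exact Nat.floor_le (div_nonneg ht.1 hLpos.le)
  have hm2 : t < (m + 1) * L := by
    rw [← div_lt_iff₀ hLpos]; exact Nat.lt_floor_add_one _
  have hmN : m ≤ ⌊T / L⌋₊ := Nat.floor_le_floor (div_le_div_of_nonneg_right ht.2 hLpos.le)
  have h := hu.hNorm_sq_le hH (t₁ := τ m) (t := t) (t₂ := τ (m + 1))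
    (le_min (by positivity) hT) (min_le_left _ _ |>.trans hm1)
    (le_min (by push_cast; exact hm2.le) ht.2) (min_le_right _ _) (by
      have e : τ m = m * L := min_eq_left (hm1.trans ht.2)
      have e' : τ (m + 1) ≤ ((m + 1 : ℕ) : ℝ) * L := min_le_left _ _
      push_cast at e'
      rw [e]; linarith)
  refine Real.le_sqrt_of_sq_le (h.trans (add_le_add (hle m (by omega)) (hle (m + 1) (by omega))))

/-! ### Derivatives of the exact solution -/

/-- `f l x t` is the `l`-th derivative in `x` of the exact solution `u`, in its continuous
representative for `l < n`. -/
structure IsDerivFamily (a b T : ℝ) (n : ℕ) (u : ℝ → ℝ → ℝ) (f : ℕ → ℝ → ℝ → ℝ) : Prop where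
  zero : ∀ t ∈ Icc 0 T, ∀ x, f 0 x t = u x t
  chain : ∀ t ∈ Icc 0 T, SobolevChain a b n fun l x => f l x t
  integral_le : ∀ t ∈ Icc 0 T, ∀ l ≤ n,
    ∫ x in a..b, f l x t ^ 2 ≤ hNorm a b n (fun x => u x t) ^ 2

theorem IsExactSolution.continuousOn_space (hu : IsExactSolution bc a b T u₀ u) {t : ℝ}
    (ht : t ∈ Icc 0 T) : ContinuousOn (fun x => u x t) (Icc a b) :=
  hu.continuousOn.comp (f := fun x : ℝ => (x, t)) (by fun_prop) fun _ hx => ⟨hx, ht⟩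

theorem IsExactSolution.exists_derivFamily (hu : IsExactSolution bc a b T u₀ u) (hab : a < b)
    {n : ℕ} (hn : 1 ≤ n) (hH : ∀ t ∈ Icc 0 T, MemH a b n (fun x => u x t)) :
    ∃ f, IsDerivFamily a b T n u f := by
  have key : ∀ t, ∃ φ : ℕ → ℝ → ℝ, t ∈ Icc 0 T → φ 0 = (fun x => u x t) ∧
      SobolevChain a b n φ ∧
      ∀ l ≤ n, ∫ x in a..b, φ l x ^ 2 ≤ hNorm a b n (fun x => u x t) ^ 2 := by
    intro t
    by_cases ht : t ∈ Icc 0 T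
    · obtain ⟨φ, h⟩ := exists_sobolevChain hab hn (hH t ht) (hu.continuousOn_space ht)
      exact ⟨φ, fun _ => h⟩
    · exact ⟨0, fun h => absurd h ht⟩
  choose φ hφ using key
  exact ⟨fun l x t => φ t l x, fun t ht x => congrFun (hφ t ht).1 x, fun t ht => (hφ t ht).2.1,
    fun t ht => (hφ t ht).2.2⟩

variable {n : ℕ} {f : ℕ → ℝ → ℝ → ℝ}

namespace IsDerivFamily

/-- Differentiating the transport identity in `x` moves it up the chain. Strictness of `δ < b - a`
keeps the overlap nondegenerate, so that derivatives within it are unique. -/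
theorem transport (hf : IsDerivFamily a b T n u f) (hu : IsExactSolution bc a b T u₀ u)
    {t δ : ℝ} (hδ : 0 ≤ δ) (hδb : δ < b - a) (ht : 0 ≤ t) (htδ : t + δ ≤ T) {l : ℕ} (hl : l < n) :
    ∀ x ∈ Icc a (b - δ), f l x t = f l (x + δ) (t + δ) := by
  have ht1 : t ∈ Icc 0 T := ⟨ht, by linarith⟩
  have ht2 : t + δ ∈ Icc 0 T := ⟨by linarith, htδ⟩
  induction l with
  | zero =>
    intro x hx
    rw [hf.zero t ht1, hf.zero _ ht2, hu.transport hδ hx.1 (by linarith [hx.2]) ht htδ]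
  | succ l ih =>
    intro x hx
    have hsub : Icc a (b - δ) ⊆ Icc a b := Icc_subset_Icc le_rfl (by linarith)
    have h1 := ((hf.chain t ht1).hasDerivWithinAt hl (hsub hx)).mono hsub
    have hmaps : MapsTo (fun y => y + δ) (Icc a (b - δ)) (Icc a b) := fun y hy =>
      ⟨by linarith [hy.1], by linarith [hy.2]⟩
    have h2 := ((hf.chain _ ht2).hasDerivWithinAt hl (hmaps hx)).scomp x
      ((hasDerivAt_id x).add_const δ).hasDerivWithinAt hmaps
    have h3 : HasDerivWithinAt (fun y => f l y t) (f (l + 1) (x + δ) (t + δ))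
        (Icc a (b - δ)) x := by
      refine (h2.congr_deriv (by simp)).congr (fun y hy => ih (by omega) y hy)
        (ih (by omega) x hx)
    exact (uniqueDiffOn_Icc (by linarith) x hx).eq_deriv _ h1 h3

/-- Near `t` the time dependence at a fixed point is read off from the single profile at time `t'`,
where the chain gives the derivative. This avoids any time regularity of the higher space
derivatives. -/
theorem hasDerivWithinAt_time_of_local (hf : IsDerivFamily a b T n u f) {l : ℕ} (hl : l + 1 < n)
    {x t t' δ : ℝ} (hδ : 0 < δ) (ht : t ∈ Icc 0 T) (ht' : t' ∈ Icc 0 T)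
    (hloc : ∀ m < n, ∀ r ∈ Icc 0 T ∩ Ioo (t - δ) (t + δ), x + (t' - r) ∈ Icc a b ∧
      f m x r = f m (x + (t' - r)) t') :
    HasDerivWithinAt (fun r => f l x r) (-f (l + 1) x t) (Icc 0 T) t := by
  have hnhds : Ioo (t - δ) (t + δ) ∈ 𝓝 t := Ioo_mem_nhds (by linarith) (by linarith)
  have htm : t ∈ Icc 0 T ∩ Ioo (t - δ) (t + δ) := ⟨ht, by linarith, by linarith⟩
  rw [← hasDerivWithinAt_inter hnhds]
  have hmaps : MapsTo (fun r => x + (t' - r)) (Icc 0 T ∩ Ioo (t - δ) (t + δ)) (Icc a b) :=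
    fun r hr => (hloc l (by omega) r hr).1
  have h2 := ((hf.chain t' ht').hasDerivWithinAt hl (hmaps htm)).scomp t
    (((hasDerivAt_id t).const_sub t').const_add x).hasDerivWithinAt hmaps
  refine (h2.congr_deriv ?_).congr (fun r hr => (hloc l (by omega) r hr).2)
    (hloc l (by omega) t htm).2
  rw [(hloc (l + 1) hl t htm).2]
  simp

theorem hasDerivWithinAt_time_left (hf : IsDerivFamily a b T n u f)
    (hu : IsExactSolution bc a b T u₀ u) (hab : a < b) {l : ℕ} (hl : l + 1 < n) {t : ℝ}
    (ht : t ∈ Icc 0 T) : HasDerivWithinAt (fun r => f l a r) (-f (l + 1) a t) (Icc 0 T) t := by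
  -- At the left end point characteristics enter the domain, so the reference time is taken in the
  -- future; at the right end point it is taken in the past.
  refine hf.hasDerivWithinAt_time_of_local hl (δ := (b - a) / 2) (t' := min (t + (b - a) / 2) T)
    (by linarith) ht ⟨le_min (by linarith [ht.1]) (ht.1.trans ht.2), min_le_right _ _⟩ ?_
  rintro m hm r ⟨hr, hr'⟩
  set t' := min (t + (b - a) / 2) T with ht'
  have h1 : r ≤ t' := le_min hr'.2.le hr.2
  have h2 : t' ≤ t + (b - a) / 2 := min_le_left _ _
  have h3 : t' ≤ T := min_le_right _ _
  have h4 := hf.transport hu (t := r) (δ := t' - r) (by linarith) (by linarith [hr'.1]) hr.1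
    (by linarith) hm a ⟨le_rfl, by linarith [hr'.1]⟩
  refine ⟨⟨by linarith, by linarith [hr'.1]⟩, ?_⟩
  rw [h4]; congr 1; ring

theorem hasDerivWithinAt_time_right (hf : IsDerivFamily a b T n u f)
    (hu : IsExactSolution bc a b T u₀ u) (hab : a < b) {l : ℕ} (hl : l + 1 < n) {t : ℝ}
    (ht : t ∈ Icc 0 T) : HasDerivWithinAt (fun r => f l b r) (-f (l + 1) b t) (Icc 0 T) t := by
  refine hf.hasDerivWithinAt_time_of_local hl (δ := (b - a) / 2) (t' := max (t - (b - a) / 2) 0)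
    (by linarith) ht ⟨le_max_right _ _, max_le (by linarith [ht.2]) (ht.1.trans ht.2)⟩ ?_
  rintro m hm r ⟨hr, hr'⟩
  set t' := max (t - (b - a) / 2) 0 with ht'
  have h1 : t' ≤ r := max_le hr'.1.le hr.1
  have h2 : t - (b - a) / 2 ≤ t' := le_max_left _ _
  have h3 : 0 ≤ t' := le_max_right _ _
  have h4 := hf.transport hu (t := t') (δ := r - t') (by linarith) (by linarith [hr'.2]) h3
    (by linarith [hr.2]) hm (b - (r - t')) ⟨by linarith [hr'.2], le_rfl⟩
  have e1 : b + (t' - r) = b - (r - t') := by ring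
  refine ⟨⟨by linarith [hr'.2], by linarith⟩, ?_⟩
  rw [e1, h4]; congr 1 <;> ring

theorem iteratedDerivWithin_of_hasDerivWithinAt (hT : 0 < T) {G : ℕ → ℝ → ℝ} {g : ℝ → ℝ} {n : ℕ}
    (h0 : ∀ t ∈ Icc 0 T, g t = G 0 t)
    (hG : ∀ l < n, ∀ t ∈ Icc 0 T, HasDerivWithinAt (G l) (G (l + 1) t) (Icc 0 T) t) {l : ℕ}
    (hl : l ≤ n) : ∀ t ∈ Icc 0 T, iteratedDerivWithin l g (Icc 0 T) t = G l t := by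
  induction l with
  | zero => simpa using h0
  | succ l ih =>
    intro t ht
    rw [iteratedDerivWithin_succ, derivWithin_congr (ih (by omega)) (ih (by omega) t ht)]
    exact (hG l (by omega) t ht).derivWithin (uniqueDiffOn_Icc hT t ht)

theorem iteratedDerivWithin_eq (hf : IsDerivFamily a b T n u f) (hT : 0 < T) {x : ℝ}
    (hx : ∀ l, l + 1 < n → ∀ t ∈ Icc 0 T,
      HasDerivWithinAt (fun r => f l x r) (-f (l + 1) x t) (Icc 0 T) t)
    {g : ℝ → ℝ} (hg : ∀ t ∈ Icc 0 T, u x t = g t) {l : ℕ} (hl : l < n) {t : ℝ}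
    (ht : t ∈ Icc 0 T) : iteratedDerivWithin l g (Icc 0 T) t = (-1) ^ l * f l x t := by
  refine iteratedDerivWithin_of_hasDerivWithinAt hT (n := n - 1)
    (G := fun l t => (-1) ^ l * f l x t) (fun t ht => ?_) (fun l hl t ht => ?_) (by omega) t ht
  · simp [hf.zero t ht, hg t ht]
  · refine ((hx l (by omega) t ht).const_mul ((-1) ^ l)).congr_deriv ?_
    rw [pow_succ]; ring

theorem hasDerivWithinAt_time (hf : IsDerivFamily a b T n u f)
    (hu : IsExactSolution bc a b T u₀ u) (hab : a < b) (hn : 1 < n) {x t : ℝ}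
    (hx : x ∈ Icc a b) (ht : t ∈ Ioc 0 T) :
    HasDerivWithinAt (fun r => u x r) (-f 1 x t) (Icc 0 T) t := by
  have ht' : t ∈ Icc 0 T := Ioc_subset_Icc_self ht
  obtain ⟨D, hD, hD0⟩ := hu.pde x hx t ht
  have h1 : HasDerivWithinAt (fun r => u x r) (D (0, 1)) (Icc 0 T) t :=
    hD.comp_hasDerivWithinAt (f := fun r : ℝ => (x, r)) t
      (((hasDerivAt_const t x).prodMk (hasDerivAt_id t)).hasDerivWithinAt) fun r hr => ⟨hx, hr⟩
  have h2 : HasDerivWithinAt (fun y => u y t) (D (1, 0)) (Icc a b) x :=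
    hD.comp_hasDerivWithinAt (f := fun y : ℝ => (y, t)) x
      (((hasDerivAt_id x).prodMk (hasDerivAt_const x t)).hasDerivWithinAt) fun y hy => ⟨hy, ht'⟩
  have h3 : HasDerivWithinAt (fun y => u y t) (f 1 x t) (Icc a b) x :=
    ((hf.chain t ht').hasDerivWithinAt (l := 0) (by omega) hx).congr
      (fun y _ => (hf.zero t ht' y).symm) (hf.zero t ht' x).symm
  have h4 : D (1, 0) = f 1 x t := (uniqueDiffOn_Icc hab x hx).eq_deriv _ h2 h3
  exact h1.congr_deriv (by linarith)

end IsDerivFamily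

end Exact

end OFSV

end

noncomputable section

namespace OFSV

open Polynomial Set MeasureTheory Filter Topology

/-! ### Estimates on one spectral volume -/

/-- The inverse estimate with constant `K` for polynomials of degree at most `k`. -/
def InverseEstimate (k : ℕ) (K : ℝ) : Prop :=
  ∀ p : ℝ[X], p.natDegree ≤ k → ∀ n ≤ k, ∀ α l : ℝ, 0 < l → ∀ x ∈ Icc α (α + l),
    l ^ (2 * n + 1) * (derivative^[n] p).eval x ^ 2 ≤ K * ∫ y in α..(α + l), p.eval y ^ 2

section Cell

variable {F : Family} {k : ℕ} {s A : ℕ → ℝ} {β K : ℝ}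

theorem IsCVPoints.mem_cell (hs : IsCVPoints F k s) (α : ℝ) {l : ℝ} (hl : 0 ≤ l) {j : ℕ}
    (hj : j ≤ k + 1) : α + l * s j ∈ Icc α (α + l) := by
  obtain ⟨h0, h1⟩ := hs.mem_Icc hj
  exact ⟨by nlinarith, by nlinarith⟩

theorem IsQuadrature.sum_weight (hQ : IsQuadrature k s A β) (hk : 1 ≤ k) :
    ∑ j ∈ Finset.range (k + 1), A j = 1 := by
  have h := hQ.integral_eq 1 (by simp)
  rw [coeff_one, if_neg (by omega)] at h
  simpa using h.symm

/-- Nonnegative weights of total mass one make the quadrature part an average, so the inverse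
estimates for `w` and `w'` give a bound that does not depend on the particular weights. -/
theorem abs_testVal_le (hs : IsCVPoints F k s) (hQ : IsQuadrature k s A β) (hk : 1 ≤ k)
    (hK : InverseEstimate k K) (α : ℝ) {l : ℝ} (hl : 0 < l) {w : ℝ[X]} (hw : w.natDegree ≤ k)
    {j : ℕ} (hj : j ≤ k + 1) :
    |testVal s A α l w j| ≤ 2 * √(K * (∫ y in α..(α + l), w.eval y ^ 2) / l) := by
  set r := √(K * (∫ y in α..(α + l), w.eval y ^ 2) / l) with hr
  have h0 : |w.eval α| ≤ r := by
    refine Real.abs_le_sqrt ?_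
    rw [le_div_iff₀ hl]
    have := hK w hw 0 (by omega) α l hl α ⟨le_rfl, by linarith⟩
    simpa [mul_comm] using this
  have h1 : ∀ i < k + 1, l * |(derivative w).eval (α + l * s (i + 1))| ≤ r := by
    intro i hi
    rw [← abs_of_pos hl, ← abs_mul, abs_of_pos hl]
    refine Real.abs_le_sqrt ?_
    rw [le_div_iff₀ hl]
    have := hK w hw 1 hk α l hl _ (hs.mem_cell α hl.le (j := i + 1) (by omega))
    refine le_trans (le_of_eq ?_) this
    simp only [Function.iterate_one]
    ring
  have h2 : |l * ∑ i ∈ Finset.range j, A i * (derivative w).eval (α + l * s (i + 1))| ≤ r := by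
    rw [Finset.mul_sum]
    refine (Finset.abs_sum_le_sum_abs _ _).trans ?_
    calc ∑ i ∈ Finset.range j, |l * (A i * (derivative w).eval (α + l * s (i + 1)))|
        ≤ ∑ i ∈ Finset.range j, A i * r := by
          refine Finset.sum_le_sum fun i hi => ?_
          have hi := Finset.mem_range.1 hi
          rw [abs_mul, abs_mul, abs_of_pos hl, abs_of_nonneg (hQ.weight_nonneg i)]
          have := mul_le_mul_of_nonneg_left (h1 i (by omega)) (hQ.weight_nonneg i)
          linarith
      _ ≤ ∑ i ∈ Finset.range (k + 1), A i * r :=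
          Finset.sum_le_sum_of_subset_of_nonneg (Finset.range_mono hj)
            fun i _ _ => mul_nonneg (hQ.weight_nonneg i) (Real.sqrt_nonneg _)
      _ = r := by rw [← Finset.sum_mul, hQ.sum_weight hk, one_mul]
  have := abs_add_le (w.eval α)
    (l * ∑ i ∈ Finset.range j, A i * (derivative w).eval (α + l * s (i + 1)))
  rw [testVal]
  linarith

theorem abs_sum_mul_integral_le (hs : IsCVPoints F k s) (α : ℝ) {l : ℝ} (hl : 0 < l)
    {w : ℕ → ℝ} {W : ℝ} (hW : ∀ j ≤ k, |w j| ≤ W) {g : ℝ → ℝ}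
    (hg : IntervalIntegrable g volume α (α + l)) :
    |∑ j ∈ Finset.range (k + 1), w j * ∫ x in (α + l * s j)..(α + l * s (j + 1)), g x| ≤
      W * ∫ x in α..(α + l), |g x| := by
  have hle : ∀ j ≤ k, α + l * s j ≤ α + l * s (j + 1) := fun j hj => by
    have := mul_le_mul_of_nonneg_left (hs.lt j hj).le hl.le
    linarith
  have hsub : ∀ j ≤ k, IntervalIntegrable (fun x => |g x|) volume
      (α + l * s j) (α + l * s (j + 1)) := fun j hj => hg.abs.mono_set (by
    rw [uIcc_of_le (by linarith : α ≤ α + l)]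
    exact uIcc_subset_Icc (hs.mem_cell α hl.le (by omega)) (hs.mem_cell α hl.le (by omega)))
  have hsum : ∑ j ∈ Finset.range (k + 1), ∫ x in (α + l * s j)..(α + l * s (j + 1)), |g x| =
      ∫ x in α..(α + l), |g x| := by
    have := intervalIntegral.sum_integral_adjacent_intervals (a := fun j => α + l * s j)
      (f := fun x => |g x|) (μ := volume) (n := k + 1) (fun j hj => hsub j (by omega))
    rw [this, hs.zero, hs.last, mul_zero, mul_one, add_zero]
  rw [← hsum, Finset.mul_sum]
  refine (Finset.abs_sum_le_sum_abs _ _).trans (Finset.sum_le_sum fun j hj => ?_)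
  have hj : j ≤ k := by have := Finset.mem_range.1 hj; omega
  rw [abs_mul]
  refine mul_le_mul (hW j hj) ?_ (abs_nonneg _) ((abs_nonneg _).trans (hW j hj))
  exact intervalIntegral.abs_integral_le_integral_abs (hle j hj)

/-- The projection error of a polynomial with bounded derivative. -/
theorem integral_abs_sub_proj_le {α l S : ℝ} (hl : 0 < l) {n : ℕ} {p q : ℝ[X]}
    (hq : IsL2Proj α (α + l) n p q) (hS : ∀ x ∈ Icc α (α + l), |(derivative p).eval x| ≤ S) :
    ∫ x in α..(α + l), |(p - q).eval x| ≤ l ^ 2 * S := by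
  have hS0 : 0 ≤ S := (abs_nonneg _).trans (hS α ⟨le_rfl, by linarith⟩)
  have hα : α ≤ α + l := by linarith
  -- The projection is at least as good in `L²` as any constant, in particular the value at the left
  -- end point.
  set c : ℝ[X] := C (p.eval α) with hc
  have horth := hq.2 (q - c) (by
    refine (natDegree_sub_le _ _).trans ?_
    simp [hc, hq.1])
  have hint : ∀ g : ℝ[X], IntervalIntegrable (fun x => g.eval x ^ 2) volume α (α + l) :=
    fun g => (by fun_prop : Continuous fun x => g.eval x ^ 2).intervalIntegrable _ _
  have hint2 : ∀ g h : ℝ[X],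
      IntervalIntegrable (fun x => g.eval x * h.eval x) volume α (α + l) :=
    fun g h => (by fun_prop : Continuous fun x => g.eval x * h.eval x).intervalIntegrable _ _
  have h1 : ∫ x in α..(α + l), (p - q).eval x ^ 2 ≤ ∫ x in α..(α + l), (p - c).eval x ^ 2 := by
    have e : ∀ x, (p - c).eval x ^ 2 = (p - q).eval x ^ 2 +
        (2 * ((p - q).eval x * (q - c).eval x) + (q - c).eval x ^ 2) := fun x => by
      simp only [eval_sub]; ring
    simp only [e]
    rw [intervalIntegral.integral_add (hint _) (((hint2 _ _).const_mul 2).add (hint _)),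
      intervalIntegral.integral_add ((hint2 _ _).const_mul 2) (hint _),
      intervalIntegral.integral_const_mul, horth]
    have := intervalIntegral.integral_nonneg (μ := volume) (f := fun x => (q - c).eval x ^ 2)
      hα fun x _ => sq_nonneg _
    linarith
  have h2 : ∀ x ∈ Icc α (α + l), (p - c).eval x ^ 2 ≤ (l * S) ^ 2 := by
    intro x hx
    have h := abs_integral_le_integral_abs (f := fun z => (derivative p).eval z)
      (left_mem_Icc.2 hα) hx (intervalIntegrable_eval _ _ _)
    rw [integral_derivative] at h
    have h' := intervalIntegral.integral_mono_on hα (f := fun z => |(derivative p).eval z|)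
      (g := fun _ => S) (intervalIntegrable_eval _ _ _).abs (by simp) hS
    rw [intervalIntegral.integral_const, smul_eq_mul, add_sub_cancel_left] at h'
    rw [hc, eval_sub, eval_C, ← sq_abs]
    exact pow_le_pow_left₀ (abs_nonneg _) (h.trans h') 2
  have h3 := intervalIntegral.integral_mono_on hα (hint (p - c))
    (g := fun _ => (l * S) ^ 2) (by simp) h2
  rw [intervalIntegral.integral_const, smul_eq_mul, add_sub_cancel_left] at h3
  have h4 := sq_integral_abs_le hα (f := fun x => (p - q).eval x)
    (memLp_of_continuousOn (Polynomial.continuous _).continuousOn)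
  rw [add_sub_cancel_left] at h4
  refine (abs_le_of_sq_le_sq' ?_ (by positivity)).2
  calc (∫ x in α..(α + l), |(p - q).eval x|) ^ 2
      ≤ l * ∫ x in α..(α + l), (p - q).eval x ^ 2 := h4
    _ ≤ l * (l * (l * S) ^ 2) := mul_le_mul_of_nonneg_left (h1.trans h3) hl.le
    _ = (l ^ 2 * S) ^ 2 := by ring

/-- The damping terms are dissipative for the error `e`, up to the projection error of the smooth
part `p` of `v = e + p`. -/
theorem neg_sum_testVal_mul_damping_le (hs : IsCVPoints F k s) (hQ : IsQuadrature k s A β)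
    (hk : 1 ≤ k) {α l S W : ℝ} (hl : 0 < l) {n : ℕ} (hn : n + 1 ≤ k) {v e p : ℝ[X]}
    (hv : v = e + p) (he : e.natDegree ≤ k)
    (hS : ∀ x ∈ Icc α (α + l), |(derivative p).eval x| ≤ S)
    (hW : ∀ j ≤ k, |testVal s A α l e j| ≤ W) :
    -∑ j ∈ Finset.range (k + 1), testVal s A α l e j *
        ∫ x in (α + l * s j)..(α + l * s (j + 1)), (v - l2Proj α (α + l) n v).eval x ≤
      W * (l ^ 2 * S) := by
  have hα : α < α + l := by linarith
  set q := l2Proj α (α + l) n v with hq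
  have hqv : IsL2Proj α (α + l) n v q := isL2Proj_l2Proj hα n v
  set q₁ := l2Proj α (α + l) n e with hq1
  have hqe : IsL2Proj α (α + l) n e q₁ := isL2Proj_l2Proj hα n e
  have hint2 : ∀ g h : ℝ[X],
      IntervalIntegrable (fun x => g.eval x * h.eval x) volume α (α + l) :=
    fun g h => (by fun_prop : Continuous fun x => g.eval x * h.eval x).intervalIntegrable _ _
  have hqp : IsL2Proj α (α + l) n p (q - q₁) := by
    refine ⟨(natDegree_sub_le _ _).trans (max_le hqv.1 hqe.1), fun r hr => ?_⟩
    have h1 := hqv.2 r hr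
    have h2 := hqe.2 r hr
    have h3 : ∀ x, (p - (q - q₁)).eval x * r.eval x =
        (v - q).eval x * r.eval x - (e - q₁).eval x * r.eval x := fun x => by
      rw [hv]; simp only [eval_sub, eval_add]; ring
    simp only [h3]
    rw [intervalIntegral.integral_sub (hint2 _ _) (hint2 _ _), h1, h2, sub_zero]
  have hsplit : ∑ j ∈ Finset.range (k + 1), testVal s A α l e j *
        ∫ x in (α + l * s j)..(α + l * s (j + 1)), (v - q).eval x =
      (∑ j ∈ Finset.range (k + 1), testVal s A α l e j *
        ∫ x in (α + l * s j)..(α + l * s (j + 1)), (e - q₁).eval x) +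
      ∑ j ∈ Finset.range (k + 1), testVal s A α l e j *
        ∫ x in (α + l * s j)..(α + l * s (j + 1)), (p - (q - q₁)).eval x := by
    rw [← Finset.sum_add_distrib]
    refine Finset.sum_congr rfl fun j _ => ?_
    rw [← mul_add, ← intervalIntegral.integral_add (intervalIntegrable_eval _ _ _)
      (intervalIntegrable_eval _ _ _)]
    congr 2; ext x
    rw [hv]; simp only [eval_sub, eval_add]; ring
  have hpos : 0 ≤ ∑ j ∈ Finset.range (k + 1), testVal s A α l e j *
        ∫ x in (α + l * s j)..(α + l * s (j + 1)), (e - q₁).eval x := by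
    have hd : (e - q₁).natDegree ≤ k :=
      (natDegree_sub_le _ _).trans (max_le he (hqe.1.trans (by omega)))
    rw [hQ.sum_testVal_mul_integral hk α hl hd he hs.zero hs.last]
    -- Here `n < k` is decisive: the projection leaves the leading coefficient alone, so the defect
    -- term is a square and keeps its sign.
    have hcoef : (e - q₁).coeff k = e.coeff k := by
      rw [coeff_sub, coeff_eq_zero_of_natDegree_lt (p := q₁) (hqe.1.trans_lt (by omega)), sub_zero]
    have hE : ∫ x in α..(α + l), (e - q₁).eval x * e.eval x =
        ∫ x in α..(α + l), (e - q₁).eval x * (e - q₁).eval x := by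
      have h1 := hqe.2 q₁ hqe.1
      have h3 : ∀ x, (e - q₁).eval x * e.eval x =
          (e - q₁).eval x * (e - q₁).eval x + (e - q₁).eval x * q₁.eval x := fun x => by
        simp only [eval_sub]; ring
      simp only [h3]
      rw [intervalIntegral.integral_add (hint2 _ _) (hint2 _ _), h1, add_zero]
    rw [hcoef, hE]
    have h1 : 0 ≤ ∫ x in α..(α + l), (e - q₁).eval x * (e - q₁).eval x :=
      intervalIntegral.integral_nonneg hα.le fun x _ => mul_self_nonneg _
    have h2 := hQ.defect_nonneg
    have h3 := mul_self_nonneg (e.coeff k)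
    positivity
  have hbd := abs_sum_mul_integral_le hs α hl hW
    (intervalIntegrable_eval (p - (q - q₁)) α (α + l))
  have hpr := integral_abs_sub_proj_le hl hqp hS
  have hW0 : 0 ≤ W := (abs_nonneg _).trans (hW 0 (by omega))
  have := mul_le_mul_of_nonneg_left hpr hW0
  rw [hsplit]
  linarith [neg_abs_le (∑ j ∈ Finset.range (k + 1), testVal s A α l e j *
        ∫ x in (α + l * s j)..(α + l * s (j + 1)), (p - (q - q₁)).eval x)]

/-! ### The energy form and its time derivative -/

theorem integral_derivative_mul_self (p : ℝ[X]) (α β : ℝ) :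
    ∫ x in α..β, (derivative p * p).eval x = (p.eval β ^ 2 - p.eval α ^ 2) / 2 := by
  have h := integral_derivative_mul p p α β
  have e : ∫ x in α..β, (p * derivative p).eval x = ∫ x in α..β, (derivative p * p).eval x := by
    rw [mul_comm]
  rw [e] at h
  linarith

/-- The symmetric form induced on polynomials of degree at most `k` by the test values. -/
def massForm (k : ℕ) (β α l : ℝ) : ℝ[X] →ₗ[ℝ] ℝ[X] →ₗ[ℝ] ℝ :=
  have hint : ∀ q r : ℝ[X],
      IntervalIntegrable (fun x => q.eval x * r.eval x) volume α (α + l) :=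
    fun q r => (by fun_prop : Continuous fun x => q.eval x * r.eval x).intervalIntegrable _ _
  LinearMap.mk₂ ℝ (fun v w => (∫ x in α..(α + l), v.eval x * w.eval x) +
      β * (k / (k + 1)) * l ^ (2 * k + 1) * (v.coeff k * w.coeff k))
    (fun q q' r => by
      simp only [eval_add, add_mul, coeff_add]
      rw [intervalIntegral.integral_add (hint _ _) (hint _ _)]
      ring)
    (fun c q r => by
      simp only [eval_smul, smul_eq_mul, mul_assoc, coeff_smul]
      rw [intervalIntegral.integral_const_mul]
      ring)
    (fun q r r' => by
      simp only [eval_add, mul_add, coeff_add]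
      rw [intervalIntegral.integral_add (hint _ _) (hint _ _)]
      ring)
    (fun c q r => by
      simp only [eval_smul, smul_eq_mul, mul_left_comm _ c, coeff_smul]
      rw [intervalIntegral.integral_const_mul]
      ring)

theorem massForm_apply (k : ℕ) (β α l : ℝ) (v w : ℝ[X]) :
    massForm k β α l v w = (∫ x in α..(α + l), v.eval x * w.eval x) +
      β * (k / (k + 1)) * l ^ (2 * k + 1) * (v.coeff k * w.coeff k) := rfl

theorem massForm_comm (k : ℕ) (β α l : ℝ) (v w : ℝ[X]) :
    massForm k β α l v w = massForm k β α l w v := by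
  simp only [massForm_apply, mul_comm (v.eval _), mul_comm (v.coeff _)]

theorem integral_sq_le_massForm (k : ℕ) (hβ : 0 ≤ β) (α : ℝ) {l : ℝ} (hl : 0 ≤ l) (v : ℝ[X]) :
    ∫ x in α..(α + l), v.eval x ^ 2 ≤ massForm k β α l v v := by
  rw [massForm_apply]
  have h3 := mul_self_nonneg (v.coeff k)
  have : 0 ≤ β * (k / (k + 1)) * l ^ (2 * k + 1) * (v.coeff k * v.coeff k) := by positivity
  simp only [sq]
  linarith

/-- The error is known through its nodal values. Expanding in the fixed Lagrange basis reduces the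
derivative of the energy to the product rule for real functions. -/
theorem hasDerivWithinAt_bilin_interpolate (B : ℝ[X] →ₗ[ℝ] ℝ[X] →ₗ[ℝ] ℝ)
    (hB : ∀ v w, B v w = B w v) (I : Finset ℕ) (z : ℕ → ℝ) {r : ℝ → ℕ → ℝ} {r' : ℕ → ℝ}
    {D : Set ℝ} {t : ℝ} (hr : ∀ j ∈ I, HasDerivWithinAt (fun t => r t j) (r' j) D t) :
    HasDerivWithinAt
      (fun t => B (Lagrange.interpolate I z (r t)) (Lagrange.interpolate I z (r t)))
      (2 * B (Lagrange.interpolate I z r') (Lagrange.interpolate I z (r t))) D t := by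
  have hexp : ∀ p q : ℕ → ℝ, B (Lagrange.interpolate I z p) (Lagrange.interpolate I z q) =
      ∑ i ∈ I, ∑ j ∈ I, p i * q j * B (Lagrange.basis I z i) (Lagrange.basis I z j) := by
    intro p q
    simp only [Lagrange.interpolate_apply, ← smul_eq_C_mul, map_sum, LinearMap.sum_apply,
      map_smul, LinearMap.smul_apply, smul_eq_mul, Finset.mul_sum]
    rw [Finset.sum_comm]
    exact Finset.sum_congr rfl fun i _ => Finset.sum_congr rfl fun j _ => by ring
  have h : HasDerivWithinAt (fun t => ∑ i ∈ I, ∑ j ∈ I,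
        r t i * r t j * B (Lagrange.basis I z i) (Lagrange.basis I z j))
      (∑ i ∈ I, ∑ j ∈ I,
        (r' i * r t j + r t i * r' j) * B (Lagrange.basis I z i) (Lagrange.basis I z j)) D t :=
    HasDerivWithinAt.fun_sum fun i hi => HasDerivWithinAt.fun_sum fun j hj =>
      ((hr i hi).mul (hr j hj)).mul_const _
  have e : (∑ i ∈ I, ∑ j ∈ I,
        (r' i * r t j + r t i * r' j) * B (Lagrange.basis I z i) (Lagrange.basis I z j)) =
      2 * B (Lagrange.interpolate I z r') (Lagrange.interpolate I z (r t)) := by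
    have h1 := hexp r' (r t)
    have h2 := hexp (r t) r'
    rw [hB] at h2
    simp only [add_mul, Finset.sum_add_distrib]
    rw [← h1, ← h2, two_mul]
  rw [e] at h
  simpa only [hexp] using h

theorem continuousOn_bilin_interpolate (B : ℝ[X] →ₗ[ℝ] ℝ[X] →ₗ[ℝ] ℝ)
    (I : Finset ℕ) (z : ℕ → ℝ) {r : ℝ → ℕ → ℝ} {D : Set ℝ}
    (hr : ∀ j ∈ I, ContinuousOn (fun t => r t j) D) :
    ContinuousOn
      (fun t => B (Lagrange.interpolate I z (r t)) (Lagrange.interpolate I z (r t))) D := by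
  simp only [Lagrange.interpolate_apply, ← smul_eq_C_mul, map_sum, LinearMap.sum_apply,
    map_smul, LinearMap.smul_apply, smul_eq_mul]
  exact continuousOn_finsetSum _ fun i hi => (hr i hi).mul
    (continuousOn_finsetSum _ fun j hj => (hr j hj).mul continuousOn_const)

end Cell

/-- A differential inequality of Grönwall type, with the derivative at the initial time unknown. -/
theorem le_mul_exp_of_deriv_le {T P H : ℝ} (hP : 0 ≤ P) {E E' : ℝ → ℝ} (hH : 0 ≤ H)
    (hc : ContinuousOn E (Icc 0 T)) (hE0 : E 0 = 0)
    (hd : ∀ t ∈ Ioc 0 T, HasDerivWithinAt E (E' t) (Icc 0 T) t)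
    (hle : ∀ t ∈ Ioc 0 T, E' t ≤ P * (E t + H)) :
    ∀ t ∈ Icc 0 T, E t ≤ H * Real.exp (P * T) := by
  intro t ht
  set G : ℝ → ℝ := fun t => (E t + H) * Real.exp (-(P * t)) with hG
  have hder : ∀ t ∈ Ioo 0 T, HasDerivAt G
      (E' t * Real.exp (-(P * t)) + (E t + H) * (Real.exp (-(P * t)) * (-(P * 1)))) t := by
    intro t ht
    have h1 := (hd t (Ioo_subset_Ioc_self ht)).hasDerivAt (Icc_mem_nhds ht.1 ht.2)
    exact (h1.add_const H).mul (((hasDerivAt_id t).const_mul P).neg.exp)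
  have hanti : AntitoneOn G (Icc 0 T) := by
    refine antitoneOn_of_deriv_nonpos (convex_Icc 0 T) ?_ ?_ ?_
    · exact (hc.add continuousOn_const).mul (by fun_prop)
    · rw [interior_Icc]
      exact fun t ht => (hder t ht).differentiableAt.differentiableWithinAt
    · rw [interior_Icc]
      intro t ht
      rw [(hder t ht).deriv]
      have := hle t (Ioo_subset_Ioc_self ht)
      have h2 := mul_le_mul_of_nonneg_right this (Real.exp_pos (-(P * t))).le
      linarith
  have hT : 0 ≤ T := ht.1.trans ht.2
  have h := hanti (left_mem_Icc.2 hT) ht ht.1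
  simp only [hG, hE0, mul_zero, neg_zero, Real.exp_zero, mul_one, zero_add] at h
  have h1 : E t + H ≤ H * Real.exp (P * t) := by
    rw [Real.exp_neg, ← div_eq_mul_inv, div_le_iff₀ (Real.exp_pos _)] at h
    exact h
  have h2 : Real.exp (P * t) ≤ Real.exp (P * T) :=
    Real.exp_le_exp.2 (mul_le_mul_of_nonneg_left ht.2 hP)
  have h3 := mul_le_mul_of_nonneg_left h2 hH
  linarith

end OFSV

end

noncomputable section

namespace OFSV

open Polynomial Set MeasureTheory Filter Topology

/-! ### Meshes and interpolation -/

namespace Mesh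

variable {a b : ℝ} (m : Mesh a b)

theorem node_succ (i : ℕ) : m.node (i + 1) = m.node i + m.len i := by
  rw [len]; ring

theorem len_pos {i : ℕ} (hi : i < m.N) : 0 < m.len i := sub_pos.2 (m.node_lt i hi)

theorem node_le {i j : ℕ} (hij : i ≤ j) (hj : j ≤ m.N) : m.node i ≤ m.node j := by
  induction j with
  | zero => rw [Nat.le_zero.1 hij]
  | succ j ih =>
    rcases hij.eq_or_lt with rfl | h
    · exact le_rfl
    · exact (ih (by omega) (by omega)).trans (m.node_lt j (by omega)).le

theorem node_mem {i : ℕ} (hi : i ≤ m.N) : m.node i ∈ Icc a b := by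
  have h0 := m.node_le (Nat.zero_le i) hi
  have h1 := m.node_le hi le_rfl
  rw [m.node_zero] at h0
  rw [m.node_last] at h1
  exact ⟨h0, h1⟩

theorem N_pos (hab : a < b) : 0 < m.N := by
  rcases Nat.eq_zero_or_pos m.N with h | h
  · have h0 := m.node_zero
    have h1 := m.node_last
    rw [h, h0] at h1
    exact absurd h1 hab.ne
  · exact h

theorem len_le_h {i : ℕ} (hi : i < m.N) : m.len i ≤ m.h :=
  le_ciSup (f := fun i : Fin m.N => m.len i) (Set.finite_range _).bddAbove ⟨i, hi⟩

theorem h_pos (hab : a < b) : 0 < m.h :=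
  (m.len_pos (m.N_pos hab)).trans_le (m.len_le_h (m.N_pos hab))

theorem len_le {i : ℕ} (hi : i < m.N) : m.len i ≤ b - a := by
  have h0 := (m.node_mem hi.le).1
  have h1 := (m.node_mem (i := i + 1) hi).2
  rw [len]; linarith

theorem one_le_of_regular (hab : a < b) {ρ : ℝ} (hρ : m.Regular ρ) : 1 ≤ ρ := by
  have hN := m.N_pos hab
  have h1 := hρ 0 hN
  have h2 := m.len_le_h hN
  have h3 := m.len_pos hN
  by_contra h
  nlinarith

theorem cell_subset {i : ℕ} (hi : i < m.N) :
    Icc (m.node i) (m.node i + m.len i) ⊆ Icc a b := by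
  rw [← m.node_succ]
  exact Icc_subset_Icc (m.node_mem hi.le).1 (m.node_mem (i := i + 1) hi).2

theorem sum_integral {g : ℝ → ℝ} (hab : a ≤ b) (hg : IntervalIntegrable g volume a b) :
    ∑ i ∈ Finset.range m.N, ∫ x in m.node i..(m.node i + m.len i), g x = ∫ x in a..b, g x := by
  have h := intervalIntegral.sum_integral_adjacent_intervals (a := m.node) (f := g) (μ := volume)
    (n := m.N) (fun i hi => hg.mono_set (by
      rw [uIcc_of_le hab]
      exact uIcc_subset_Icc (m.node_mem hi.le) (m.node_mem (i := i + 1) hi)))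
  rw [m.node_zero, m.node_last] at h
  rw [← h]
  exact Finset.sum_congr rfl fun i _ => by rw [m.node_succ]

/-- The Lagrange interpolant of `g` on the `i`-th spectral volume at the points `x_{i,j}`,
`1 ≤ j ≤ k + 1`. -/
def interp (s : ℕ → ℝ) (k i : ℕ) (g : ℝ → ℝ) : ℝ[X] :=
  Lagrange.interpolate (Finset.range (k + 1)) (fun j => m.pt s i (j + 1))
    (fun j => g (m.pt s i (j + 1)))

variable {F : Family} {k : ℕ} {s : ℕ → ℝ} {i : ℕ}

theorem pt_lt (hs : IsCVPoints F k s) (hi : i < m.N) {j : ℕ} (hj : j ≤ k) :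
    m.pt s i j < m.pt s i (j + 1) := by
  have := mul_lt_mul_of_pos_left (hs.lt j hj) (m.len_pos hi)
  simp only [pt]; linarith

theorem pt_mem (hs : IsCVPoints F k s) (hi : i < m.N) {j : ℕ} (hj : j ≤ k + 1) :
    m.pt s i j ∈ Icc (m.node i) (m.node i + m.len i) :=
  hs.mem_cell _ (m.len_pos hi).le hj

theorem pt_zero (hs : IsCVPoints F k s) (i : ℕ) : m.pt s i 0 = m.node i := by
  simp [pt, hs.zero]

theorem pt_last (hs : IsCVPoints F k s) (i : ℕ) :
    m.pt s i (k + 1) = m.node i + m.len i := by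
  simp [pt, hs.last]

theorem injOn_pt (hs : IsCVPoints F k s) (hi : i < m.N) :
    InjOn (fun j => m.pt s i (j + 1)) (Finset.range (k + 1) : Finset ℕ) := by
  intro x hx y hy hxy
  refine hs.injOn_succ le_rfl hx hy ?_
  simp only [pt, add_right_inj] at hxy
  exact mul_left_cancel₀ (m.len_pos hi).ne' hxy

theorem eval_interp (hs : IsCVPoints F k s) (hi : i < m.N) (g : ℝ → ℝ) {j : ℕ} (hj : j ≤ k) :
    (m.interp s k i g).eval (m.pt s i (j + 1)) = g (m.pt s i (j + 1)) := by
  have hj' : j ∈ Finset.range (k + 1) := Finset.mem_range.2 (by omega)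
  exact Lagrange.eval_interpolate_at_node (v := fun j => m.pt s i (j + 1))
    (fun j => g (m.pt s i (j + 1))) (m.injOn_pt hs hi) hj'

theorem natDegree_interp_le (hs : IsCVPoints F k s) (hi : i < m.N) (g : ℝ → ℝ) :
    (m.interp s k i g).natDegree ≤ k := by
  have h := Lagrange.degree_interpolate_lt (fun j => g (m.pt s i (j + 1))) (m.injOn_pt hs hi)
  rw [Finset.card_range] at h
  by_cases h0 : m.interp s k i g = 0
  · simp [h0]
  · rw [interp] at h0 ⊢
    rw [← natDegree_lt_iff_degree_lt h0] at h
    omega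

theorem interp_eval_self (hs : IsCVPoints F k s) (hi : i < m.N) {p : ℝ[X]}
    (hp : p.natDegree ≤ k) : m.interp s k i (fun x => p.eval x) = p := by
  refine (Lagrange.eq_interpolate (m.injOn_pt hs hi) ?_).symm
  rw [Finset.card_range]
  exact (degree_le_of_natDegree_le hp).trans_lt (by exact_mod_cast Nat.lt_succ_self k)

theorem interp_add (s : ℕ → ℝ) (k i : ℕ) (g g' : ℝ → ℝ) :
    m.interp s k i (fun x => g x + g' x) = m.interp s k i g + m.interp s k i g' :=
  map_add (Lagrange.interpolate (Finset.range (k + 1)) fun j => m.pt s i (j + 1)) _ _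

theorem interp_sub (s : ℕ → ℝ) (k i : ℕ) (g g' : ℝ → ℝ) :
    m.interp s k i (fun x => g x - g' x) = m.interp s k i g - m.interp s k i g' :=
  map_sub (Lagrange.interpolate (Finset.range (k + 1)) fun j => m.pt s i (j + 1)) _ _

end Mesh

theorem SobolevChain.sq_sub_interp_le {a b : ℝ} {m : Mesh a b} {F : Family} {k : ℕ} {s : ℕ → ℝ}
    {φ : ℕ → ℝ → ℝ} (hφ : SobolevChain a b (k + 1) φ) (hs : IsCVPoints F k s) {i : ℕ}
    (hi : i < m.N) {l : ℕ} (hl : l ≤ k) {x : ℝ}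
    (hx : x ∈ Icc (m.node i) (m.node i + m.len i)) :
    (φ l x - (derivative^[l] (m.interp s k i (φ 0))).eval x) ^ 2 ≤
      m.len i ^ (2 * (k - l) + 1) *
        ∫ y in m.node i..(m.node i + m.len i), φ (k + 1) y ^ 2 := by
  have hsub := (Icc_subset_Icc_iff (by linarith [m.len_pos hi])).1 (m.cell_subset hi)
  have h := (hφ.mono hsub.1 hsub.2).sq_interpolation_error_le (m.natDegree_interp_le hs hi (φ 0))
    (z := fun j => m.pt s i (j + 1))
    (fun j hj => ⟨m.pt_mem hs hi (by omega), m.eval_interp hs hi _ hj⟩)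
    (fun j hj => m.pt_lt hs hi (by omega)) hl hx
  rwa [add_sub_cancel_left] at h

/-! ### The error equation -/

/-- The data of the error analysis: exact and numerical solution, together with the derivatives of
the former, the quadrature rule of the control volumes, and a bound `M` on the Sobolev norm. -/
structure ErrorSetting (F : Family) (k nE : ℕ) (a b T ρ : ℝ) (bc : BoundaryCondition) (u₀ : ℝ → ℝ)
    (u : ℝ → ℝ → ℝ) (f : ℕ → ℝ → ℝ → ℝ) (m : Mesh a b) (s : ℕ → ℝ) (uh : ℕ → ℝ → ℝ[X])
    (A : ℕ → ℝ) (β K M : ℝ) : Prop where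
  one_le_k : 1 ≤ k
  one_le_nE : 1 ≤ nE
  hab : a < b
  hT : 0 < T
  exact : IsExactSolution bc a b T u₀ u
  family : IsDerivFamily a b T (k + 2) u f
  regular : m.Regular ρ
  points : IsCVPoints F k s
  solution : IsSolution m bc T k nE s u₀ uh
  quadrature : IsQuadrature k s A β
  K_pos : 0 < K
  inverse : InverseEstimate k K
  hNorm_le : ∀ t ∈ Icc 0 T, hNorm a b (k + 2) (fun x => u x t) ≤ M

/-- The difference of the numerical solution and the interpolant of the exact one. -/
def err {a b : ℝ} (m : Mesh a b) (s : ℕ → ℝ) (k : ℕ) (u : ℝ → ℝ → ℝ) (uh : ℕ → ℝ → ℝ[X])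
    (i : ℕ) (t : ℝ) : ℝ[X] :=
  m.interp s k i fun x => (uh i t).eval x - u x t

/-- The time derivative of `err`, given the space derivative `v` of the exact solution. -/
def errDot {a b : ℝ} (m : Mesh a b) (T : ℝ) (s : ℕ → ℝ) (k : ℕ) (v : ℝ → ℝ → ℝ)
    (uh : ℕ → ℝ → ℝ[X]) (i : ℕ) (t : ℝ) : ℝ[X] :=
  m.interp s k i fun x => derivWithin (fun r => (uh i r).eval x) (Icc 0 T) t + v x t

/-- The upwind trace of the error at `x_{i,j}`. -/
def upwindErr {a b : ℝ} (m : Mesh a b) (bc : BoundaryCondition) (s : ℕ → ℝ) (u : ℝ → ℝ → ℝ)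
    (uh : ℕ → ℝ → ℝ[X]) (t : ℝ) (i j : ℕ) : ℝ :=
  upwind m bc s (fun n => uh n t) t i j - u (m.pt s i j) t

namespace ErrorSetting

variable {F : Family} {k nE : ℕ} {a b T ρ : ℝ} {bc : BoundaryCondition} {u₀ : ℝ → ℝ}
  {u : ℝ → ℝ → ℝ} {f : ℕ → ℝ → ℝ → ℝ} {m : Mesh a b} {s : ℕ → ℝ} {uh : ℕ → ℝ → ℝ[X]}
  {A : ℕ → ℝ} {β K M : ℝ}

theorem natDegree_err_le (h : ErrorSetting F k nE a b T ρ bc u₀ u f m s uh A β K M) {i : ℕ}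
    (hi : i < m.N) (t : ℝ) : (err m s k u uh i t).natDegree ≤ k :=
  m.natDegree_interp_le h.points hi _

theorem eq_err_add (h : ErrorSetting F k nE a b T ρ bc u₀ u f m s uh A β K M) {i : ℕ}
    (hi : i < m.N) {t : ℝ} (ht : t ∈ Icc 0 T) :
    uh i t = err m s k u uh i t + m.interp s k i (fun x => f 0 x t) := by
  have h0 : (fun x => f 0 x t) = fun x => u x t := funext (h.family.zero t ht)
  rw [err, m.interp_sub, m.interp_eval_self h.points hi (h.solution.natDegree_le i hi t ht), h0]
  ring

theorem M_nonneg (h : ErrorSetting F k nE a b T ρ bc u₀ u f m s uh A β K M) : 0 ≤ M :=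
  (Real.sqrt_nonneg _).trans (h.hNorm_le 0 ⟨le_rfl, h.hT.le⟩)

theorem integral_sq_le (h : ErrorSetting F k nE a b T ρ bc u₀ u f m s uh A β K M) {t : ℝ}
    (ht : t ∈ Icc 0 T) {l : ℕ} (hl : l ≤ k + 2) : ∫ x in a..b, f l x t ^ 2 ≤ M ^ 2 :=
  (h.family.integral_le t ht l hl).trans
    (pow_le_pow_left₀ (Real.sqrt_nonneg _) (h.hNorm_le t ht) 2)

theorem intervalIntegrable_sq (h : ErrorSetting F k nE a b T ρ bc u₀ u f m s uh A β K M) {t : ℝ}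
    (ht : t ∈ Icc 0 T) {l : ℕ} (hl : l ≤ k + 2) :
    IntervalIntegrable (fun x => f l x t ^ 2) volume a b :=
  intervalIntegrable_sq_of_memLp h.hab.le ((h.family.chain t ht).memLp_of_le hl)

theorem integral_cell_sq_le (h : ErrorSetting F k nE a b T ρ bc u₀ u f m s uh A β K M) {t : ℝ}
    (ht : t ∈ Icc 0 T) {l : ℕ} (hl : l ≤ k + 2) {i : ℕ} (hi : i < m.N) :
    ∫ x in m.node i..(m.node i + m.len i), f l x t ^ 2 ≤ M ^ 2 := by
  have hsub := (Icc_subset_Icc_iff (by linarith [m.len_pos hi])).1 (m.cell_subset hi)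
  exact (intervalIntegral.integral_mono_interval hsub.1 (by linarith [m.len_pos hi]) hsub.2
    (Eventually.of_forall fun x => sq_nonneg _) (h.intervalIntegrable_sq ht hl)).trans
    (h.integral_sq_le ht hl)

/-- The pointwise time derivative of `uh` is again a polynomial in `x` of degree at most `k`,
because interpolation at fixed nodes commutes with differentiation in time. -/
theorem derivWithin_eq (h : ErrorSetting F k nE a b T ρ bc u₀ u f m s uh A β K M) {i : ℕ}
    (hi : i < m.N) {t : ℝ} (ht : t ∈ Ioc 0 T) (x : ℝ) :
    derivWithin (fun r => (uh i r).eval x) (Icc 0 T) t =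
      (m.interp s k i fun y => derivWithin (fun r => (uh i r).eval y) (Icc 0 T) t).eval x := by
  have ht' := Ioc_subset_Icc_self ht
  have hexp : ∀ g : ℝ → ℝ, (m.interp s k i g).eval x = ∑ j ∈ Finset.range (k + 1),
      g (m.pt s i (j + 1)) *
        (Lagrange.basis (Finset.range (k + 1)) (fun j => m.pt s i (j + 1)) j).eval x := by
    intro g
    rw [Mesh.interp, Lagrange.interpolate_apply, eval_finsetSum]
    simp
  have hd : HasDerivWithinAt (fun r => (m.interp s k i fun y => (uh i r).eval y).eval x)
      ((m.interp s k i fun y => derivWithin (fun r => (uh i r).eval y) (Icc 0 T) t).eval x)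
      (Icc 0 T) t := by
    simp only [hexp]
    exact HasDerivWithinAt.fun_sum fun j _ =>
      (h.solution.differentiable i hi _ t ht).hasDerivWithinAt.mul_const _
  have hd' : HasDerivWithinAt (fun r => (uh i r).eval x)
      ((m.interp s k i fun y => derivWithin (fun r => (uh i r).eval y) (Icc 0 T) t).eval x)
      (Icc 0 T) t := by
    refine hd.congr (fun r hr => ?_) ?_
    · rw [m.interp_eval_self h.points hi (h.solution.natDegree_le i hi r hr)]
    · rw [m.interp_eval_self h.points hi (h.solution.natDegree_le i hi t ht')]
  exact hd'.derivWithin (uniqueDiffOn_Icc h.hT t ht')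

/-- The error equation on one control volume. -/
theorem integral_errDot (h : ErrorSetting F k nE a b T ρ bc u₀ u f m s uh A β K M) {i : ℕ}
    (hi : i < m.N) {t : ℝ} (ht : t ∈ Ioc 0 T) {j : ℕ} (hj : j ≤ k) :
    ∫ x in m.pt s i j..m.pt s i (j + 1), (errDot m T s k (f 1) uh i t).eval x =
      -(upwindErr m bc s u uh t i (j + 1) - upwindErr m bc s u uh t i j) -
      (∑ l ∈ Finset.range (k + 1), sigma m bc T k nE (fun n => uh n t) t i l / m.len i *
        ∫ x in m.pt s i j..m.pt s i (j + 1),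
          (uh i t - l2Proj (m.node i) (m.node (i + 1)) (l - 1) (uh i t)).eval x) -
      ∫ x in m.pt s i j..m.pt s i (j + 1),
        (f 1 x t - (m.interp s k i (fun x => f 1 x t)).eval x) := by
  have ht' := Ioc_subset_Icc_self ht
  -- The indicator of one control volume as test function localises the scheme.
  have hsch := h.solution.scheme t ht fun i' j' => if i' = i ∧ j' = j then 1 else 0
  rw [form, Finset.sum_eq_single_of_mem i (Finset.mem_range.2 hi),
    Finset.sum_eq_single_of_mem j (Finset.mem_range.2 (by omega))] at hsch
  rotate_left
  · intro j' _ hj'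
    rw [if_neg (by tauto), zero_mul]
  · intro i' _ hi'
    exact Finset.sum_eq_zero fun j' _ => by rw [if_neg (by tauto), zero_mul]
  rw [if_pos ⟨rfl, rfl⟩, one_mul] at hsch
  rw [intervalIntegral.integral_congr fun x _ => h.derivWithin_eq hi ht x] at hsch
  have hx := m.cell_subset hi (m.pt_mem h.points hi (j := j) (by omega))
  have hy := m.cell_subset hi (m.pt_mem h.points hi (j := j + 1) (by omega))
  have hchain := h.family.chain t ht'
  have hftc := hchain.ftc 0 (by omega) _ hx _ hy
  simp only [h.family.zero t ht', zero_add] at hftc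
  have hI : IntervalIntegrable (fun x => f 1 x t) volume (m.pt s i j) (m.pt s i (j + 1)) :=
    hchain.intervalIntegrable (l := 1) (by omega) hx hy
  rw [intervalIntegral.integral_sub hI (intervalIntegrable_eval _ _ _), ← hftc, errDot,
    m.interp_add]
  simp only [eval_add]
  rw [intervalIntegral.integral_add (intervalIntegrable_eval _ _ _)
    (intervalIntegrable_eval _ _ _), upwindErr, upwindErr]
  linarith

theorem upwindErr_succ (h : ErrorSetting F k nE a b T ρ bc u₀ u f m s uh A β K M) {i : ℕ}
    (hi : i < m.N) (t : ℝ) {j : ℕ} (hj : j ≤ k) :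
    upwindErr m bc s u uh t i (j + 1) = (err m s k u uh i t).eval (m.pt s i (j + 1)) := by
  rw [err, m.eval_interp h.points hi _ hj, upwindErr, upwind.eq_def, if_neg (by omega)]

theorem upwindErr_zero_of_pos (h : ErrorSetting F k nE a b T ρ bc u₀ u f m s uh A β K M) {i : ℕ}
    (hi : i + 1 < m.N) (t : ℝ) :
    upwindErr m bc s u uh t (i + 1) 0 =
      (err m s k u uh i t).eval (m.node i + m.len i) := by
  have h1 := m.eval_interp h.points (i := i) (by omega) (fun x => (uh i t).eval x - u x t) le_rfl
  rw [m.pt_last h.points] at h1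
  rw [err, h1, upwindErr, upwind.eq_def, if_pos rfl, if_neg (by omega), m.pt_zero h.points, m.node_succ,
    Nat.add_sub_cancel]

/-- With inflow data the incoming error is zero; in the periodic case it is the outgoing error of
the last cell. -/
theorem sq_upwindErr_zero_le (h : ErrorSetting F k nE a b T ρ bc u₀ u f m s uh A β K M) {t : ℝ}
    (ht : t ∈ Icc 0 T) :
    upwindErr m bc s u uh t 0 0 ^ 2 ≤
      (err m s k u uh (m.N - 1) t).eval (m.node (m.N - 1) + m.len (m.N - 1)) ^ 2 := by
  have hN := m.N_pos h.hab
  rw [upwindErr, upwind.eq_def, if_pos rfl, if_pos rfl, m.pt_zero h.points, m.node_zero]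
  have hb := h.exact.boundary
  cases bc with
  | periodic =>
    have h1 := m.eval_interp h.points (i := m.N - 1) (by omega)
      (fun x => (uh (m.N - 1) t).eval x - u x t) le_rfl
    rw [m.pt_last h.points, ← m.node_succ, Nat.sub_add_cancel hN, m.node_last] at h1
    rw [err, ← m.node_succ, Nat.sub_add_cancel hN, m.node_last, h1]
    have := hb t ht
    simp only [this, le_refl]
  | inflow g useData =>
    have := hb t ht
    simp only [this, sub_self]
    rw [zero_pow two_ne_zero]
    exact sq_nonneg _

theorem sum_sq_upwindErr_le (h : ErrorSetting F k nE a b T ρ bc u₀ u f m s uh A β K M) {t : ℝ}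
    (ht : t ∈ Icc 0 T) :
    ∑ i ∈ Finset.range m.N, upwindErr m bc s u uh t i 0 ^ 2 ≤
      ∑ i ∈ Finset.range m.N, (err m s k u uh i t).eval (m.node i + m.len i) ^ 2 := by
  obtain ⟨N, hN⟩ : ∃ N, m.N = N + 1 := ⟨m.N - 1, by have := m.N_pos h.hab; omega⟩
  have h0 := h.sq_upwindErr_zero_le ht
  rw [hN, Nat.add_sub_cancel] at h0
  rw [hN, Finset.sum_range_succ', Finset.sum_range_succ _ N]
  refine add_le_add (Finset.sum_le_sum fun i hi => ?_) h0
  have := Finset.mem_range.1 hi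
  rw [h.upwindErr_zero_of_pos (by omega) t]

end ErrorSetting

end OFSV

end

noncomputable section

namespace OFSV

open Polynomial Set MeasureTheory Filter Topology

/-! ### The energy estimate -/

/-- The squared `L²` norm of `p` on the `i`-th spectral volume. -/
def cellSq {a b : ℝ} (m : Mesh a b) (i : ℕ) (g : ℝ → ℝ) : ℝ :=
  ∫ x in m.node i..(m.node i + m.len i), g x ^ 2

theorem cellSq_nonneg {a b : ℝ} (m : Mesh a b) {i : ℕ} (hi : i < m.N) (g : ℝ → ℝ) :
    0 ≤ cellSq m i g :=
  intervalIntegral.integral_nonneg (by linarith [m.len_pos hi]) fun _ _ => sq_nonneg _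

/-- A bound for the derivative of the interpolants of functions of unit Sobolev norm. -/
def interpSlope (k : ℕ) (a b : ℝ) : ℝ :=
  √(2 * (2 / (b - a) + 2 * (b - a) + (b - a) ^ (2 * (k - 1) + 1)))

theorem sq_sub_le_two_mul (x y : ℝ) : (x - y) ^ 2 ≤ 2 * (x ^ 2 + y ^ 2) := by
  nlinarith [sq_nonneg (x + y)]

/-- Each cell is adjacent to two nodes and each node is an end of two cells, cyclically. Inflow
jumps are estimated by the same cyclic pattern, which only adds nonnegative terms. -/
theorem sum_cyclic (N : ℕ) (Y : ℕ → ℝ) :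
    ∑ i ∈ Finset.range N, (Y (if i = 0 then N - 1 else i - 1) + Y (if i = N then 0 else i) +
      (Y (if i + 1 = 0 then N - 1 else i + 1 - 1) + Y (if i + 1 = N then 0 else i + 1))) =
    4 * ∑ i ∈ Finset.range N, Y i := by
  rcases N with _ | N
  · simp
  simp only [Finset.sum_add_distrib]
  have h1 : ∑ i ∈ Finset.range (N + 1), Y (if i = 0 then N + 1 - 1 else i - 1) =
      ∑ i ∈ Finset.range (N + 1), Y i := by
    rw [Finset.sum_range_succ', Finset.sum_range_succ _ N]
    simp
  have h2 : ∑ i ∈ Finset.range (N + 1), Y (if i = N + 1 then 0 else i) =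
      ∑ i ∈ Finset.range (N + 1), Y i :=
    Finset.sum_congr rfl fun i hi => by
      rw [if_neg (Finset.mem_range.1 hi).ne]
  have h3 : ∑ i ∈ Finset.range (N + 1), Y (if i + 1 = 0 then N + 1 - 1 else i + 1 - 1) =
      ∑ i ∈ Finset.range (N + 1), Y i := by
    simp
  have h4 : ∑ i ∈ Finset.range (N + 1), Y (if i + 1 = N + 1 then 0 else i + 1) =
      ∑ i ∈ Finset.range (N + 1), Y i := by
    rw [Finset.sum_range_succ, Finset.sum_range_succ' _ N, if_pos rfl]
    congr 1
    refine Finset.sum_congr rfl fun i hi => ?_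
    rw [if_neg (by have := Finset.mem_range.1 hi; omega)]
  rw [h1, h2, h3, h4]
  ring

theorem sq_sigma_le {a b : ℝ} (hab : a < b) (m : Mesh a b) (bc : BoundaryCondition) (T : ℝ)
    {k nE : ℕ} (hk : 1 ≤ k) (hnE : 1 ≤ nE) (v : ℕ → ℝ[X]) (t : ℝ) (i : ℕ) {l : ℕ} (hl : l ≤ k) :
    sigma m bc T k nE v t i l ^ 2 ≤ (2 * (2 * (k : ℝ) + 1)) ^ 2 * m.h ^ (2 * l) *
      (jump m bc T v t l i ^ 2 + jump m bc T v t l (i + 1) ^ 2) := by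
  have hk' : (1 : ℝ) ≤ k := by exact_mod_cast hk
  have hl' : (l : ℝ) ≤ k := by exact_mod_cast hl
  have hn' : (1 : ℝ) ≤ nE := by exact_mod_cast hnE
  have hh := (m.h_pos hab).le
  set J := jump m bc T v t l i ^ 2 + jump m bc T v t l (i + 1) ^ 2 with hJ
  have hJ0 : 0 ≤ J := by positivity
  have hfac : (1 : ℝ) ≤ (Nat.factorial l : ℝ) := by exact_mod_cast Nat.succ_le_of_lt l.factorial_pos
  have h1 : 2 * (2 * (l : ℝ) + 1) / (2 * (k : ℝ) - 1) ≤ 2 * (2 * (k : ℝ) + 1) := by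
    rw [div_le_iff₀ (by linarith)]
    nlinarith
  have h10 : 0 ≤ 2 * (2 * (l : ℝ) + 1) / (2 * (k : ℝ) - 1) :=
    div_nonneg (by positivity) (by linarith)
  have h2 : m.h ^ l / (Nat.factorial l : ℝ) ≤ m.h ^ l := div_le_self (by positivity) hfac
  have h3 : 1 / (nE : ℝ) * J ≤ J := by
    have : 1 / (nE : ℝ) ≤ 1 := (div_le_one (by linarith)).2 hn'
    nlinarith
  rw [sigma, ← hJ, mul_pow, mul_pow, Real.sq_sqrt (by positivity)]
  calc (2 * (2 * (l : ℝ) + 1) / (2 * (k : ℝ) - 1)) ^ 2 * (m.h ^ l / (Nat.factorial l : ℝ)) ^ 2 *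
        (1 / (nE : ℝ) * J)
      ≤ (2 * (2 * (k : ℝ) + 1)) ^ 2 * (m.h ^ l) ^ 2 * J := by gcongr
    _ = _ := by rw [← pow_mul, mul_comm l 2]

namespace ErrorSetting

variable {F : Family} {k nE : ℕ} {a b T ρ : ℝ} {bc : BoundaryCondition} {u₀ : ℝ → ℝ}
  {u : ℝ → ℝ → ℝ} {f : ℕ → ℝ → ℝ → ℝ} {m : Mesh a b} {s : ℕ → ℝ} {uh : ℕ → ℝ → ℝ[X]}
  {A : ℕ → ℝ} {β K M : ℝ}

/-- The Sobolev inequality bounds `u_x` pointwise and the interpolation error bounds the difference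
of slopes. This is the only information on the smooth part that the damping estimate uses. -/
theorem abs_derivative_interp_le (h : ErrorSetting F k nE a b T ρ bc u₀ u f m s uh A β K M)
    {i : ℕ} (hi : i < m.N) {t : ℝ} (ht : t ∈ Icc 0 T) :
    ∀ x ∈ Icc (m.node i) (m.node i + m.len i),
      |(derivative (m.interp s k i fun x => f 0 x t)).eval x| ≤ interpSlope k a b * M := by
  intro x hx
  have hL : 0 < b - a := sub_pos.2 h.hab
  have hchain := h.family.chain t ht
  have hk := h.one_le_k
  have h1 := hchain.sq_le_sobolev h.hab (l := 1) (by omega) (m.cell_subset hi hx)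
  have h2 := (hchain.of_le (m := k + 1) (by omega)).sq_sub_interp_le h.points hi hk hx
  rw [Function.iterate_one] at h2
  have h3 : m.len i ^ (2 * (k - 1) + 1) *
      ∫ y in m.node i..(m.node i + m.len i), f (k + 1) y t ^ 2 ≤
      (b - a) ^ (2 * (k - 1) + 1) * M ^ 2 :=
    mul_le_mul (pow_le_pow_left₀ (m.len_pos hi).le (m.len_le hi) _)
      (h.integral_cell_sq_le ht (by omega) hi) (cellSq_nonneg m hi _) (by positivity)
  have h4 : f 1 x t ^ 2 ≤ 2 / (b - a) * M ^ 2 + 2 * (b - a) * M ^ 2 :=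
    h1.trans (add_le_add
      (mul_le_mul_of_nonneg_left (h.integral_sq_le ht (by omega)) (by positivity))
      (mul_le_mul_of_nonneg_left (h.integral_sq_le ht (l := 2) (by omega)) (by positivity)))
  have h5 := sq_sub_le_two_mul (f 1 x t)
    (f 1 x t - (derivative (m.interp s k i fun x => f 0 x t)).eval x)
  rw [sub_sub_cancel] at h5
  rw [interpSlope, ← Real.sqrt_sq h.M_nonneg, ← Real.sqrt_mul (by positivity)]
  refine Real.abs_le_sqrt (h5.trans ?_)
  have h6 := h2.trans h3
  linarith

/-- The error of the `l`-th trace splits into that of `e`, treated by the inverse estimate and mesh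
regularity, and an interpolation error. The factor `h ^ (2 * l + 1)` matches the scaling of both and
gives a bound uniform in `l`. -/
theorem trace_error_le (h : ErrorSetting F k nE a b T ρ bc u₀ u f m s uh A β K M)
    {i : ℕ} (hi : i < m.N) {t : ℝ} (ht : t ∈ Icc 0 T) {l : ℕ} (hl : l ≤ k) {x : ℝ}
    (hx : x ∈ Icc (m.node i) (m.node i + m.len i)) :
    m.h ^ (2 * l + 1) * ((derivative^[l] (uh i t)).eval x - f l x t) ^ 2 ≤
      2 * (ρ ^ (2 * k + 1) * K * cellSq m i (fun x => (err m s k u uh i t).eval x) +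
        m.h ^ (2 * k + 2) * cellSq m i (fun x => f (k + 1) x t)) := by
  have hh := m.h_pos h.hab
  have hlen := m.len_pos hi
  have hρ := m.one_le_of_regular h.hab h.regular
  set e := err m s k u uh i t with he
  set p := m.interp s k i (fun x => f 0 x t) with hp
  have hQ := cellSq_nonneg m hi fun x => e.eval x
  have hF := cellSq_nonneg m hi fun x => f (k + 1) x t
  have hsplit : (derivative^[l] (uh i t)).eval x - f l x t =
      (derivative^[l] e).eval x - (f l x t - (derivative^[l] p).eval x) := by
    rw [h.eq_err_add hi ht, iterate_map_add derivative l, eval_add]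
    ring
  have h1 : m.h ^ (2 * l + 1) * (derivative^[l] e).eval x ^ 2 ≤
      ρ ^ (2 * k + 1) * K * cellSq m i (fun x => e.eval x) := by
    have hinv := h.inverse e (h.natDegree_err_le hi t) l hl _ _ hlen x hx
    calc m.h ^ (2 * l + 1) * (derivative^[l] e).eval x ^ 2
        ≤ (ρ * m.len i) ^ (2 * l + 1) * (derivative^[l] e).eval x ^ 2 := by
          gcongr
          exact h.regular i hi
      _ = ρ ^ (2 * l + 1) * (m.len i ^ (2 * l + 1) * (derivative^[l] e).eval x ^ 2) := by
          rw [mul_pow]; ring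
      _ ≤ ρ ^ (2 * k + 1) * (K * cellSq m i (fun x => e.eval x)) := by
          refine mul_le_mul (pow_le_pow_right₀ hρ (by omega)) hinv (by positivity) (by positivity)
      _ = _ := by ring
  have h2 : m.h ^ (2 * l + 1) * (f l x t - (derivative^[l] p).eval x) ^ 2 ≤
      m.h ^ (2 * k + 2) * cellSq m i (fun x => f (k + 1) x t) := by
    have hint := ((h.family.chain t ht).of_le (m := k + 1) (by omega)).sq_sub_interp_le
      h.points hi hl hx
    calc m.h ^ (2 * l + 1) * (f l x t - (derivative^[l] p).eval x) ^ 2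
        ≤ m.h ^ (2 * l + 1) * (m.len i ^ (2 * (k - l) + 1) *
            cellSq m i (fun x => f (k + 1) x t)) := by gcongr; exact hint
      _ ≤ m.h ^ (2 * l + 1) * (m.h ^ (2 * (k - l) + 1) *
            cellSq m i (fun x => f (k + 1) x t)) := by
          gcongr
          exact m.len_le_h hi
      _ = m.h ^ (2 * l + 1 + (2 * (k - l) + 1)) * cellSq m i (fun x => f (k + 1) x t) := by
          rw [pow_add]; ring
      _ = _ := by congr 2; omega
  rw [hsplit]
  calc m.h ^ (2 * l + 1) *
        ((derivative^[l] e).eval x - (f l x t - (derivative^[l] p).eval x)) ^ 2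
      ≤ m.h ^ (2 * l + 1) * (2 * ((derivative^[l] e).eval x ^ 2 +
          (f l x t - (derivative^[l] p).eval x) ^ 2)) := by
        gcongr; exact sq_sub_le_two_mul _ _
    _ ≤ _ := by linarith

/-- The jumps of the numerical solution are controlled by the error on the adjacent cells. -/
theorem jump_le (h : ErrorSetting F k nE a b T ρ bc u₀ u f m s uh A β K M) {t : ℝ}
    (ht : t ∈ Icc 0 T) {Y : ℕ → ℝ}
    (hY : ∀ i, Y i = ρ ^ (2 * k + 1) * K * cellSq m i (fun x => (err m s k u uh i t).eval x) +
        m.h ^ (2 * k + 2) * cellSq m i (fun x => f (k + 1) x t))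
    {l n : ℕ} (hl : l ≤ k) (hn : n ≤ m.N) :
    m.h ^ (2 * l + 1) * jump m bc T (fun i => uh i t) t l n ^ 2 ≤
      4 * (Y (if n = 0 then m.N - 1 else n - 1) + Y (if n = m.N then 0 else n)) := by
  have hN := m.N_pos h.hab
  have hh := m.h_pos h.hab
  have hρ := m.one_le_of_regular h.hab h.regular
  have hY0 : ∀ i < m.N, 0 ≤ Y i := fun i hi => by
    rw [hY]
    have h1 := cellSq_nonneg m hi fun x => (err m s k u uh i t).eval x
    have h2 := cellSq_nonneg m hi fun x => f (k + 1) x t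
    have := h.K_pos
    positivity
  have htr : ∀ i < m.N, ∀ x ∈ Icc (m.node i) (m.node i + m.len i),
      m.h ^ (2 * l + 1) * ((derivative^[l] (uh i t)).eval x - f l x t) ^ 2 ≤ 2 * Y i := by
    intro i hi x hx
    rw [hY]; exact h.trace_error_le hi ht hl hx
  have hleft : ∀ i < m.N, m.node i ∈ Icc (m.node i) (m.node i + m.len i) := fun i hi =>
    ⟨le_rfl, by linarith [m.len_pos hi]⟩
  have hright : ∀ i < m.N, m.node (i + 1) ∈ Icc (m.node i) (m.node i + m.len i) := fun i hi =>
    ⟨by rw [m.node_succ]; linarith [m.len_pos hi], by rw [m.node_succ]⟩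
  have ha : m.h ^ (2 * l + 1) * ((derivative^[l] (uh 0 t)).eval a - f l a t) ^ 2 ≤ 2 * Y 0 :=
    htr 0 hN a (by
      have := hleft 0 hN; simp only [m.node_zero] at this ⊢; exact this)
  have hcomb : ∀ p q c Y₁ Y₂ : ℝ, m.h ^ (2 * l + 1) * (p - c) ^ 2 ≤ 2 * Y₁ →
      m.h ^ (2 * l + 1) * (q - c) ^ 2 ≤ 2 * Y₂ →
      m.h ^ (2 * l + 1) * (q - p) ^ 2 ≤ 4 * (Y₁ + Y₂) := by
    intro p q c Y₁ Y₂ h1 h2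
    have h3 := sq_sub_le_two_mul (q - c) (p - c)
    rw [sub_sub_sub_cancel_right] at h3
    have := mul_le_mul_of_nonneg_left h3 (pow_pos hh (2 * l + 1)).le
    linarith
  have hp : (if n = 0 then m.N - 1 else n - 1) < m.N := by split_ifs <;> omega
  have hq : (if n = m.N then 0 else n) < m.N := by split_ifs <;> omega
  by_cases hend : n = 0 ∨ n = m.N
  · have hbd := h.exact.boundary
    have hsol := h.exact
    rw [jump.eq_def, if_pos hend]
    cases bc with
    | periodic =>
      have e1 : (if n = 0 then m.N - 1 else n - 1) = m.N - 1 := by split_ifs <;> omega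
      have e2 : (if n = m.N then 0 else n) = 0 := by split_ifs <;> omega
      rw [e1, e2]
      -- Periodicity is only assumed for `u`. Its space derivatives at both end points are, up to
      -- the same sign, time derivatives of one common boundary function.
      have hper : f l b t = f l a t := by
        have i1 := h.family.iteratedDerivWithin_eq h.hT (x := a)
          (fun l hl t ht => h.family.hasDerivWithinAt_time_left hsol h.hab hl ht)
          (g := fun t => u a t) (fun _ _ => rfl) (l := l) (by omega) ht
        have i2 := h.family.iteratedDerivWithin_eq h.hT (x := b)
          (fun l hl t ht => h.family.hasDerivWithinAt_time_right hsol h.hab hl ht)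
          (g := fun t => u a t) (fun t ht => (hbd t ht).symm) (l := l) (by omega) ht
        exact mul_left_cancel₀ (pow_ne_zero l (by norm_num)) (i2.symm.trans i1)
      have hb := htr (m.N - 1) (by omega) b (by
        have := hright (m.N - 1) (by omega)
        rw [Nat.sub_add_cancel hN, m.node_last] at this
        exact this)
      rw [hper] at hb
      exact hcomb _ _ _ _ _ hb ha
    | inflow g useData =>
      dsimp only
      have h1 := hY0 _ hp
      have h2 := hY0 _ hq
      by_cases h0 : n = 0 ∧ useData = true
      · rw [if_pos h0]
        obtain ⟨rfl, -⟩ := h0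
        have i1 := h.family.iteratedDerivWithin_eq h.hT (x := a)
          (fun l hl t ht => h.family.hasDerivWithinAt_time_left hsol h.hab hl ht)
          (g := g) hbd (l := l) (by omega) ht
        have e1 : (-1 : ℝ) ^ l * ((-1) ^ l * f l a t) = f l a t := by
          rw [← mul_assoc, ← mul_pow]; simp
        have e2 : (if 0 = m.N then 0 else 0) = 0 := by split_ifs <;> rfl
        rw [e2] at h2
        rw [i1, e1, e2]
        refine ha.trans ?_
        linarith
      · rw [if_neg h0, zero_pow two_ne_zero, mul_zero]
        linarith
  · rw [jump.eq_def, if_neg hend]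
    have hn0 : n ≠ 0 := fun h => hend (Or.inl h)
    have hnN : n ≠ m.N := fun h => hend (Or.inr h)
    rw [if_neg hn0, if_neg hnN]
    refine hcomb _ _ (f l (m.node n) t) _ _ (htr (n - 1) (by omega) _ ?_)
      (htr n (by omega) _ (hleft n (by omega)))
    have := hright (n - 1) (by omega)
    rwa [Nat.sub_add_cancel (Nat.pos_of_ne_zero hn0)] at this

theorem young {w x S l : ℝ} (hS : 0 ≤ S) (hl : 0 ≤ l) :
    x / l * (w * (l ^ 2 * S)) ≤ S / 2 * (l * x ^ 2 + l * w ^ 2) := by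
  rcases hl.eq_or_lt with rfl | hl
  · simp
  have e : x / l * (w * (l ^ 2 * S)) = S * l * (x * w) := by field_simp
  rw [e]
  nlinarith [mul_nonneg (mul_nonneg hS hl.le) (sq_nonneg (x - w))]

/-- The rate of change of the energy on one spectral volume. -/
theorem massForm_errDot_le (h : ErrorSetting F k nE a b T ρ bc u₀ u f m s uh A β K M)
    {i : ℕ} (hi : i < m.N) {t : ℝ} (ht : t ∈ Ioc 0 T) :
    massForm k β (m.node i) (m.len i) (errDot m T s k (f 1) uh i t) (err m s k u uh i t) ≤
      (upwindErr m bc s u uh t i 0 ^ 2 -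
          (err m s k u uh i t).eval (m.node i + m.len i) ^ 2) / 2 +
        (∑ l ∈ Finset.range (k + 1), interpSlope k a b * M / 2 *
          ((2 * (2 * (k : ℝ) + 1)) ^ 2 * (m.h ^ (2 * l + 1) *
              jump m bc T (fun i => uh i t) t l i ^ 2 + m.h ^ (2 * l + 1) *
              jump m bc T (fun i => uh i t) t l (i + 1) ^ 2) +
            4 * K * cellSq m i (fun x => (err m s k u uh i t).eval x))) +
        (4 * K * cellSq m i (fun x => (err m s k u uh i t).eval x) +
          m.h ^ (2 * k + 2) * cellSq m i (fun x => f (k + 2) x t)) / 2 := by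
  have ht' := Ioc_subset_Icc_self ht
  have hk := h.one_le_k
  have hlen := m.len_pos hi
  have hh := m.h_pos h.hab
  set α := m.node i with hα
  set L := m.len i with hL
  set e := err m s k u uh i t with he
  set d := errDot m T s k (f 1) uh i t with hd
  have hed : e.natDegree ≤ k := h.natDegree_err_le hi t
  have hdd : d.natDegree ≤ k := m.natDegree_interp_le h.points hi _
  set Q := cellSq m i (fun x => e.eval x) with hQdef
  have hQ0 : 0 ≤ Q := cellSq_nonneg m hi _
  have hK := h.K_pos
  set W := 2 * √(K * Q / L) with hWdef
  have hW0 : 0 ≤ W := by positivity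
  -- This normalisation lets Young's inequality turn each factor `W` into the local energy without
  -- negative powers of the cell length.
  have hLW : L * W ^ 2 = 4 * K * Q := by
    rw [hWdef, mul_pow, Real.sq_sqrt (by positivity)]
    field_simp
    ring
  have hW : ∀ j ≤ k, |testVal s A α L e j| ≤ W := fun j hj =>
    abs_testVal_le h.points h.quadrature hk h.inverse α hlen hed (by omega)
  have hsum := h.quadrature.sum_testVal_mul_integral hk α hlen hdd hed h.points.zero h.points.last
  rw [← massForm_apply] at hsum
  rw [← hsum]
  have hcv : ∀ j ∈ Finset.range (k + 1), testVal s A α L e j *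
      ∫ x in (α + L * s j)..(α + L * s (j + 1)), d.eval x =
      -(testVal s A α L e j * (upwindErr m bc s u uh t i (j + 1) - upwindErr m bc s u uh t i j)) +
      (∑ l ∈ Finset.range (k + 1), sigma m bc T k nE (fun n => uh n t) t i l / L *
        -(testVal s A α L e j * ∫ x in (α + L * s j)..(α + L * s (j + 1)),
          (uh i t - l2Proj α (α + L) (l - 1) (uh i t)).eval x)) +
      -(testVal s A α L e j * ∫ x in (α + L * s j)..(α + L * s (j + 1)),
        (f 1 x t - (m.interp s k i (fun x => f 1 x t)).eval x)) := by
    intro j hj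
    have hj : j ≤ k := by have := Finset.mem_range.1 hj; omega
    have h1 := h.integral_errDot hi ht hj
    rw [m.node_succ] at h1
    have h2 : ∫ x in (α + L * s j)..(α + L * s (j + 1)), d.eval x =
      ∫ x in m.pt s i j..m.pt s i (j + 1), (errDot m T s k (f 1) uh i t).eval x := rfl
    rw [h2, h1, mul_sub, mul_sub, Finset.mul_sum, sub_eq_add_neg, sub_eq_add_neg,
      ← Finset.sum_neg_distrib, mul_neg]
    congr 2
    exact Finset.sum_congr rfl fun l _ => by
      simp only [Mesh.pt, ← hα, ← hL]
      ring
  rw [Finset.sum_congr rfl hcv, Finset.sum_add_distrib, Finset.sum_add_distrib, Finset.sum_comm]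
  refine add_le_add (add_le_add ?_ ?_) ?_
  · have hfl := h.quadrature.sum_testVal_mul_flux hk α hlen hed hed
      (fun j => upwindErr m bc s u uh t i j) h.points.last
      (fun j hj => h.upwindErr_succ hi t hj)
    rw [Finset.sum_neg_distrib, hfl, integral_derivative_mul_self]
    -- Upwinding: completing the square at the left end point leaves incoming minus outgoing energy.
    nlinarith [sq_nonneg (e.eval α - upwindErr m bc s u uh t i 0)]
  · refine Finset.sum_le_sum fun l hl => ?_
    have hl : l ≤ k := by have := Finset.mem_range.1 hl; omega
    rw [← Finset.mul_sum, Finset.sum_neg_distrib]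
    set σ := sigma m bc T k nE (fun n => uh n t) t i l with hσ
    have hσ0 : 0 ≤ σ := by
      rw [hσ, sigma]
      have : (1 : ℝ) ≤ k := by exact_mod_cast hk
      have h1 : 0 ≤ 2 * (2 * (l : ℝ) + 1) / (2 * (k : ℝ) - 1) :=
        div_nonneg (by positivity) (by linarith)
      positivity
    have hS0 : 0 ≤ interpSlope k a b * M := mul_nonneg (Real.sqrt_nonneg _) h.M_nonneg
    -- The truncated `l - 1` is at most `k - 1`, also for `l = 0` since `k ≥ 1`.
    have hdamp := neg_sum_testVal_mul_damping_le h.points h.quadrature hk hlen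
      (n := l - 1) (by omega) (h.eq_err_add hi ht') hed (h.abs_derivative_interp_le hi ht') hW
    have h1 := mul_le_mul_of_nonneg_left hdamp (div_nonneg hσ0 hlen.le)
    refine h1.trans ((young hS0 hlen.le).trans ?_)
    have h2 := sq_sigma_le h.hab m bc T hk h.one_le_nE (fun n => uh n t) t i hl
    rw [← hσ] at h2
    refine mul_le_mul_of_nonneg_left ?_ (by positivity)
    rw [hLW]
    refine add_le_add ?_ le_rfl
    calc L * σ ^ 2 ≤ m.h * ((2 * (2 * (k : ℝ) + 1)) ^ 2 * m.h ^ (2 * l) *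
          (jump m bc T (fun n => uh n t) t l i ^ 2 +
            jump m bc T (fun n => uh n t) t l (i + 1) ^ 2)) :=
          mul_le_mul (m.len_le_h hi) h2 (sq_nonneg _) hh.le
      _ = _ := by rw [pow_succ]; ring
  · have hchain := ((h.family.chain t ht').tail)
    set g : ℝ → ℝ := fun x => f 1 x t - (m.interp s k i (fun x => f 1 x t)).eval x with hg
    set G := cellSq m i (fun x => f (k + 2) x t) with hG
    have hG0 : 0 ≤ G := cellSq_nonneg m hi _
    have hsub := (Icc_subset_Icc_iff (by linarith [m.len_pos hi])).1 (m.cell_subset hi)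
    have hgc : ContinuousOn g (Icc α (α + L)) :=
      ((hchain.continuousOn 0 (by omega)).mono (m.cell_subset hi)).sub
        (Polynomial.continuous _).continuousOn
    have hαL : α ≤ α + L := by linarith
    have hgI : IntervalIntegrable g volume α (α + L) := by
      refine ContinuousOn.intervalIntegrable ?_
      rwa [uIcc_of_le hαL]
    have hbd := abs_sum_mul_integral_le h.points α hlen hW hgI
    set X := ∫ x in α..(α + L), |g x| with hX
    -- The shifted chain starts at `u_x`, so its interpolation error involves the derivative of
    -- order `k + 2`; this is where the full regularity is used.
    have hX2 : X ^ 2 ≤ L * (L * (L ^ (2 * k + 1) * G)) := by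
      have h1 := sq_integral_abs_le hαL (memLp_of_continuousOn hgc)
      rw [add_sub_cancel_left] at h1
      have h2 : ∀ x ∈ Icc α (α + L), g x ^ 2 ≤ L ^ (2 * k + 1) * G := fun x hx =>
        hchain.sq_sub_interp_le h.points hi (l := 0) (Nat.zero_le k) hx
      have h3 := intervalIntegral.integral_mono_on hαL
        (intervalIntegrable_sq_of_memLp hαL (memLp_of_continuousOn hgc))
        (g := fun _ => L ^ (2 * k + 1) * G) (by simp) h2
      rw [intervalIntegral.integral_const, smul_eq_mul, add_sub_cancel_left] at h3
      exact h1.trans (mul_le_mul_of_nonneg_left h3 hlen.le)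
    have hWX : W * X ≤ (4 * K * Q + L ^ (2 * k + 2) * G) / 2 := by
      have h1 : L * (2 * (W * X)) ≤ L * (4 * K * Q + L ^ (2 * k + 2) * G) := by
        have h2 : L * (L ^ (2 * k + 2) * G) = L * (L * (L ^ (2 * k + 1) * G)) := by ring
        rw [mul_add, h2, ← hLW]
        nlinarith [sq_nonneg (L * W - X)]
      have := le_of_mul_le_mul_left h1 hlen
      linarith
    have hLh : L ^ (2 * k + 2) * G ≤ m.h ^ (2 * k + 2) * G := by
      gcongr
      exact m.len_le_h hi
    rw [Finset.sum_neg_distrib]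
    have := neg_abs_le (∑ j ∈ Finset.range (k + 1), testVal s A α L e j *
      ∫ x in (α + L * s j)..(α + L * s (j + 1)), g x)
    linarith

/-- The constant in the differential inequality for the energy. -/
def growthRate (k : ℕ) (a b ρ K M : ℝ) : ℝ :=
  (k + 1) * (interpSlope k a b * M) *
    ((2 * (2 * (k : ℝ) + 1)) ^ 2 * 16 * (ρ ^ (2 * k + 1) * K + M ^ 2) + 4 * K) + 4 * K + M ^ 2

theorem sum_massForm_errDot_le (h : ErrorSetting F k nE a b T ρ bc u₀ u f m s uh A β K M)
    {t : ℝ} (ht : t ∈ Ioc 0 T) :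
    ∑ i ∈ Finset.range m.N, 2 *
        massForm k β (m.node i) (m.len i) (errDot m T s k (f 1) uh i t) (err m s k u uh i t) ≤
      growthRate k a b ρ K M * ((∑ i ∈ Finset.range m.N,
        massForm k β (m.node i) (m.len i) (err m s k u uh i t) (err m s k u uh i t)) +
          m.h ^ (2 * k + 2)) := by
  have ht' := Ioc_subset_Icc_self ht
  have hh := m.h_pos h.hab
  have hK := h.K_pos
  have hM := h.M_nonneg
  have hρ := m.one_le_of_regular h.hab h.regular
  have hS0 : 0 ≤ interpSlope k a b * M := mul_nonneg (Real.sqrt_nonneg _) hM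
  set S := interpSlope k a b * M with hS
  set H := m.h ^ (2 * k + 2) with hH
  have hH0 : 0 < H := pow_pos hh _
  set c := (2 * (2 * (k : ℝ) + 1)) ^ 2 with hc
  have hc0 : 0 ≤ c := sq_nonneg _
  set Q : ℕ → ℝ := fun i => cellSq m i (fun x => (err m s k u uh i t).eval x) with hQ
  set G : ℕ → ℝ := fun i => cellSq m i (fun x => f (k + 1) x t) with hG
  set G' : ℕ → ℝ := fun i => cellSq m i (fun x => f (k + 2) x t) with hG'
  set Y : ℕ → ℝ := fun i => ρ ^ (2 * k + 1) * K * Q i + H * G i with hY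
  set E := ∑ i ∈ Finset.range m.N,
    massForm k β (m.node i) (m.len i) (err m s k u uh i t) (err m s k u uh i t) with hE
  have hQE : ∑ i ∈ Finset.range m.N, Q i ≤ E := Finset.sum_le_sum fun i hi =>
    integral_sq_le_massForm k h.quadrature.defect_nonneg _
      (m.len_pos (Finset.mem_range.1 hi)).le _
  have hQ0 : 0 ≤ ∑ i ∈ Finset.range m.N, Q i :=
    Finset.sum_nonneg fun i hi => cellSq_nonneg m (Finset.mem_range.1 hi) _
  have hGsum : ∑ i ∈ Finset.range m.N, G i ≤ M ^ 2 := by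
    have := m.sum_integral h.hab.le (h.intervalIntegrable_sq ht' (l := k + 1) (by omega))
    exact this.le.trans (h.integral_sq_le ht' (by omega))
  have hGsum' : ∑ i ∈ Finset.range m.N, G' i ≤ M ^ 2 := by
    have := m.sum_integral h.hab.le (h.intervalIntegrable_sq ht' (l := k + 2) (by omega))
    exact this.le.trans (h.integral_sq_le ht' (by omega))
  have hYsum : ∑ i ∈ Finset.range m.N, Y i ≤
      ρ ^ (2 * k + 1) * K * (∑ i ∈ Finset.range m.N, Q i) + H * M ^ 2 := by
    rw [hY, Finset.sum_add_distrib, ← Finset.mul_sum, ← Finset.mul_sum]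
    gcongr
  -- The factor `16` is the `4` of the jump bound times the `4` occurrences of each cell.
  have hjump : ∀ l ∈ Finset.range (k + 1), ∑ i ∈ Finset.range m.N,
      (m.h ^ (2 * l + 1) * jump m bc T (fun i => uh i t) t l i ^ 2 +
        m.h ^ (2 * l + 1) * jump m bc T (fun i => uh i t) t l (i + 1) ^ 2) ≤
      16 * ∑ i ∈ Finset.range m.N, Y i := by
    intro l hl
    have hl : l ≤ k := by have := Finset.mem_range.1 hl; omega
    have e : 16 * ∑ i ∈ Finset.range m.N, Y i = 4 * (4 * ∑ i ∈ Finset.range m.N, Y i) := by ring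
    rw [e, ← sum_cyclic, Finset.mul_sum]
    refine Finset.sum_le_sum fun i hi => ?_
    have hi := Finset.mem_range.1 hi
    rw [mul_add]
    exact add_le_add (h.jump_le ht' (fun _ => rfl) hl hi.le) (h.jump_le ht' (fun _ => rfl) hl hi)
  have hup := h.sum_sq_upwindErr_le ht'
  have hcell := Finset.sum_le_sum fun i (hi : i ∈ Finset.range m.N) =>
    h.massForm_errDot_le (Finset.mem_range.1 hi) ht
  rw [Finset.sum_add_distrib, Finset.sum_add_distrib, ← Finset.sum_div, Finset.sum_sub_distrib,
    ← Finset.sum_div, Finset.sum_add_distrib, ← Finset.mul_sum, ← Finset.mul_sum,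
    Finset.sum_comm] at hcell
  have hdamp : ∑ l ∈ Finset.range (k + 1), ∑ i ∈ Finset.range m.N, S / 2 *
      (c * (m.h ^ (2 * l + 1) * jump m bc T (fun i => uh i t) t l i ^ 2 +
        m.h ^ (2 * l + 1) * jump m bc T (fun i => uh i t) t l (i + 1) ^ 2) + 4 * K * Q i) ≤
      (k + 1) * (S / 2 * (c * (16 * ∑ i ∈ Finset.range m.N, Y i) +
        4 * K * ∑ i ∈ Finset.range m.N, Q i)) := by
    have : ∀ l ∈ Finset.range (k + 1), ∑ i ∈ Finset.range m.N, S / 2 *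
      (c * (m.h ^ (2 * l + 1) * jump m bc T (fun i => uh i t) t l i ^ 2 +
        m.h ^ (2 * l + 1) * jump m bc T (fun i => uh i t) t l (i + 1) ^ 2) + 4 * K * Q i) ≤
      S / 2 * (c * (16 * ∑ i ∈ Finset.range m.N, Y i) +
        4 * K * ∑ i ∈ Finset.range m.N, Q i) := by
      intro l hl
      rw [← Finset.mul_sum, Finset.sum_add_distrib, ← Finset.mul_sum, ← Finset.mul_sum]
      have := hjump l hl
      gcongr
    refine (Finset.sum_le_sum this).trans (le_of_eq ?_)
    rw [Finset.sum_const, Finset.card_range, nsmul_eq_mul]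
    push_cast
    ring
  have hdamp2 : (k + 1) * (S / 2 * (c * (16 * ∑ i ∈ Finset.range m.N, Y i) +
        4 * K * ∑ i ∈ Finset.range m.N, Q i)) ≤
      (k + 1) * (S / 2 * (c * (16 * (ρ ^ (2 * k + 1) * K * E + H * M ^ 2)) + 4 * K * E)) := by
    have h1 : ρ ^ (2 * k + 1) * K * (∑ i ∈ Finset.range m.N, Q i) ≤ ρ ^ (2 * k + 1) * K * E := by
      gcongr
    have h2 : ∑ i ∈ Finset.range m.N, Y i ≤ ρ ^ (2 * k + 1) * K * E + H * M ^ 2 := by linarith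
    gcongr
  have hE0 : 0 ≤ E := hQ0.trans hQE
  rw [← Finset.mul_sum]
  have hrest : 4 * K * (∑ i ∈ Finset.range m.N, Q i) + H * (∑ i ∈ Finset.range m.N, G' i) ≤
      4 * K * E + H * M ^ 2 := by gcongr
  have hfin : 2 * ((k + 1) * (S / 2 *
      (c * (16 * (ρ ^ (2 * k + 1) * K * E + H * M ^ 2)) + 4 * K * E))) +
      (4 * K * E + H * M ^ 2) ≤ growthRate k a b ρ K M * (E + H) := by
    -- `growthRate` multiplies `E + H` as a whole, so the products with the wrong partner are
    -- surplus, and they are nonnegative.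
    have hx : 0 ≤ (k + 1) * S * (c * 16 * (ρ ^ (2 * k + 1) * K) * H + c * 16 * M ^ 2 * E +
        4 * K * H) + 4 * K * H + M ^ 2 * E := by positivity
    have hid : growthRate k a b ρ K M * (E + H) = 2 * ((k + 1) * (S / 2 *
      (c * (16 * (ρ ^ (2 * k + 1) * K * E + H * M ^ 2)) + 4 * K * E))) +
      (4 * K * E + H * M ^ 2) +
      ((k + 1) * S * (c * 16 * (ρ ^ (2 * k + 1) * K) * H + c * 16 * M ^ 2 * E +
        4 * K * H) + 4 * K * H + M ^ 2 * E) := by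
      rw [growthRate, ← hS, ← hc]; ring
    linarith
  linarith

theorem growthRate_nonneg (h : ErrorSetting F k nE a b T ρ bc u₀ u f m s uh A β K M) :
    0 ≤ growthRate k a b ρ K M := by
  have hK := h.K_pos
  have hM := h.M_nonneg
  have hρ := m.one_le_of_regular h.hab h.regular
  have hS0 : 0 ≤ interpSlope k a b * M := mul_nonneg (Real.sqrt_nonneg _) hM
  rw [growthRate]
  positivity

/-- Grönwall for the energy, which starts at zero because the initial value interpolates `u₀` at the
same nodes. Only its lower bound by the `L²` norm is used afterwards, so `β` never enters the
constant. -/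
theorem sum_cellSq_err_le (h : ErrorSetting F k nE a b T ρ bc u₀ u f m s uh A β K M) {t : ℝ}
    (ht : t ∈ Icc 0 T) :
    ∑ i ∈ Finset.range m.N, cellSq m i (fun x => (err m s k u uh i t).eval x) ≤
      m.h ^ (2 * k + 2) * Real.exp (growthRate k a b ρ K M * T) := by
  have hk := h.one_le_k
  have hgron := le_mul_exp_of_deriv_le (T := T) h.growthRate_nonneg
    (E := fun t => ∑ i ∈ Finset.range m.N,
      massForm k β (m.node i) (m.len i) (err m s k u uh i t) (err m s k u uh i t))
    (E' := fun t => ∑ i ∈ Finset.range m.N, 2 *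
      massForm k β (m.node i) (m.len i) (errDot m T s k (f 1) uh i t) (err m s k u uh i t))
    (pow_pos (m.h_pos h.hab) (2 * k + 2)).le ?_ ?_ ?_ (fun t ht => h.sum_massForm_errDot_le ht)
    t ht
  · refine le_trans (Finset.sum_le_sum fun i hi => ?_) hgron
    exact integral_sq_le_massForm k h.quadrature.defect_nonneg _
      (m.len_pos (Finset.mem_range.1 hi)).le _
  · refine continuousOn_finsetSum _ fun i hi => ?_
    have hi := Finset.mem_range.1 hi
    refine continuousOn_bilin_interpolate _ _ _ fun j hj => ?_
    have hx := m.cell_subset hi (m.pt_mem h.points hi (j := j + 1)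
      (by have := Finset.mem_range.1 hj; omega))
    exact (h.solution.continuousOn i hi _).sub
      (h.exact.continuousOn.comp (f := fun r : ℝ => (m.pt s i (j + 1), r)) (by fun_prop)
        fun r hr => ⟨hx, hr⟩)
  · refine Finset.sum_eq_zero fun i hi => ?_
    have hi := Finset.mem_range.1 hi
    have : err m s k u uh i 0 = 0 := by
      rw [err, Mesh.interp, Lagrange.interpolate_apply]
      refine Finset.sum_eq_zero fun j hj => ?_
      have hj := Finset.mem_range.1 hj
      have hx := m.cell_subset hi (m.pt_mem h.points hi (j := j + 1) (by omega))
      rw [h.solution.initial i hi (j + 1) (by omega) (by omega), h.exact.initial _ hx, sub_self]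
      simp
    rw [this]; simp
  · intro t ht
    refine HasDerivWithinAt.fun_sum fun i hi => ?_
    have hi := Finset.mem_range.1 hi
    refine hasDerivWithinAt_bilin_interpolate _ (massForm_comm _ _ _ _) _ _ fun j hj => ?_
    have hx := m.cell_subset hi (m.pt_mem h.points hi (j := j + 1)
      (by have := Finset.mem_range.1 hj; omega))
    have h1 := (h.solution.differentiable i hi (m.pt s i (j + 1)) t ht).hasDerivWithinAt
    have h2 := h.family.hasDerivWithinAt_time h.exact h.hab (by omega) hx ht
    exact (h1.sub h2).congr_deriv (by ring)

theorem l2Error_le (h : ErrorSetting F k nE a b T ρ bc u₀ u f m s uh A β K M) {t : ℝ}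
    (ht : t ∈ Icc 0 T) : l2Error m (fun x => u x t) (fun i => uh i t) ≤
      √(2 * (Real.exp (growthRate k a b ρ K M * T) + M ^ 2)) * m.h ^ (k + 1) := by
  have hh := m.h_pos h.hab
  have hchain := h.family.chain t ht
  have hcell : ∀ i ∈ Finset.range m.N,
      ∫ x in m.node i..m.node (i + 1), (u x t - (uh i t).eval x) ^ 2 ≤
        2 * (cellSq m i (fun x => (err m s k u uh i t).eval x) +
          m.h ^ (2 * k + 2) * cellSq m i (fun x => f (k + 1) x t)) := by
    intro i hi
    have hi := Finset.mem_range.1 hi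
    have hlen := m.len_pos hi
    have hα : m.node i ≤ m.node i + m.len i := by linarith
    have hG := cellSq_nonneg m hi (fun x => f (k + 1) x t)
    set p := m.interp s k i (fun x => f 0 x t) with hp
    set e := err m s k u uh i t with he
    set G := cellSq m i (fun x => f (k + 1) x t) with hGdef
    rw [m.node_succ]
    have hpt : ∀ x ∈ Icc (m.node i) (m.node i + m.len i), (u x t - (uh i t).eval x) ^ 2 ≤
        2 * e.eval x ^ 2 + 2 * (m.len i ^ (2 * k + 1) * G) := by
      intro x hx
      have h1 := (hchain.of_le (m := k + 1) (by omega)).sq_sub_interp_le h.points hi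
        (l := 0) (Nat.zero_le k) hx
      have h2 : u x t - (uh i t).eval x = (f 0 x t - p.eval x) - e.eval x := by
        rw [h.eq_err_add hi ht, eval_add, h.family.zero t ht]; ring
      rw [h2]
      have h3 := sq_sub_le_two_mul (f 0 x t - p.eval x) (e.eval x)
      simp only [Function.iterate_zero, id] at h1
      have h4 : (f 0 x t - p.eval x) ^ 2 ≤ m.len i ^ (2 * k + 1) * G := h1
      linarith
    have hcont : ContinuousOn (fun x => u x t - (uh i t).eval x)
        (Icc (m.node i) (m.node i + m.len i)) :=
      ((h.exact.continuousOn_space ht).mono (m.cell_subset hi)).sub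
        (Polynomial.continuous _).continuousOn
    have he2 : IntervalIntegrable (fun x => e.eval x ^ 2) volume (m.node i)
        (m.node i + m.len i) :=
      (by fun_prop : Continuous fun x => e.eval x ^ 2).intervalIntegrable _ _
    have hmono := intervalIntegral.integral_mono_on hα
      (intervalIntegrable_sq_of_memLp hα (memLp_of_continuousOn hcont))
      ((he2.const_mul 2).add (by simp)) hpt
    refine hmono.trans ?_
    rw [intervalIntegral.integral_add (he2.const_mul 2) (by simp),
      intervalIntegral.integral_const_mul, intervalIntegral.integral_const, smul_eq_mul,
      add_sub_cancel_left]
    have h5 : m.len i * (m.len i ^ (2 * k + 1) * G) ≤ m.h ^ (2 * k + 2) * G := by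
      calc m.len i * (m.len i ^ (2 * k + 1) * G) = m.len i ^ (2 * k + 2) * G := by ring
        _ ≤ _ := by gcongr; exact m.len_le_h hi
    have h6 : cellSq m i (fun x => e.eval x) =
      ∫ x in m.node i..(m.node i + m.len i), e.eval x ^ 2 := rfl
    rw [h6]
    linarith
  have hG : ∑ i ∈ Finset.range m.N, cellSq m i (fun x => f (k + 1) x t) ≤ M ^ 2 := by
    have := m.sum_integral h.hab.le (h.intervalIntegrable_sq ht (l := k + 1) (by omega))
    exact this.le.trans (h.integral_sq_le ht (by omega))
  have hsum := Finset.sum_le_sum hcell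
  rw [← Finset.mul_sum, Finset.sum_add_distrib, ← Finset.mul_sum] at hsum
  have herr := h.sum_cellSq_err_le ht
  have hG' := mul_le_mul_of_nonneg_left hG (pow_pos hh (2 * k + 2)).le
  have hpow : m.h ^ (k + 1) = √(m.h ^ (2 * k + 2)) := by
    rw [show 2 * k + 2 = (k + 1) * 2 by ring, pow_mul, Real.sqrt_sq (pow_pos hh _).le]
  rw [l2Error, hpow, ← Real.sqrt_mul (by positivity)]
  refine Real.sqrt_le_sqrt (hsum.trans ?_)
  linarith

end ErrorSetting

end OFSV

end

/-! ### The convergence theorem -/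

theorem theorem3p2 (F : OFSV.Family) (k nE : ℕ) (hk : 1 ≤ k) (hnE : 1 ≤ nE)
    (a b T ρ : ℝ) (hab : a < b) (hT : 0 < T) :
    ∃ C : ℝ → ℝ, ∀ (bc : OFSV.BoundaryCondition) (u₀ : ℝ → ℝ) (u : ℝ → ℝ → ℝ),
      OFSV.IsExactSolution bc a b T u₀ u →
      (∀ t ∈ Set.Icc 0 T, OFSV.MemH a b (k + 2) (fun x => u x t)) →
      ∃ M : ℝ, IsLUB ((fun t => OFSV.hNorm a b (k + 2) (fun x => u x t)) '' Set.Icc 0 T) M ∧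
        ∀ (m : OFSV.Mesh a b) (s : ℕ → ℝ) (uh : ℕ → ℝ → Polynomial ℝ),
          m.Regular ρ → OFSV.IsCVPoints F k s → OFSV.IsSolution m bc T k nE s u₀ uh →
          ∀ t ∈ Set.Icc 0 T,
            OFSV.l2Error m (fun x => u x t) (fun i => uh i t) ≤ C M * m.h ^ (k + 1) := by
  obtain ⟨K, hK, hinv⟩ := OFSV.exists_inverse_estimate k hk
  -- `K` depends on `k` alone, and neither the quadrature weights nor the defect occur, so the
  -- constant is fixed before the mesh, the points and the solution.
  refine ⟨fun M => √(2 * (Real.exp (OFSV.ErrorSetting.growthRate k a b ρ K M * T) + M ^ 2)),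
    fun bc u₀ u hu hH => ?_⟩
  have hlub := isLUB_csSup
    (Set.Nonempty.image (fun t => OFSV.hNorm a b (k + 2) (fun x => u x t))
      (Set.nonempty_Icc.2 hT.le)) (hu.bddAbove_hNorm hab hH)
  refine ⟨_, hlub, fun m s uh hρ hs hsol t ht => ?_⟩
  obtain ⟨f, hf⟩ := hu.exists_derivFamily hab (by omega) hH
  obtain ⟨A, β, hA, hβ, hq⟩ := hs.exists_quadrature
  exact OFSV.ErrorSetting.l2Error_le
    { one_le_k := hk, one_le_nE := hnE, hab := hab, hT := hT, exact := hu, family := hf,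
      regular := hρ, points := hs, solution := hsol, quadrature := ⟨hA, hβ, hq⟩, K_pos := hK,
      inverse := hinv, hNorm_le := fun t ht => hlub.1 ⟨t, ht, rfl⟩ } ht
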